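/- A \emph{fullerene} is a simple convex $3$-polytope in $\mathbb R^3$ all of whose facets are pentagons and hexagons. A \emph{$5$-belt} of a simple $3$-polytope is a cyclic sequence $(F_1,\dots,F_5)$ of facets (considered up to rotation and reversal, or equivalently as a set of facets) such that $F_1\cap F_2,\ F_2\cap F_3,\ F_3\cap F_4,\ F_4\cap F_5,\ F_5\cap F_1$ are edges, no other two of the five facets intersect, and $F_1\cap\dots\cap F_5=\varnothing$. The belt \emph{surrounds} a facet $F$ if its members are exactly the facets that share an edge with $F$. Two polytopes are \emph{combinatorially equivalent} if there is a bijection between their sets of faces that preserves inclusion in both directions. For $k\ge 0$ let $D_k$ be the combinatorial simple $3$-polytope obtained as follows: cut the surface of the dodecahedron along a zigzag cycle into two caps, each consisting of a pentagon and the five pentagons adjacent to it, and insert between the caps $k$ successive $5$-belts of hexagons, each hexagon meeting its two neighbours in the same belt in opposite edges. Explicitly, the facets of $D_k$ are $b$, $t$ and $f_{r,i}$ with $0\le r\le k+1$, $i\in\mathbb Z/5$, and its vertices correspond to the triples $\{b,f_{0,i},f_{0,i+1}\}$, $\{t,f_{k+1,i},f_{k+1,i+1}\}$, and, for $0\le r\le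 k$, $\{f_{r,i},f_{r,i+1},f_{r+1,i+1}\}$ and $\{f_{r,i},f_{r+1,i},f_{r+1,i+1}\}$ of facets that meet there; its faces are the intersections of facets. \textbf{Theorem.} Let $P$ be a fullerene. I. Every pentagonal facet of $P$ is surrounded by a $5$-belt, and there are exactly $12$ $5$-belts that surround a pentagonal facet. II. If $P$ has a $5$-belt that does not surround a pentagonal facet, then (1) every such belt consists only of hexagons; (2) $P$ is combinatorially equivalent to $D_k$ for some $k\ge 1$; and (3) for this $k$, the number of all $5$-belts of $P$ is exactly $12+k$. -/

import Mathlib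

/-- A convex polytope in `ℝⁿ`: a bounded set `{x | ⟪aᵢ, x⟫ + bᵢ ≥ 0, i = 1, …, m}`, given by an
irredundant system of inequalities (deleting any one of them changes the set). -/
structure ConvexPolytope (n : ℕ) where
  /-- the number of inequalities -/
  m : ℕ
  /-- the normal vectors -/
  a : Fin m → EuclideanSpace ℝ (Fin n)
  /-- the constant terms -/
  b : Fin m → ℝ
  bounded : Bornology.IsBounded {x : EuclideanSpace ℝ (Fin n) | ∀ i, 0 ≤ inner ℝ (a i) x + b i}
  irredundant : ∀ i, {x : EuclideanSpace ℝ (Fin n) | ∀ j, j ≠ i → 0 ≤ inner ℝ (a j) x + b j} ≠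
    {x : EuclideanSpace ℝ (Fin n) | ∀ j, 0 ≤ inner ℝ (a j) x + b j}

/-- Combinatorial equivalence of two families of faces: an inclusion-preserving (in both
directions) bijection. -/
def CombEquiv {α β : Type*} (A : Set (Set α)) (B : Set (Set β)) : Prop :=
  Nonempty (A ≃o B)

namespace ConvexPolytope

variable {n : ℕ} (P : ConvexPolytope n)

/-- The set of points of the polytope. -/
def carrier : Set (EuclideanSpace ℝ (Fin n)) :=
  {x | ∀ i, 0 ≤ inner ℝ (P.a i) x + P.b i}

/-- The facet `Fᵢ = P ∩ Hᵢ`, where `Hᵢ` is the hyperplane `⟪aᵢ, x⟫ + bᵢ = 0`. -/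
def facet (i : Fin P.m) : Set (EuclideanSpace ℝ (Fin n)) :=
  {x | x ∈ P.carrier ∧ inner ℝ (P.a i) x + P.b i = 0}

/-- The faces of `P`: the intersections of facets (the empty intersection being `P` itself). -/
def faces : Set (Set (EuclideanSpace ℝ (Fin n))) :=
  {G | ∃ S : Set (Fin P.m), G = P.carrier ∩ ⋂ i ∈ S, P.facet i}

/-- `P` is an `n`-polytope: it has full dimension in `ℝⁿ`. -/
def IsFullDim : Prop := (interior P.carrier).Nonempty

/-- `G` is a nonempty face of dimension `d`. -/
def IsFaceOfDim (d : ℕ) (G : Set (EuclideanSpace ℝ (Fin n))) : Prop :=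
  G ∈ P.faces ∧ G.Nonempty ∧ Module.finrank ℝ (vectorSpan ℝ G) = d

/-- Vertices of `P`, as one-point faces. -/
def IsVertex (G : Set (EuclideanSpace ℝ (Fin n))) : Prop := P.IsFaceOfDim 0 G

/-- Edges of `P`. -/
def IsEdge (G : Set (EuclideanSpace ℝ (Fin n))) : Prop := P.IsFaceOfDim 1 G

/-- A simple `n`-polytope: an `n`-polytope each vertex of which lies in exactly `n` facets. -/
def IsSimple : Prop :=
  P.IsFullDim ∧ ∀ v, P.IsVertex v → {i : Fin P.m | v ⊆ P.facet i}.ncard = n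

end ConvexPolytope

namespace ConvexPolytope

variable (P : ConvexPolytope 3)

/-- The facet `Fᵢ` of a `3`-polytope is a `k`-gon: it has exactly `k` edges. -/
def IsGon (k : ℕ) (i : Fin P.m) : Prop :=
  {e | P.IsEdge e ∧ e ⊆ P.facet i}.ncard = k

/-- A fullerene: a simple `3`-polytope with all facets pentagons and hexagons. -/
def IsFullerene : Prop :=
  P.IsSimple ∧ ∀ i, P.IsGon 5 i ∨ P.IsGon 6 i

/-- A `k`-loop (`k ≥ 1`): a cyclic sequence of `k` facets, successive ones meeting in an edge. -/
def IsLoop {k : ℕ} (L : ZMod k → Fin P.m) : Prop :=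
  ∀ p, P.IsEdge (P.facet (L p) ∩ P.facet (L (p + 1)))

/-- A `k`-loop which is a `k`-belt: the facets have no common point, and two facets at different
positions meet if and only if their positions are successive in the cyclic order. -/
def IsBeltLoop {k : ℕ} (L : ZMod k → Fin P.m) : Prop :=
  P.IsLoop L ∧ (⋂ p, P.facet (L p)) = ∅ ∧
    ∀ p q, p ≠ q → ((P.facet (L p) ∩ P.facet (L q)).Nonempty ↔ q = p + 1 ∨ p = q + 1)

/-- `B` is the set of facets of a `k`-belt. The cyclic order of the belt is determined by `B` up to
rotation and reversal, so belts are counted as such sets. -/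
def IsBelt (k : ℕ) (B : Set (Fin P.m)) : Prop :=
  ∃ L : ZMod k → Fin P.m, P.IsBeltLoop L ∧ Set.range L = B

/-- The facets in `B` surround the facet `Fᵢ`: they are the facets that one meets on the other side
when walking along the boundary of `Fᵢ`, that is, those which have a common edge with `Fᵢ`. -/
def Surrounds (B : Set (Fin P.m)) (i : Fin P.m) : Prop :=
  B = {j | P.IsEdge (P.facet j ∩ P.facet i)}

/-- `B` surrounds some pentagonal facet. -/
def SurroundsPentagon (B : Set (Fin P.m)) : Prop :=
  ∃ i, P.IsGon 5 i ∧ P.Surrounds B i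

end ConvexPolytope

/-! The combinatorial polytopes `D_k`. The dodecahedron `D_0` is cut along a zigzag cycle into two
caps, each a pentagon (`bottom`, `top`) surrounded by five pentagons, and `k` successive belts of
five hexagons are inserted between them. This gives `k + 2` rings of five facets; rings `0` and
`k + 1` are the pentagons of the two caps, rings `1, …, k` are hexagons. The facet `side r i` meets
its neighbours `side r (i ± 1)` in the ring, and the facets `side (r + 1) i`,
`side (r + 1) (i + 1)` of the next ring. -/

namespace DPolytope

/-- The facets of `D_k`. -/
inductive Facet (k : ℕ) : Type
  | bottom : Facet k
  | top : Facet k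
  | side (r : Fin (k + 2)) (i : ZMod 5) : Facet k

/-- The `20 + 10 k` vertices of `D_k`. -/
inductive Vertex (k : ℕ) : Type
  | bottom (i : ZMod 5) : Vertex k
  | top (i : ZMod 5) : Vertex k
  | lower (r : Fin (k + 1)) (i : ZMod 5) : Vertex k
  | upper (r : Fin (k + 1)) (i : ZMod 5) : Vertex k

/-- The three facets of `D_k` which meet in a given vertex. -/
def facetsAt {k : ℕ} : Vertex k → Set (Facet k)
  | .bottom i => {.bottom, .side 0 i, .side 0 (i + 1)}
  | .top i => {.top, .side (Fin.last (k + 1)) i, .side (Fin.last (k + 1)) (i + 1)}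
  | .lower r i => {.side r.castSucc i, .side r.castSucc (i + 1), .side r.succ (i + 1)}
  | .upper r i => {.side r.castSucc i, .side r.succ i, .side r.succ (i + 1)}

/-- The faces of `D_k`, each given by its set of vertices: the intersections of facets (the empty
intersection being `D_k` itself). -/
def faces (k : ℕ) : Set (Set (Vertex k)) :=
  {G | ∃ S : Set (Facet k), G = ⋂ f ∈ S, {v : Vertex k | f ∈ facetsAt v}}

end DPolytope

/-! The facets of a simple `3`-polytope are the vertices of a triangulation of the sphere, whose
triangles are the vertices of the polytope; for a fullerene all degrees are `5` or `6`. A belt is a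
chordless cycle of this triangulation. Every cycle bounds two complementary sets of triangles: mod
`2`, boundaries are cycles, and Euler's formula forces the dimensions to agree. Double counting in
one of these discs relates the number of pentagons inside a belt to the number of triangles along
it, so that next to a belt of length `3` or `4` there would be a shorter or equally long belt
bounding a smaller disc; hence such belts do not exist.

If a `5`-belt has a single facet on one side, it is the link of a pentagon. Otherwise the same count
shows that there are six pentagons on either side and that the facets next to the belt on either
side form a `5`-belt again. Peeling off these rings one by one, each side ends in a pentagon
surrounded by five pentagons, which makes the polytope a `D_k`. A `5`-belt of `D_k` which is not the
link of a pentagon cuts each of its hexagons in halves, hence runs along one of the `k` rings. -/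

open Finset symmDiff

namespace TriangulatedSphere

/-! ### Incidence matrices modulo two -/

section Incidence

variable {F : Type*} [DecidableEq F]

/-- The mod `2` incidence matrix of the facets in `A` and the edges in `E`. -/
def facetEdgeMatrix (A : Finset F) (E : Finset (Finset F)) : Matrix A E (ZMod 2) :=
  Matrix.of fun x e => if x.1 ∈ e.1 then 1 else 0

/-- The graph with edge set `E` connects the facets in `A`, in cohomological form: functions which
are constant along the edges are constant on `A`. -/
def EdgeConnected (A : Finset F) (E : Finset (Finset F)) : Prop :=
  ∀ g : F → ZMod 2, (∀ e ∈ E, ∀ x ∈ e, ∀ y ∈ e, g x = g y) → ∀ x ∈ A, ∀ y ∈ A, g x = g y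

/-- The support of a mod `2` chain on `T`, as a subset of `T`. -/
def chainSupport {V : Type*} {T : Finset V} (c : T → ZMod 2) : Finset V :=
  {v ∈ T.attach | c v = 1}.map (Function.Embedding.subtype _)

lemma mem_chainSupport {V : Type*} {T : Finset V} {c : T → ZMod 2} {v : V} :
    v ∈ chainSupport c ↔ ∃ h : v ∈ T, c ⟨v, h⟩ = 1 := by
  simp [chainSupport]

lemma eq_pair_of_card_eq_two {α : Type*} [DecidableEq α] {e : Finset α} (he : #e = 2) {x y : α}
    (hxy : x ≠ y) (hx : x ∈ e) (hy : y ∈ e) : e = {x, y} :=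
  (eq_of_subset_of_card_le (by simp [insert_subset_iff, hx, hy])
    (by rw [he, card_pair hxy])).symm

lemma transpose_facetEdgeMatrix_mulVec_eq_add {A : Finset F} {E : Finset (Finset F)}
    (g : A → ZMod 2) {x y : A} (hxy : x ≠ y) (he : {x.1, y.1} ∈ E) :
    (facetEdgeMatrix A E).transpose.mulVec g ⟨_, he⟩ = g x + g y := by
  have hfilter : ({a : A | a.1 = x.1 ∨ a.1 = y.1} : Finset A) = {x, y} := by
    ext a
    simp only [mem_filter, mem_univ, true_and, mem_insert, mem_singleton, Subtype.ext_iff]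
  simp only [Matrix.mulVec, dotProduct, facetEdgeMatrix, Matrix.transpose_apply, Matrix.of_apply,
    ite_mul, one_mul, zero_mul, mem_insert, mem_singleton]
  rw [← sum_filter, hfilter, sum_pair hxy]

lemma EdgeConnected.eq_of_mulVec_eq_zero {A : Finset F} {E : Finset (Finset F)}
    (hE : ∀ e ∈ E, #e = 2 ∧ e ⊆ A) (hconn : EdgeConnected A E) {g : A → ZMod 2}
    (hg : (facetEdgeMatrix A E).transpose.mulVec g = 0) (x y : A) : g x = g y := by
  have hedge : ∀ e ∈ E, ∀ z ∈ e, ∀ w ∈ e, (if h : z ∈ A then g ⟨z, h⟩ else 0) =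
      if h : w ∈ A then g ⟨w, h⟩ else 0 := by
    intro e he z hz w hw
    rcases eq_or_ne z w with rfl | hzw
    · rfl
    have hzA := (hE e he).2 hz
    have hwA := (hE e he).2 hw
    obtain rfl := eq_pair_of_card_eq_two (hE e he).1 hzw hz hw
    have hsum := transpose_facetEdgeMatrix_mulVec_eq_add (A := A) g (x := ⟨z, hzA⟩)
      (y := ⟨w, hwA⟩) (by simpa using hzw) he
    rw [hg, Pi.zero_apply] at hsum
    simpa [hzA, hwA] using (CharTwo.add_eq_zero.1 hsum.symm)
  simpa using hconn _ hedge x x.2 y y.2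

lemma EdgeConnected.card_le_rank {A : Finset F} {E : Finset (Finset F)}
    (hE : ∀ e ∈ E, #e = 2 ∧ e ⊆ A) (hconn : EdgeConnected A E) :
    #A ≤ (facetEdgeMatrix A E).rank + 1 := by
  have hker : Module.finrank (ZMod 2)
      (LinearMap.ker (facetEdgeMatrix A E).transpose.mulVecLin) ≤ 1 := by
    have hle : LinearMap.ker (facetEdgeMatrix A E).transpose.mulVecLin ≤
        Submodule.span (ZMod 2) {(1 : A → ZMod 2)} := by
      intro g hg
      rcases isEmpty_or_nonempty A with hA | ⟨⟨x⟩⟩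
      · rw [Subsingleton.elim g 0]
        exact Submodule.zero_mem _
      · refine Submodule.mem_span_singleton.2 ⟨g x, ?_⟩
        ext y
        simp [hconn.eq_of_mulVec_eq_zero hE hg x y]
    exact (Submodule.finrank_mono hle).trans ((finrank_span_le_card _).trans (by simp))
  have hsum := LinearMap.finrank_range_add_finrank_ker (facetEdgeMatrix A E).transpose.mulVecLin
  rw [Module.finrank_fintype_fun_eq_card, Fintype.card_coe] at hsum
  rw [← Matrix.rank_transpose]
  unfold Matrix.rank
  omega

lemma indicator_mem_ker_facetEdgeMatrix {A : Finset F} {S E : Finset (Finset F)} (hS : S ⊆ E)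
    (heven : ∀ x, Even #{e ∈ S | x ∈ e}) :
    (fun e : E => if e.1 ∈ S then (1 : ZMod 2) else 0) ∈
      LinearMap.ker (facetEdgeMatrix A E).mulVecLin := by
  rw [LinearMap.mem_ker, Matrix.mulVecLin_apply]
  ext x
  simp only [Matrix.mulVec, dotProduct, facetEdgeMatrix, Matrix.of_apply, Pi.zero_apply, ← ite_and,
    mul_ite, mul_one, mul_zero]
  have hfilter : ({e ∈ E | e ∈ S ∧ x.1 ∈ e} : Finset _) = {e ∈ S | x.1 ∈ e} := by
    ext e
    simp only [mem_filter]
    exact ⟨fun h => h.2, fun h => ⟨hS h.1, h⟩⟩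
  rw [sum_coe_sort E (fun e => if e ∈ S ∧ x.1 ∈ e then (1 : ZMod 2) else 0), sum_boole, hfilter]
  exact ZMod.natCast_eq_zero_iff_even.2 (heven x.1)

end Incidence

end TriangulatedSphere

/-- A triangulated `2`-sphere, written in the language of the dual simple `3`-polytope: `F` is the
set of facets, `V` the set of vertices, and `facetsAt v` is the triangle dual to the vertex `v`. An
edge is represented by the pair of facets containing it. That the triangulated surface is a sphere
is expressed by `euler`, which is `V - E + F = 2` with `2 E = 3 V` eliminated. -/
structure TriangulatedSphere (F V : Type*) [Fintype F] [Fintype V] [DecidableEq F]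
    [DecidableEq V] where
  facetsAt : V → Finset F
  card_facetsAt : ∀ v, #(facetsAt v) = 3
  facetsAt_injective : Function.Injective facetsAt
  card_cofaces : ∀ v e, e ⊆ facetsAt v → #e = 2 → #{w | e ⊆ facetsAt w} = 2
  star_connected : ∀ (x : F) (Q : V → Prop),
    (∀ v w, x ∈ facetsAt v → x ∈ facetsAt w → 2 ≤ #(facetsAt v ∩ facetsAt w) → Q v → Q w) →
      ∀ v w, x ∈ facetsAt v → x ∈ facetsAt w → Q v → Q w
  connected : ∀ Q : V → Prop, (∀ v w, 2 ≤ #(facetsAt v ∩ facetsAt w) → Q v → Q w) → ∀ v w, Q v → Q w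
  exists_mem_facetsAt : ∀ x, ∃ v, x ∈ facetsAt v
  euler : Fintype.card V + 4 = 2 * Fintype.card F

namespace TriangulatedSphere

variable {F V : Type*} [Fintype F] [Fintype V] [DecidableEq F] [DecidableEq V]
  (K : TriangulatedSphere F V)

/-- The mod `2` boundary of a set `T` of vertices (of triangles, in the dual picture). -/
def boundary (T : Finset V) : Finset (Finset F) :=
  {e | #e = 2 ∧ Odd #{v ∈ T | e ⊆ K.facetsAt v}}

/-- The vertices of the facet `x`. -/
def star (x : F) : Finset V := {v | x ∈ K.facetsAt v}

/-- The facets inside the region `T`: all their vertices lie in `T`. -/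
def inside (T : Finset V) : Finset F := {x | K.star x ⊆ T}

/-- Adjacency of facets. Since a vertex lies on three pairwise adjacent facets, a common vertex is
enough. -/
def Adj (x y : F) : Prop := x ≠ y ∧ ∃ v, x ∈ K.facetsAt v ∧ y ∈ K.facetsAt v

/-- The number of vertices of a facet. -/
def deg (x : F) : ℕ := #(K.star x)

variable {K}

lemma mem_star {x : F} {v : V} : v ∈ K.star x ↔ x ∈ K.facetsAt v := by simp [star]

lemma mem_inside {x : F} {T : Finset V} : x ∈ K.inside T ↔ K.star x ⊆ T := by simp [inside]

lemma mem_boundary {T : Finset V} {e : Finset F} :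
    e ∈ K.boundary T ↔ #e = 2 ∧ Odd #{v ∈ T | e ⊆ K.facetsAt v} := by simp [boundary]

lemma Adj.symm {x y : F} (h : K.Adj x y) : K.Adj y x :=
  ⟨h.1.symm, h.2.imp fun _ hv => ⟨hv.2, hv.1⟩⟩

lemma eq_or_eq_of_subset_facetsAt {e : Finset F} (he : #e = 2) {v w u : V} (hvw : v ≠ w)
    (hv : e ⊆ K.facetsAt v) (hw : e ⊆ K.facetsAt w) (hu : e ⊆ K.facetsAt u) : u = v ∨ u = w := by
  have hcard := K.card_cofaces v e hv he
  have hsub : ({v, w} : Finset V) ⊆ ({w | e ⊆ K.facetsAt w} : Finset V) := by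
    intro z hz
    simp only [mem_insert, mem_singleton] at hz
    rcases hz with rfl | rfl <;> simp [hv, hw]
  have heq := eq_of_subset_of_card_le hsub (by rw [hcard, card_pair hvw])
  have : u ∈ ({v, w} : Finset V) := by rw [heq]; simp [hu]
  simpa using this

lemma exists_ne_subset_facetsAt {e : Finset F} (he : #e = 2) {v : V} (hv : e ⊆ K.facetsAt v) :
    ∃ w, w ≠ v ∧ e ⊆ K.facetsAt w := by
  have hcard := K.card_cofaces v e hv he
  obtain ⟨w, hw, hne⟩ := exists_mem_ne (s := ({w | e ⊆ K.facetsAt w} : Finset V)) (by omega) v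
  exact ⟨w, hne, by simpa using hw⟩

lemma filter_subset_facetsAt_eq {e : Finset F} (he : #e = 2) {v w : V} (hvw : v ≠ w)
    (hv : e ⊆ K.facetsAt v) (hw : e ⊆ K.facetsAt w) (T : Finset V) :
    ({u ∈ T | e ⊆ K.facetsAt u} : Finset V) = {u ∈ ({v, w} : Finset V) | u ∈ T} := by
  ext u
  simp only [mem_filter, mem_insert, mem_singleton]
  constructor
  · rintro ⟨h1, h2⟩
    exact ⟨eq_or_eq_of_subset_facetsAt he hvw hv hw h2, h1⟩
  · rintro ⟨rfl | rfl, h⟩ <;> simp [*]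

lemma mem_boundary_iff {e : Finset F} (he : #e = 2) {v w : V} (hvw : v ≠ w)
    (hv : e ⊆ K.facetsAt v) (hw : e ⊆ K.facetsAt w) (T : Finset V) :
    e ∈ K.boundary T ↔ ¬ (v ∈ T ↔ w ∈ T) := by
  rw [mem_boundary, filter_subset_facetsAt_eq he hvw hv hw]
  by_cases h1 : v ∈ T <;> by_cases h2 : w ∈ T <;>
    simp [h1, h2, he, filter_insert, filter_singleton, hvw]

lemma exists_mem_notMem_of_mem_boundary {e : Finset F} {T : Finset V} (h : e ∈ K.boundary T) :
    ∃ v ∈ T, ∃ w ∉ T, e ⊆ K.facetsAt v ∧ e ⊆ K.facetsAt w := by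
  obtain ⟨he, hodd⟩ := mem_boundary.1 h
  obtain ⟨v, hv⟩ := card_pos.1 hodd.pos
  simp only [mem_filter] at hv
  obtain ⟨w, hwv, hw⟩ := exists_ne_subset_facetsAt he hv.2
  have := (mem_boundary_iff he hwv.symm hv.2 hw T).1 h
  exact ⟨v, hv.1, w, by tauto, hv.2, hw⟩

lemma card_eq_two_of_mem_boundary {e : Finset F} {T : Finset V} (h : e ∈ K.boundary T) : #e = 2 :=
  (mem_boundary.1 h).1

lemma mem_iff_mem_of_notMem_boundary {e : Finset F} (he : #e = 2) {v w : V}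
    (hv : e ⊆ K.facetsAt v) (hw : e ⊆ K.facetsAt w) {T : Finset V} (hT : e ∉ K.boundary T) :
    v ∈ T ↔ w ∈ T := by
  by_cases hvw : v = w
  · rw [hvw]
  · by_contra h
    exact hT ((mem_boundary_iff he hvw hv hw T).2 h)

lemma boundary_symmDiff (S T : Finset V) : K.boundary (S ∆ T) = K.boundary S ∆ K.boundary T := by
  ext e
  by_cases he : #e = 2
  · by_cases hex : ∃ v, e ⊆ K.facetsAt v
    · obtain ⟨v, hv⟩ := hex
      obtain ⟨w, hwv, hw⟩ := exists_ne_subset_facetsAt he hv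
      simp only [mem_symmDiff, mem_boundary_iff he hwv.symm hv hw]
      tauto
    · push Not at hex
      simp [mem_symmDiff, mem_boundary, hex]
  · simp [mem_symmDiff, mem_boundary, he]

lemma boundary_univ : K.boundary univ = ∅ := by
  ext e
  simp only [notMem_empty, iff_false]
  intro h
  obtain ⟨v, -, w, hw, -⟩ := exists_mem_notMem_of_mem_boundary h
  simp at hw

lemma boundary_compl (T : Finset V) : K.boundary Tᶜ = K.boundary T := by
  have : Tᶜ = T ∆ univ := by ext; simp [mem_symmDiff]
  rw [this, boundary_symmDiff, boundary_univ]
  ext; simp [mem_symmDiff]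

lemma eq_empty_or_univ_of_boundary_eq_empty {T : Finset V} (h : K.boundary T = ∅) :
    T = ∅ ∨ T = univ := by
  rcases T.eq_empty_or_nonempty with hempty | ⟨v, hv⟩
  · exact Or.inl hempty
  · right
    ext w
    simp only [mem_univ, iff_true]
    refine K.connected (· ∈ T) ?_ v w hv
    intro v w hvw hv
    obtain ⟨e, he, hcard⟩ := exists_subset_card_eq hvw
    exact (mem_iff_mem_of_notMem_boundary hcard (he.trans inter_subset_left)
      (he.trans inter_subset_right) (by simp [h])).1 hv

lemma eq_or_eq_compl_of_boundary_eq {S T : Finset V} (h : K.boundary S = K.boundary T) :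
    S = T ∨ S = Tᶜ := by
  have hempty : K.boundary (S ∆ T) = ∅ := by rw [boundary_symmDiff, h]; simp
  rcases eq_empty_or_univ_of_boundary_eq_empty hempty with h1 | h1
  · exact Or.inl (symmDiff_eq_bot.1 h1)
  · right
    ext v
    have : v ∈ S ∆ T := by simp [h1]
    simp only [mem_symmDiff, mem_compl] at this ⊢
    tauto

lemma star_nonempty (x : F) : (K.star x).Nonempty :=
  (K.exists_mem_facetsAt x).imp fun _ h => mem_star.2 h

lemma star_subset_or_disjoint {T : Finset V} {x : F} (h : ∀ e ∈ K.boundary T, x ∉ e) :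
    K.star x ⊆ T ∨ K.star x ⊆ Tᶜ := by
  have key : ∀ v w, x ∈ K.facetsAt v → x ∈ K.facetsAt w → v ∈ T → w ∈ T := by
    refine K.star_connected x (· ∈ T) ?_
    intro v w hv hw hvw hT
    obtain ⟨e, hxe, he, hcard⟩ :=
      exists_subsuperset_card_eq (s := {x}) (t := K.facetsAt v ∩ K.facetsAt w) (n := 2)
        (by simp [hv, hw]) (by simp) hvw
    refine (mem_iff_mem_of_notMem_boundary hcard (he.trans inter_subset_left)
      (he.trans inter_subset_right) (fun h' => h e h' (by simpa using hxe))).1 hT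
  by_cases hstar : ∃ v ∈ K.star x, v ∈ T
  · obtain ⟨v, hv, hvT⟩ := hstar
    exact Or.inl fun w hw => key v w (mem_star.1 hv) (mem_star.1 hw) hvT
  · push Not at hstar
    exact Or.inr fun w hw => by simpa using hstar w hw

/-- The edges with an endpoint in `T`. -/
def edges (K : TriangulatedSphere F V) (T : Finset V) : Finset (Finset F) :=
  T.biUnion fun v => (K.facetsAt v).powersetCard 2

lemma mem_edges {T : Finset V} {e : Finset F} :
    e ∈ K.edges T ↔ #e = 2 ∧ ∃ v ∈ T, e ⊆ K.facetsAt v := by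
  simp only [edges, mem_biUnion, mem_powersetCard]
  constructor
  · rintro ⟨v, hv, h1, h2⟩
    exact ⟨h2, v, hv, h1⟩
  · rintro ⟨h2, v, hv, h1⟩
    exact ⟨v, hv, h1, h2⟩

lemma boundary_subset_edges (T : Finset V) : K.boundary T ⊆ K.edges T := fun e he => by
  obtain ⟨v, hv, w, -, h, -⟩ := exists_mem_notMem_of_mem_boundary he
  exact mem_edges.2 ⟨card_eq_two_of_mem_boundary he, v, hv, h⟩

lemma two_mul_card_edges (T : Finset V) : 2 * #(K.edges T) = 3 * #T + #(K.boundary T) := by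
  have hvertices : ∑ v ∈ T, #{e ∈ K.edges T | e ⊆ K.facetsAt v} = 3 * #T := by
    rw [mul_comm, ← smul_eq_mul, ← sum_const]
    refine sum_congr rfl fun v hv => ?_
    have hfilter : ({e ∈ K.edges T | e ⊆ K.facetsAt v} : Finset (Finset F)) =
        (K.facetsAt v).powersetCard 2 := by
      ext e
      simp only [mem_filter, mem_edges, mem_powersetCard]
      exact ⟨fun h => ⟨h.2, h.1.1⟩, fun h => ⟨⟨h.2, v, hv, h.1⟩, h.1⟩⟩
    rw [hfilter, card_powersetCard, K.card_facetsAt]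
    rfl
  have hswap : ∑ v ∈ T, #{e ∈ K.edges T | e ⊆ K.facetsAt v} =
      ∑ e ∈ K.edges T, #{v ∈ T | e ⊆ K.facetsAt v} :=
    sum_card_bipartiteAbove_eq_sum_card_bipartiteBelow (fun v e => e ⊆ K.facetsAt v)
  have hsum : ∑ e ∈ K.edges T, (#{v ∈ T | e ⊆ K.facetsAt v} + if e ∈ K.boundary T then 1 else 0) =
      2 * #(K.edges T) := by
    rw [mul_comm, ← smul_eq_mul, ← sum_const]
    refine sum_congr rfl fun e he => ?_
    obtain ⟨he, v, hv, hev⟩ := mem_edges.1 he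
    obtain ⟨w, hwv, hw⟩ := exists_ne_subset_facetsAt he hev
    have hmem := mem_boundary_iff he hwv.symm hev hw T
    rw [filter_subset_facetsAt_eq he hwv.symm hev hw]
    by_cases hwT : w ∈ T <;> simp [hv, hwT, filter_insert, filter_singleton, hwv.symm, hmem]
  rw [sum_add_distrib, ← hswap, hvertices, ← sum_filter, filter_mem_eq_inter,
    inter_eq_right.2 (boundary_subset_edges T)] at hsum
  simp only [sum_const, smul_eq_mul, mul_one] at hsum
  exact hsum.symm

/-! ### Mod two homology -/

/-- The mod `2` incidence matrix of the edges in `E` and the vertices in `T`. -/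
def edgeVertexMatrix (K : TriangulatedSphere F V) (E : Finset (Finset F)) (T : Finset V) :
    Matrix E T (ZMod 2) :=
  Matrix.of fun e v => if e.1 ⊆ K.facetsAt v.1 then 1 else 0

lemma even_card_filter_mem_facetsAt (v : V) (x : F) :
    Even #{e ∈ (K.facetsAt v).powersetCard 2 | x ∈ e} := by
  by_cases hx : x ∈ K.facetsAt v
  · have hcard := card_filter_powersetCard_subset {x} (K.facetsAt v) 2 (by simpa using hx) (by simp)
    simp only [singleton_subset_iff, K.card_facetsAt, card_singleton] at hcard
    rw [hcard]
    decide
  · rw [filter_false_of_mem fun e he hxe => hx ((mem_powersetCard.1 he).1 hxe)]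
    simp

lemma facetEdgeMatrix_mul_edgeVertexMatrix (A : Finset F) (T : Finset V) :
    facetEdgeMatrix A (K.edges T) * K.edgeVertexMatrix (K.edges T) T = 0 := by
  ext x v
  have hfilter : ({e ∈ K.edges T | e ⊆ K.facetsAt v.1 ∧ x.1 ∈ e} : Finset _) =
      {e ∈ (K.facetsAt v.1).powersetCard 2 | x.1 ∈ e} := by
    ext e
    simp only [mem_filter, mem_edges, mem_powersetCard]
    exact ⟨fun h => ⟨⟨h.2.1, h.1.1⟩, h.2.2⟩, fun h => ⟨⟨h.1.2, v.1, v.2, h.1.1⟩, h.1.1, h.2⟩⟩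
  simp only [Matrix.mul_apply, facetEdgeMatrix, edgeVertexMatrix, Matrix.of_apply,
    Matrix.zero_apply, ← ite_and, mul_ite, mul_one, mul_zero]
  rw [sum_coe_sort (K.edges T) (fun e => if e ⊆ K.facetsAt v.1 ∧ x.1 ∈ e then (1 : ZMod 2) else 0),
    sum_boole, hfilter]
  exact ZMod.natCast_eq_zero_iff_even.2 (even_card_filter_mem_facetsAt v.1 x.1)

lemma edgeVertexMatrix_mulVec {E : Finset (Finset F)} {T : Finset V} (c : T → ZMod 2) (e : E) :
    (K.edgeVertexMatrix E T).mulVec c e = (#{v ∈ chainSupport c | e.1 ⊆ K.facetsAt v} : ℕ) := by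
  have hite : ∀ a : ZMod 2, ∀ p : Prop, [Decidable p] →
      (if p then a else 0) = if a = 1 then if p then 1 else 0 else 0 := by
    intro a p _
    by_cases hp : p <;> simp only [hp, if_true, if_false] <;> revert a <;> decide
  rw [← sum_boole, chainSupport, sum_map, sum_filter]
  simp only [Matrix.mulVec, dotProduct, edgeVertexMatrix, Matrix.of_apply, ite_mul, one_mul,
    zero_mul, Function.Embedding.subtype_apply]
  exact sum_congr rfl fun v _ => hite (c v) _

lemma mem_boundary_chainSupport {E : Finset (Finset F)} {T : Finset V} (c : T → ZMod 2) (e : E)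
    (he : #e.1 = 2) :
    e.1 ∈ K.boundary (chainSupport c) ↔ (K.edgeVertexMatrix E T).mulVec c e = 1 := by
  rw [edgeVertexMatrix_mulVec, ZMod.natCast_eq_one_iff_odd, mem_boundary, and_iff_right he]

lemma edges_mono {S T : Finset V} (h : S ⊆ T) : K.edges S ⊆ K.edges T :=
  biUnion_subset_biUnion_of_subset_left _ h

lemma boundary_chainSupport_eq_empty {T : Finset V} {c : T → ZMod 2}
    (hc : (K.edgeVertexMatrix (K.edges T) T).mulVec c = 0) :
    K.boundary (chainSupport c) = ∅ := by
  refine eq_empty_of_forall_notMem fun e he => ?_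
  have hsub : chainSupport c ⊆ T := fun v hv => (mem_chainSupport.1 hv).1
  have hmem := (mem_boundary_chainSupport c ⟨e, edges_mono hsub (boundary_subset_edges _ he)⟩
    (card_eq_two_of_mem_boundary he)).1 he
  rw [hc] at hmem
  exact zero_ne_one hmem

lemma eq_zero_or_eq_one_of_edgeVertexMatrix_mulVec_eq_zero {T : Finset V} {c : T → ZMod 2}
    (hc : (K.edgeVertexMatrix (K.edges T) T).mulVec c = 0) : c = 0 ∨ T = univ ∧ c = 1 := by
  have hzero : ∀ a : ZMod 2, a ≠ 1 → a = 0 := by decide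
  rcases eq_empty_or_univ_of_boundary_eq_empty (boundary_chainSupport_eq_empty hc) with h | h
  · refine Or.inl (funext fun v => hzero _ fun hv => ?_)
    exact notMem_empty v.1 (h ▸ mem_chainSupport.2 ⟨v.2, hv⟩)
  · have hmem : ∀ v, ∃ h : v ∈ T, c ⟨v, h⟩ = 1 := fun v =>
      mem_chainSupport.1 (h ▸ mem_univ v)
    exact Or.inr ⟨eq_univ_iff_forall.2 fun v => (hmem v).1, funext fun v => (hmem v.1).2⟩

lemma finrank_ker_edgeVertexMatrix_le (T : Finset V) :
    Module.finrank (ZMod 2) (LinearMap.ker (K.edgeVertexMatrix (K.edges T) T).mulVecLin) ≤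
      if T = univ then 1 else 0 := by
  split_ifs with hT
  · have hle : LinearMap.ker (K.edgeVertexMatrix (K.edges T) T).mulVecLin ≤
        Submodule.span (ZMod 2) {(1 : T → ZMod 2)} := by
      intro c hc
      rcases eq_zero_or_eq_one_of_edgeVertexMatrix_mulVec_eq_zero (by simpa using hc) with
        rfl | ⟨-, rfl⟩
      · exact Submodule.zero_mem _
      · exact Submodule.mem_span_singleton_self _
    exact (Submodule.finrank_mono hle).trans ((finrank_span_le_card _).trans (by simp))
  · have hbot : LinearMap.ker (K.edgeVertexMatrix (K.edges T) T).mulVecLin = ⊥ :=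
      (Submodule.eq_bot_iff _).2 fun c hc =>
        (eq_zero_or_eq_one_of_edgeVertexMatrix_mulVec_eq_zero (by simpa using hc)).resolve_right
          fun h => hT h.1
    rw [hbot, finrank_bot]

lemma card_le_rank_edgeVertexMatrix (T : Finset V) :
    #T ≤ (K.edgeVertexMatrix (K.edges T) T).rank + if T = univ then 1 else 0 := by
  have hker := finrank_ker_edgeVertexMatrix_le (K := K) T
  have hsum := LinearMap.finrank_range_add_finrank_ker (K.edgeVertexMatrix (K.edges T) T).mulVecLin
  rw [Module.finrank_fintype_fun_eq_card, Fintype.card_coe] at hsum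
  unfold Matrix.rank
  omega

lemma card_add_card_le_card_edges_add_one {T : Finset V} {A : Finset F} (hT : T ≠ univ)
    (hA : ∀ v ∈ T, K.facetsAt v ⊆ A) (hconn : EdgeConnected A (K.edges T)) :
    #A + #T ≤ #(K.edges T) + 1 := by
  have hedge : ∀ e ∈ K.edges T, #e = 2 ∧ e ⊆ A := fun e he => by
    obtain ⟨he, v, hv, hev⟩ := mem_edges.1 he
    exact ⟨he, hev.trans (hA v hv)⟩
  have hrankT := card_le_rank_edgeVertexMatrix (K := K) T
  have hrankA := hconn.card_le_rank hedge
  have hrank := Matrix.rank_add_rank_le_card_of_mul_eq_zero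
    (facetEdgeMatrix_mul_edgeVertexMatrix (K := K) A T)
  rw [Fintype.card_coe] at hrank
  rw [if_neg hT] at hrankT
  omega

lemma eq_of_forall_edge {α : Type*} (g : F → α)
    (hg : ∀ e ∈ K.edges univ, ∀ x ∈ e, ∀ y ∈ e, g x = g y) (x y : F) : g x = g y := by
  have hvertex : ∀ v, ∀ x ∈ K.facetsAt v, ∀ y ∈ K.facetsAt v, g x = g y := by
    intro v x hx y hy
    rcases eq_or_ne x y with rfl | hxy
    · rfl
    · refine hg {x, y} (mem_edges.2 ⟨card_pair hxy, v, mem_univ _, ?_⟩) x (by simp) y (by simp)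
      simp [insert_subset_iff, hx, hy]
  obtain ⟨v, hv⟩ := K.exists_mem_facetsAt x
  obtain ⟨w, hw⟩ := K.exists_mem_facetsAt y
  refine K.connected (fun w => ∀ y ∈ K.facetsAt w, g x = g y) ?_ v w (hvertex v x hv) y hw
  intro v w hvw h z hz
  obtain ⟨a, ha⟩ := card_pos.1 (by omega : 0 < #(K.facetsAt v ∩ K.facetsAt w))
  rw [mem_inter] at ha
  exact (h a ha.1).trans (hvertex w a ha.2 z hz)

/-- The inclusion `⊆` is `∂² = 0`; Euler's formula forces the dimensions to agree. -/
lemma range_edgeVertexMatrix_eq_ker_facetEdgeMatrix :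
    LinearMap.range (K.edgeVertexMatrix (K.edges univ) univ).mulVecLin =
      LinearMap.ker (facetEdgeMatrix univ (K.edges univ)).mulVecLin := by
  have hle : LinearMap.range (K.edgeVertexMatrix (K.edges univ) univ).mulVecLin ≤
      LinearMap.ker (facetEdgeMatrix univ (K.edges univ)).mulVecLin := by
    rw [LinearMap.range_le_ker_iff, ← Matrix.mulVecLin_mul, facetEdgeMatrix_mul_edgeVertexMatrix,
      Matrix.mulVecLin_zero]
  refine Submodule.eq_of_le_of_finrank_le hle ?_
  have hrankV := card_le_rank_edgeVertexMatrix (K := K) univ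
  have hrankF := EdgeConnected.card_le_rank (A := univ) (E := K.edges univ)
    (fun e he => ⟨(mem_edges.1 he).1, subset_univ _⟩)
    (fun g hg x _ y _ => eq_of_forall_edge g hg x y)
  have hsum := LinearMap.finrank_range_add_finrank_ker
    (facetEdgeMatrix univ (K.edges univ)).mulVecLin
  rw [Module.finrank_fintype_fun_eq_card, Fintype.card_coe] at hsum
  have hedges := two_mul_card_edges (K := K) univ
  have heuler := K.euler
  simp only [if_true, card_univ, boundary_univ, card_empty] at hrankV hrankF hedges
  unfold Matrix.rank at hrankV hrankF
  omega

lemma exists_boundary_eq {S : Finset (Finset F)} (hS : S ⊆ K.edges univ)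
    (heven : ∀ x, Even #{e ∈ S | x ∈ e}) : ∃ T, K.boundary T = S := by
  have hmem := indicator_mem_ker_facetEdgeMatrix (A := univ) hS heven
  rw [← range_edgeVertexMatrix_eq_ker_facetEdgeMatrix] at hmem
  obtain ⟨c, hc⟩ := hmem
  refine ⟨chainSupport c, ext fun e => ?_⟩
  by_cases he : e ∈ K.edges univ
  · rw [mem_boundary_chainSupport c ⟨e, he⟩ (mem_edges.1 he).1, ← Matrix.mulVecLin_apply, hc]
    simp
  · exact iff_of_false (fun h => he (edges_mono (subset_univ _) (boundary_subset_edges _ h)))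
      fun h => he (hS h)

lemma boundary_empty : K.boundary ∅ = ∅ := by
  ext e
  simp [mem_boundary]

lemma boundary_singleton (v : V) : K.boundary {v} = (K.facetsAt v).powersetCard 2 := by
  ext e
  rw [mem_boundary, mem_powersetCard, filter_singleton]
  by_cases h : e ⊆ K.facetsAt v <;> simp [h]

lemma even_card_symmDiff {α : Type*} [DecidableEq α] {A B : Finset α} (hA : Even #A)
    (hB : Even #B) : Even #(A ∆ B) := by
  have hdisj : Disjoint (A \ B) (B \ A) := disjoint_sdiff_sdiff
  have hAB := card_sdiff_add_card_inter A B
  have hBA := card_sdiff_add_card_inter B A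
  rw [inter_comm] at hBA
  rw [symmDiff_def, sup_eq_union, card_union_of_disjoint hdisj]
  grind

lemma even_card_boundary_filter (T : Finset V) (x : F) : Even #{e ∈ K.boundary T | x ∈ e} := by
  induction T using Finset.induction_on with
  | empty => simp [boundary_empty]
  | insert v T hv ih =>
    have hinsert : insert v T = {v} ∆ T := by
      rw [(symmDiff_eq_union_iff _ _).2 (disjoint_singleton_left.2 hv)]
      rfl
    have hfilter : ({e ∈ K.boundary (insert v T) | x ∈ e} : Finset _) =
        {e ∈ (K.facetsAt v).powersetCard 2 | x ∈ e} ∆ {e ∈ K.boundary T | x ∈ e} := by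
      rw [hinsert, boundary_symmDiff, boundary_singleton]
      ext e
      simp only [mem_filter, mem_symmDiff]
      tauto
    rw [hfilter]
    exact even_card_symmDiff (even_card_filter_mem_facetsAt v x) ih

end TriangulatedSphere

namespace TriangulatedSphere

/-! ### Cycles of edges -/

section Cycles

variable {F : Type*} [DecidableEq F]

/-- The edges of the closed walk `x`. -/
def cycleEdges {k : ℕ} [NeZero k] (x : ZMod k → F) : Finset (Finset F) :=
  univ.image fun i => {x i, x (i + 1)}

/-- A cycle modulo two in the complete graph on `F`: a set of edges which has an even number of
edges at every vertex. -/
structure IsModTwoCycle (S : Finset (Finset F)) : Prop where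
  card_edge : ∀ e ∈ S, #e = 2
  even_card : ∀ z, Even #{e ∈ S | z ∈ e}

lemma mem_cycleEdges {k : ℕ} [NeZero k] {x : ZMod k → F} {e : Finset F} :
    e ∈ cycleEdges x ↔ ∃ i, {x i, x (i + 1)} = e := by simp [cycleEdges]

lemma cycleEdges_subset_iff {k : ℕ} [NeZero k] {x : ZMod k → F} {S : Finset (Finset F)} :
    cycleEdges x ⊆ S ↔ ∀ i, {x i, x (i + 1)} ∈ S := by
  simp [cycleEdges, image_subset_iff]

lemma zmod_natCast_ne_zero_of_lt {k n : ℕ} (hn : 0 < n) (hk : n < k) : (n : ZMod k) ≠ 0 := by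
  rw [Ne, ZMod.natCast_eq_zero_iff]
  exact fun h => absurd (Nat.le_of_dvd hn h) (by omega)

lemma zmod_add_one_ne {k : ℕ} (hk : 3 ≤ k) (i : ZMod k) : i + 1 ≠ i := by
  simpa using zmod_natCast_ne_zero_of_lt (n := 1) (k := k) one_pos (by omega)

lemma zmod_add_one_add_one_ne {k : ℕ} (hk : 3 ≤ k) (i : ZMod k) : i + 1 + 1 ≠ i := by
  have htwo := zmod_natCast_ne_zero_of_lt (n := 2) (k := k) two_pos (by omega)
  rw [add_assoc, one_add_one_eq_two]
  simpa using htwo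

lemma pair_eq_pair_iff {a b c d : F} :
    ({a, b} : Finset F) = {c, d} ↔ a = c ∧ b = d ∨ a = d ∧ b = c := by
  rw [← coe_inj]
  simp [Set.pair_eq_pair_iff]

lemma cycle_edge_injective {k : ℕ} (hk : 3 ≤ k) {x : ZMod k → F} (hx : Function.Injective x) :
    Function.Injective (fun i => ({x i, x (i + 1)} : Finset F)) := by
  intro i j h
  rcases pair_eq_pair_iff.1 h with h | h
  · exact hx h.1
  · have hij : i = j + 1 := hx h.1
    have hji : i + 1 = j := hx h.2
    rw [hij] at hji
    exact absurd hji (zmod_add_one_add_one_ne hk j)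

lemma card_cycleEdges {k : ℕ} [NeZero k] (hk : 3 ≤ k) {x : ZMod k → F}
    (hx : Function.Injective x) : #(cycleEdges x) = k := by
  rw [cycleEdges, card_image_of_injective _ (cycle_edge_injective hk hx), card_univ, ZMod.card]

lemma card_of_mem_cycleEdges {k : ℕ} [NeZero k] (hk : 3 ≤ k) {x : ZMod k → F}
    (hx : Function.Injective x) {e : Finset F} (he : e ∈ cycleEdges x) : #e = 2 := by
  obtain ⟨i, rfl⟩ := mem_cycleEdges.1 he
  exact card_pair (fun h => zmod_add_one_ne hk i (hx h).symm)

lemma even_card_cycleEdges_filter {k : ℕ} [NeZero k] (hk : 3 ≤ k) {x : ZMod k → F}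
    (hx : Function.Injective x) (z : F) : Even #{e ∈ cycleEdges x | z ∈ e} := by
  have himage : ({e ∈ cycleEdges x | z ∈ e} : Finset _) =
      ({i | z = x i ∨ z = x (i + 1)} : Finset (ZMod k)).image fun i => {x i, x (i + 1)} := by
    simp [cycleEdges, filter_image]
  rw [himage, card_image_of_injective _ (cycle_edge_injective hk hx)]
  by_cases hz : ∃ j, x j = z
  · obtain ⟨j, rfl⟩ := hz
    have hpair : ({i | x j = x i ∨ x j = x (i + 1)} : Finset (ZMod k)) = {j, j - 1} := by
      ext i
      simp only [mem_filter, mem_univ, true_and, mem_insert, mem_singleton, hx.eq_iff]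
      exact or_congr eq_comm ⟨fun h => eq_sub_of_add_eq h.symm, fun h => by rw [h]; simp⟩
    rw [hpair, card_pair]
    · exact even_two
    · intro h
      exact zmod_add_one_ne hk j (by nth_rewrite 1 [h]; simp)
  · have hnone : ∀ i, ¬ (z = x i ∨ z = x (i + 1)) := by
      rintro i (h | h) <;> exact hz ⟨_, h.symm⟩
    simp [hnone]

lemma exists_eq_of_cycleEdges_subset {k : ℕ} [NeZero k] {y z : ZMod k → F}
    (h : cycleEdges z ⊆ cycleEdges y) (i : ZMod k) : ∃ a, y a = z i := by
  obtain ⟨a, ha⟩ := mem_cycleEdges.1 (h (mem_cycleEdges.2 ⟨i, rfl⟩))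
  rcases pair_eq_pair_iff.1 ha with h | h
  exacts [⟨a, h.1⟩, ⟨a + 1, h.2⟩]

lemma injective_of_cycleEdges_eq {k : ℕ} [NeZero k] {y z : ZMod k → F} (hy : Function.Injective y)
    (h : cycleEdges z = cycleEdges y) : Function.Injective z := by
  have hsub : univ.image y ⊆ univ.image z := image_subset_iff.2 fun i _ => by
    obtain ⟨a, ha⟩ := exists_eq_of_cycleEdges_subset h.ge i
    exact mem_image.2 ⟨a, mem_univ a, ha⟩
  have hle := card_le_card hsub
  rw [card_image_of_injective _ hy] at hle
  simpa using card_image_iff.1 (card_image_le.antisymm hle)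

lemma cycleEdges_shift {k : ℕ} [NeZero k] (x : ZMod k → F) (a : ZMod k) :
    cycleEdges (fun i => x (i + a)) = cycleEdges x := by
  ext e
  simp only [mem_cycleEdges]
  constructor
  · rintro ⟨i, rfl⟩
    exact ⟨i + a, by rw [add_right_comm]⟩
  · rintro ⟨i, rfl⟩
    exact ⟨i - a, by rw [add_right_comm, sub_add_cancel]⟩

lemma IsModTwoCycle.exists_next {S : Finset (Finset F)} (hS : IsModTwoCycle S) {a b : F}
    (hab : ({a, b} : Finset F) ∈ S) : ∃ c, c ≠ a ∧ c ≠ b ∧ ({b, c} : Finset F) ∈ S := by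
  have hmem : ({a, b} : Finset F) ∈ ({e ∈ S | b ∈ e} : Finset _) := by simp [hab]
  have htwo : 2 ≤ #{e ∈ S | b ∈ e} := by
    obtain ⟨m, hm⟩ := hS.even_card b
    have := card_pos.2 ⟨_, hmem⟩
    omega
  obtain ⟨e, he, hne⟩ := exists_mem_ne (s := ({e ∈ S | b ∈ e} : Finset _)) (by omega)
    ({a, b} : Finset F)
  simp only [mem_filter] at he
  obtain ⟨c, hbc, rfl⟩ : ∃ c, b ≠ c ∧ e = {b, c} := by
    obtain ⟨p, q, hpq, rfl⟩ := card_eq_two.1 (hS.card_edge e he.1)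
    rcases mem_insert.1 he.2 with rfl | hb
    · exact ⟨q, hpq, rfl⟩
    · rw [mem_singleton] at hb
      subst hb
      exact ⟨p, hpq.symm, pair_comm _ _⟩
  refine ⟨c, ?_, hbc.symm, he.1⟩
  rintro rfl
  exact hne (pair_comm _ _)

lemma IsModTwoCycle.exists_walk {S : Finset (Finset F)} (hS : IsModTwoCycle S)
    (hne : S.Nonempty) : ∃ w : ℕ → F, ∀ n, {w n, w (n + 1)} ∈ S ∧ w (n + 2) ≠ w n := by
  have hnext (p : {p : F × F // {p.1, p.2} ∈ S}) :
      ∃ q : {p : F × F // {p.1, p.2} ∈ S}, q.1.1 = p.1.2 ∧ q.1.2 ≠ p.1.1 := by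
    obtain ⟨c, hca, -, hc⟩ := hS.exists_next p.2
    exact ⟨⟨(p.1.2, c), hc⟩, rfl, hca⟩
  choose next hfst hsnd using hnext
  obtain ⟨e, he⟩ := hne
  obtain ⟨a, b, -, rfl⟩ := card_eq_two.1 (hS.card_edge e he)
  let p (n : ℕ) := next^[n] ⟨(a, b), he⟩
  have hp (n : ℕ) : p (n + 1) = next (p n) := Function.iterate_succ_apply' _ _ _
  refine ⟨fun n => (p n).1.1, fun n => ⟨?_, ?_⟩⟩
  · simpa only [hp, hfst] using (p n).2
  · simpa only [hp, hfst] using hsnd (p n)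

lemma IsModTwoCycle.exists_cycleEdges_subset {S : Finset (Finset F)} (hS : IsModTwoCycle S)
    (hne : S.Nonempty) : ∃ k, 3 ≤ k ∧ ∃ (_ : NeZero k) (x : ZMod k → F),
      Function.Injective x ∧ cycleEdges x ⊆ S := by
  classical
  obtain ⟨w, hw⟩ := hS.exists_walk hne
  have hstep (n : ℕ) : w (n + 1) ≠ w n := fun h => by
    simpa [h] using hS.card_edge _ (hw n).1
  have hreturn : ∃ k, 0 < k ∧ ∃ i, w (i + k) = w i := by
    obtain ⟨i, j, hij, heq⟩ := Finite.exists_ne_map_eq_of_infinite fun n =>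
      (⟨w n, mem_biUnion.2 ⟨_, (hw n).1, mem_insert_self _ _⟩⟩ : S.biUnion id)
    rw [Subtype.mk.injEq] at heq
    rcases hij.lt_or_gt with h | h
    · exact ⟨j - i, by omega, i, by rw [Nat.add_sub_cancel' h.le, heq]⟩
    · exact ⟨i - j, by omega, j, by rw [Nat.add_sub_cancel' h.le, heq]⟩
  obtain ⟨k, ⟨hpos, i, hi⟩, hmin⟩ : ∃ k, (0 < k ∧ ∃ i, w (i + k) = w i) ∧
      ∀ l < k, ¬ (0 < l ∧ ∃ i, w (i + l) = w i) :=
    ⟨Nat.find hreturn, Nat.find_spec hreturn, fun l hl => Nat.find_min hreturn hl⟩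
  have hthree : 3 ≤ k := by
    by_contra hk
    obtain rfl | rfl : k = 1 ∨ k = 2 := by omega
    · exact hstep i hi
    · exact (hw i).2 hi
  have hinj {a b : ℕ} (hab : a < b) (hb : b < k) : w (i + a) ≠ w (i + b) := fun h =>
    hmin (b - a) (by omega) ⟨by omega, i + a, by rw [h]; congr 1; omega⟩
  have : NeZero k := ⟨by omega⟩
  have : Fact (1 < k) := ⟨by omega⟩
  refine ⟨k, hthree, inferInstance, fun p => w (i + p.val), fun p q hpq => ?_, ?_⟩
  · by_contra hne
    rcases (ZMod.val_injective k).ne hne |>.lt_or_gt with h | h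
    · exact hinj h q.val_lt hpq
    · exact hinj h p.val_lt hpq.symm
  · refine cycleEdges_subset_iff.2 fun p => ?_
    have hsucc : w (i + (p + 1).val) = w (i + p.val + 1) := by
      rw [ZMod.val_add, ZMod.val_one]
      rcases (Nat.succ_le_of_lt p.val_lt).lt_or_eq with h | h
      · rw [Nat.mod_eq_of_lt h, add_assoc]
      · have hlast : p.val + 1 = k := h
        rw [add_assoc, hlast, Nat.mod_self, add_zero, hi]
    rw [hsucc]
    exact (hw _).1

lemma IsModTwoCycle.eq_empty_of_card_le_two {S : Finset (Finset F)} (hS : IsModTwoCycle S)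
    (hcard : #S ≤ 2) : S = ∅ := by
  by_contra hne
  obtain ⟨k, hk, _, x, hx, hsub⟩ := hS.exists_cycleEdges_subset (nonempty_iff_ne_empty.2 hne)
  have := card_le_card hsub
  rw [card_cycleEdges hk hx] at this
  omega

lemma IsModTwoCycle.eq_cycleEdges {k : ℕ} [NeZero k] (hk : 3 ≤ k) {x : ZMod k → F}
    (hx : Function.Injective x) {S : Finset (Finset F)} (hS : IsModTwoCycle S)
    (hsub : cycleEdges x ⊆ S) (hcard : #S ≤ k + 2) : S = cycleEdges x := by
  have hdiff : IsModTwoCycle (S \ cycleEdges x) := by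
    refine ⟨fun e he => hS.card_edge e (mem_sdiff.1 he).1, fun z => ?_⟩
    have hfilter : ({e ∈ S \ cycleEdges x | z ∈ e} : Finset _) =
        ({e ∈ S | z ∈ e} : Finset _) \ ({e ∈ cycleEdges x | z ∈ e} : Finset _) := by
      grind
    rw [hfilter, card_sdiff_of_subset (filter_subset_filter _ hsub)]
    exact (hS.even_card z).tsub (even_card_cycleEdges_filter hk hx z)
  refine (sdiff_eq_empty_iff_subset.1 (hdiff.eq_empty_of_card_le_two ?_)).antisymm hsub
  rw [card_sdiff_of_subset hsub, card_cycleEdges hk hx]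
  omega

lemma IsModTwoCycle.exists_eq_cycleEdges {S : Finset (Finset F)} (hS : IsModTwoCycle S)
    (hne : S.Nonempty) (hcard : #S ≤ 5) : ∃ k, 3 ≤ k ∧ k ≤ 5 ∧ ∃ (_ : NeZero k)
      (x : ZMod k → F), Function.Injective x ∧ S = cycleEdges x := by
  obtain ⟨k, hk, _, x, hx, hsub⟩ := hS.exists_cycleEdges_subset hne
  have hle : k ≤ #S := card_cycleEdges hk hx ▸ card_le_card hsub
  exact ⟨k, hk, hle.trans hcard, inferInstance, x, hx,
    hS.eq_cycleEdges hk hx hsub (by omega)⟩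

omit [DecidableEq F] in
lemma exists_three_cycle {a b c : F} (hab : a ≠ b) (hbc : b ≠ c) (hca : c ≠ a) :
    ∃ x : ZMod 3 → F, Function.Injective x ∧ x 0 = a ∧ x 1 = b ∧ x 2 = c := by
  refine ⟨(![a, b, c] : Fin 3 → F), ?_, rfl, rfl, rfl⟩
  intro i j hij
  fin_cases i <;> fin_cases j <;> first | rfl | (exfalso; revert hij; simp [*, Ne.symm])

omit [DecidableEq F] in
lemma exists_four_cycle {a b c d : F} (hab : a ≠ b) (hbc : b ≠ c) (hcd : c ≠ d) (hda : d ≠ a)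
    (hac : a ≠ c) (hbd : b ≠ d) :
    ∃ x : ZMod 4 → F, Function.Injective x ∧ x 0 = a ∧ x 1 = b ∧ x 2 = c ∧ x 3 = d := by
  refine ⟨(![a, b, c, d] : Fin 4 → F), ?_, rfl, rfl, rfl, rfl⟩
  intro i j hij
  fin_cases i <;> fin_cases j <;> first | rfl | (exfalso; revert hij; simp [*, Ne.symm])

lemma zmod_three_cases (i : ZMod 3) : i = 0 ∨ i = 1 ∨ i = 2 := by revert i; decide

lemma zmod_four_cases (i : ZMod 4) : i = 0 ∨ i = 1 ∨ i = 2 ∨ i = 3 := by revert i; decide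

lemma cycleEdges_three (x : ZMod 3 → F) :
    cycleEdges x = {{x 0, x 1}, {x 1, x 2}, {x 2, x 0}} := by
  have huniv : (univ : Finset (ZMod 3)) = {0, 1, 2} := by decide
  rw [cycleEdges, huniv]
  simp only [image_insert, image_singleton]
  rfl

lemma cycleEdges_four (x : ZMod 4 → F) :
    cycleEdges x = {{x 0, x 1}, {x 1, x 2}, {x 2, x 3}, {x 3, x 0}} := by
  have huniv : (univ : Finset (ZMod 4)) = {0, 1, 2, 3} := by decide
  rw [cycleEdges, huniv]
  simp only [image_insert, image_singleton]
  rfl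

lemma cycleEdges_five (x : ZMod 5 → F) :
    cycleEdges x = {{x 0, x 1}, {x 1, x 2}, {x 2, x 3}, {x 3, x 4}, {x 4, x 0}} := by
  have huniv : (univ : Finset (ZMod 5)) = {0, 1, 2, 3, 4} := by decide
  rw [cycleEdges, huniv]
  simp only [image_insert, image_singleton]
  rfl

end Cycles

end TriangulatedSphere

namespace TriangulatedSphere

variable {F V : Type*} [Fintype F] [Fintype V] [DecidableEq F] [DecidableEq V]
  {K : TriangulatedSphere F V}

/-! ### Regions bounded by a cycle -/

section Region

variable {k : ℕ} [NeZero k] {x : ZMod k → F} {T : Finset V}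

lemma exists_mem_notMem_of_cycle (hT : K.boundary T = cycleEdges x) (i : ZMod k) :
    ∃ v ∈ T, ∃ w ∉ T, {x i, x (i + 1)} ⊆ K.facetsAt v ∧ {x i, x (i + 1)} ⊆ K.facetsAt w :=
  exists_mem_notMem_of_mem_boundary (by rw [hT]; exact mem_cycleEdges.2 ⟨i, rfl⟩)

lemma notMem_inside_of_cycle (hT : K.boundary T = cycleEdges x) (i : ZMod k) :
    x i ∉ K.inside T := by
  intro h
  obtain ⟨v, -, w, hw, -, hiw⟩ := exists_mem_notMem_of_cycle hT i
  exact hw (mem_inside.1 h (mem_star.2 (hiw (by simp))))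

lemma mem_inside_or_of_notMem_cycle (hT : K.boundary T = cycleEdges x) {y : F} (hy : ∀ i, x i ≠ y) :
    y ∈ K.inside T ∨ y ∈ K.inside Tᶜ := by
  rw [mem_inside, mem_inside]
  refine star_subset_or_disjoint fun e he hye => ?_
  rw [hT] at he
  obtain ⟨i, rfl⟩ := mem_cycleEdges.1 he
  simp only [mem_insert, mem_singleton] at hye
  rcases hye with rfl | rfl
  · exact hy _ rfl
  · exact hy _ rfl

lemma mem_inside_or_of_mem (hT : K.boundary T = cycleEdges x) {v : V} (hv : v ∈ T) {y : F}
    (hy : y ∈ K.facetsAt v) : y ∈ K.inside T ∨ ∃ i, x i = y := by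
  by_cases h : ∃ i, x i = y
  · exact Or.inr h
  · push Not at h
    refine Or.inl ((mem_inside_or_of_notMem_cycle hT h).resolve_right fun h' => ?_)
    have := mem_inside.1 h' (mem_star.2 hy)
    simp [hv] at this

lemma disjoint_inside_image (hT : K.boundary T = cycleEdges x) :
    Disjoint (K.inside T) (univ.image x) := by
  rw [disjoint_left]
  intro y hy hy'
  obtain ⟨i, -, rfl⟩ := mem_image.1 hy'
  exact notMem_inside_of_cycle hT i hy

lemma disjoint_inside_inside_compl (T : Finset V) : Disjoint (K.inside T) (K.inside Tᶜ) := by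
  rw [disjoint_left]
  intro y hy hy'
  obtain ⟨v, hv⟩ := star_nonempty (K := K) y
  have := mem_inside.1 hy' hv
  simp [mem_inside.1 hy hv] at this

lemma card_inside_add_card_inside_compl (hx : Function.Injective x)
    (hT : K.boundary T = cycleEdges x) :
    #(K.inside T) + #(K.inside Tᶜ) + k = Fintype.card F := by
  have hT' : K.boundary Tᶜ = cycleEdges x := by rw [boundary_compl, hT]
  have huniv : (univ : Finset F) = (K.inside T ∪ K.inside Tᶜ) ∪ univ.image x := by
    ext y
    simp only [mem_univ, mem_union, mem_image, true_and, true_iff]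
    by_cases hy : ∃ i, x i = y
    · exact Or.inr hy
    · push Not at hy
      exact Or.inl (mem_inside_or_of_notMem_cycle hT hy)
  rw [← card_univ, huniv, card_union_of_disjoint, card_union_of_disjoint,
    card_image_of_injective _ hx, card_univ, ZMod.card]
  · exact disjoint_inside_inside_compl T
  · exact disjoint_union_left.2 ⟨disjoint_inside_image hT, disjoint_inside_image hT'⟩

lemma eq_of_forall_add_one {α : Type*} (g : ZMod k → α) (hg : ∀ i, g (i + 1) = g i) (i : ZMod k) :
    g i = g 0 := by
  rw [← ZMod.natCast_zmod_val i]
  induction i.val with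
  | zero => rw [Nat.cast_zero]
  | succ n ih => rw [Nat.cast_succ, hg, ih]

/-- A function on the disc which is constant along its edges extends by its value on the boundary
cycle to the whole sphere, which is connected. -/
lemma edgeConnected_inside_union_image (hk : 3 ≤ k) (hx : Function.Injective x)
    (hT : K.boundary T = cycleEdges x) :
    EdgeConnected (K.inside T ∪ univ.image x) (K.edges T) := by
  intro g hg
  have hcycle : ∀ i, g (x i) = g (x 0) := by
    refine eq_of_forall_add_one (g ∘ x) fun i => ?_
    obtain ⟨v, hv, -, -, hiv, -⟩ := exists_mem_notMem_of_cycle hT i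
    refine hg {x i, x (i + 1)} (mem_edges.2 ⟨?_, v, hv, hiv⟩) _ (by simp) _ (by simp)
    exact card_of_mem_cycleEdges hk hx (mem_cycleEdges.2 ⟨i, rfl⟩)
  let extension (z : F) : ZMod 2 := if z ∈ K.inside T then g z else g (x 0)
  have hinside : ∀ e ∈ K.edges univ, ∀ z ∈ e, ∀ w ∈ e, z ∈ K.inside T →
      extension z = extension w := by
    intro e he z hz w hw hzT
    obtain ⟨hcard, v, -, hev⟩ := mem_edges.1 he
    have hv : v ∈ T := mem_inside.1 hzT (mem_star.2 (hev hz))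
    simp only [extension, if_pos hzT]
    rw [hg e (mem_edges.2 ⟨hcard, v, hv, hev⟩) z hz w hw]
    split_ifs with hwT
    · rfl
    · obtain ⟨i, rfl⟩ := (mem_inside_or_of_mem hT hv (hev hw)).resolve_left hwT
      exact hcycle i
  have hconst : ∀ z w, extension z = extension w := by
    refine eq_of_forall_edge (K := K) extension fun e he z hz w hw => ?_
    by_cases hzT : z ∈ K.inside T
    · exact hinside e he z hz w hw hzT
    · by_cases hwT : w ∈ K.inside T
      · exact (hinside e he w hw z hz hwT).symm
      · simp only [extension, if_neg hzT, if_neg hwT]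
  have hvalue : ∀ z ∈ K.inside T ∪ univ.image x, g z = extension z := by
    intro z hz
    simp only [mem_union, mem_image, mem_univ, true_and] at hz
    rcases hz with hz | ⟨i, rfl⟩
    · simp only [extension, if_pos hz]
    · simp only [extension, if_neg (notMem_inside_of_cycle hT i), hcycle i]
  intro y hy z hz
  rw [hvalue y hy, hvalue z hz, hconst y z]

lemma two_mul_card_inside_add_le (hk : 3 ≤ k) (hx : Function.Injective x)
    (hT : K.boundary T = cycleEdges x) : 2 * #(K.inside T) + k ≤ #T + 2 := by
  have hne : T ≠ univ := by
    obtain ⟨v, -, w, hw, -⟩ := exists_mem_notMem_of_cycle hT 0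
    rintro rfl
    simp at hw
  have hcard := card_add_card_le_card_edges_add_one hne
    (fun v hv y hy => by simpa using mem_inside_or_of_mem hT hv hy)
    (edgeConnected_inside_union_image hk hx hT)
  rw [card_union_of_disjoint (disjoint_inside_image hT), card_image_of_injective _ hx, card_univ,
    ZMod.card] at hcard
  have hedges := two_mul_card_edges (K := K) T
  rw [hT, card_cycleEdges hk hx] at hedges
  omega

/-- Euler's formula for a disc; the two inequalities for the two discs bounded by the cycle add up
to Euler's formula for the sphere. -/
lemma card_add_two_eq (hk : 3 ≤ k) (hx : Function.Injective x)
    (hT : K.boundary T = cycleEdges x) : #T + 2 = 2 * #(K.inside T) + k := by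
  have hle := two_mul_card_inside_add_le hk hx hT
  have hle' := two_mul_card_inside_add_le hk hx (T := Tᶜ) (K := K) (by rw [boundary_compl, hT])
  have hinside := card_inside_add_card_inside_compl hx hT
  have heuler := K.euler
  have hcompl := card_add_card_compl T
  omega

end Region

end TriangulatedSphere

namespace TriangulatedSphere

variable {F V : Type*} [Fintype F] [Fintype V] [DecidableEq F] [DecidableEq V]
  {K : TriangulatedSphere F V}

/-! ### Belts -/

/-- A belt: an induced cycle which is not the boundary of a triangle. -/
structure IsBelt (K : TriangulatedSphere F V) {k : ℕ} (x : ZMod k → F) : Prop where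
  injective : Function.Injective x
  adj : ∀ i, K.Adj (x i) (x (i + 1))
  chordless : ∀ i j, K.Adj (x i) (x j) → j = i + 1 ∨ i = j + 1
  not_common : ¬ ∃ v, ∀ i, x i ∈ K.facetsAt v

/-- The vertices of `T` at which exactly `j` facets are inside `T`. -/
def level (K : TriangulatedSphere F V) (T : Finset V) (j : ℕ) : Finset V :=
  {v ∈ T | #(K.facetsAt v ∩ K.inside T) = j}

/-- The vertices all of whose facets are inside `T`. -/
def core (K : TriangulatedSphere F V) (T : Finset V) : Finset V :=
  {v | K.facetsAt v ⊆ K.inside T}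

lemma mem_core {T : Finset V} {v : V} : v ∈ K.core T ↔ K.facetsAt v ⊆ K.inside T := by simp [core]

lemma exists_mem_facetsAt_of_vertex (v : V) : ∃ x, x ∈ K.facetsAt v :=
  card_pos.1 (by rw [K.card_facetsAt]; omega)

lemma core_subset (T : Finset V) : K.core T ⊆ T := fun v hv => by
  obtain ⟨x, hx⟩ := exists_mem_facetsAt_of_vertex (K := K) v
  exact mem_inside.1 (mem_core.1 hv hx) (mem_star.2 hx)

lemma level_three_eq_core (T : Finset V) : K.level T 3 = K.core T := by
  ext v
  simp only [level, mem_filter, mem_core]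
  constructor
  · rintro ⟨-, h⟩
    have := eq_of_subset_of_card_le (inter_subset_left (s₁ := K.facetsAt v) (s₂ := K.inside T))
      (by rw [K.card_facetsAt, h])
    exact this ▸ inter_subset_right
  · intro h
    exact ⟨core_subset T (mem_core.2 h), by rw [inter_eq_left.2 h, K.card_facetsAt]⟩

lemma adj_of_mem {v : V} {x y : F} (h : x ≠ y) (hx : x ∈ K.facetsAt v) (hy : y ∈ K.facetsAt v) :
    K.Adj x y := ⟨h, v, hx, hy⟩

lemma adj_of_mem_edges {T : Finset V} {x y : F} (h : {x, y} ∈ K.edges T) : K.Adj x y := by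
  obtain ⟨h2, v, -, hv⟩ := mem_edges.1 h
  refine ⟨?_, v, hv (by simp), hv (by simp)⟩
  rintro rfl
  simp at h2

lemma Adj.pair_mem_edges {x y : F} (h : K.Adj x y) : {x, y} ∈ K.edges univ := by
  obtain ⟨hne, v, hx, hy⟩ := h
  exact mem_edges.2 ⟨card_pair hne, v, mem_univ _, by simp [insert_subset_iff, hx, hy]⟩

lemma boundary_core_subset (T : Finset V) :
    K.boundary (K.core T) ⊆ (K.level T 2).image fun v => K.facetsAt v ∩ K.inside T := by
  intro e he
  obtain ⟨w, hw, u, hu, hew, heu⟩ := exists_mem_notMem_of_mem_boundary he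
  have hcard := card_eq_two_of_mem_boundary he
  have hinside := hew.trans (mem_core.1 hw)
  obtain ⟨z, hz⟩ := card_pos.1 (by omega : 0 < #e)
  have huT : u ∈ T := mem_inside.1 (hinside hz) (mem_star.2 (heu hz))
  have hsub : e ⊆ K.facetsAt u ∩ K.inside T := subset_inter heu hinside
  have hne : #(K.facetsAt u ∩ K.inside T) ≠ 3 := by
    intro h
    refine hu ?_
    rw [← level_three_eq_core]
    simp [level, huT, h]
  have hge := card_le_card hsub
  have hle := card_le_card (inter_subset_left (s₁ := K.facetsAt u) (s₂ := K.inside T))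
  rw [K.card_facetsAt] at hle
  refine mem_image.2 ⟨u, ?_, (eq_of_subset_of_card_le hsub (by omega)).symm⟩
  simp only [level, mem_filter, huT, true_and]
  omega

lemma card_boundary_core_le (T : Finset V) : #(K.boundary (K.core T)) ≤ #(K.level T 2) :=
  (card_le_card (boundary_core_subset T)).trans card_image_le

lemma sum_deg_eq_sum_card_inter_inside (T : Finset V) :
    ∑ y ∈ K.inside T, K.deg y = ∑ v ∈ T, #(K.facetsAt v ∩ K.inside T) := by
  calc ∑ y ∈ K.inside T, K.deg y
      = ∑ y ∈ K.inside T, #{v ∈ T | y ∈ K.facetsAt v} := by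
        refine sum_congr rfl fun y hy => congrArg card (ext fun v => ?_)
        rw [mem_star, mem_filter]
        exact ⟨fun h => ⟨mem_inside.1 hy (mem_star.2 h), h⟩, fun h => h.2⟩
    _ = ∑ v ∈ T, #{y ∈ K.inside T | y ∈ K.facetsAt v} :=
        sum_card_bipartiteAbove_eq_sum_card_bipartiteBelow fun y v => y ∈ K.facetsAt v
    _ = ∑ v ∈ T, #(K.facetsAt v ∩ K.inside T) := by
        simp only [filter_mem_eq_inter, inter_comm]

section Belt

variable {k : ℕ} [NeZero k] {x : ZMod k → F} {T : Finset V}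

lemma IsBelt.not_subset_range (hk : 3 ≤ k) (hx : K.IsBelt x) (v : V) :
    ∃ y ∈ K.facetsAt v, ∀ i, x i ≠ y := by
  by_contra! h
  obtain ⟨a, b, c, hab, hac, hbc, habc⟩ := card_eq_three.1 (K.card_facetsAt v)
  obtain ⟨i, rfl⟩ := h a (by simp [habc])
  obtain ⟨j, rfl⟩ := h b (by simp [habc])
  obtain ⟨l, rfl⟩ := h c (by simp [habc])
  have hij : i ≠ j := fun h => hab (by rw [h])
  have hil : i ≠ l := fun h => hac (by rw [h])
  have hjl : j ≠ l := fun h => hbc (by rw [h])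
  have hadj {a b : F} (hab : a ≠ b) (ha : a ∈ K.facetsAt v) (hb : b ∈ K.facetsAt v) :
      K.Adj a b := adj_of_mem hab ha hb
  have hthree : ((3 : ℕ) : ZMod k) = 0 := by
    push_cast
    rcases hx.chordless i j (hadj hab (by simp [habc]) (by simp [habc])) with h | h <;>
    rcases hx.chordless i l (hadj hac (by simp [habc]) (by simp [habc])) with h' | h' <;>
    rcases hx.chordless j l (hadj hbc (by simp [habc]) (by simp [habc])) with h'' | h'' <;>
    grind
  obtain rfl : k = 3 := by
    have := Nat.le_of_dvd (by omega) ((ZMod.natCast_eq_zero_iff 3 k).1 hthree)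
    omega
  refine hx.not_common ⟨v, fun m => ?_⟩
  have hcover : ∀ i j l m : ZMod 3, i ≠ j → i ≠ l → j ≠ l → m = i ∨ m = j ∨ m = l := by decide
  rw [habc]
  rcases hcover i j l m hij hil hjl with rfl | rfl | rfl <;> simp

lemma IsBelt.exists_inside (hk : 3 ≤ k) (hx : K.IsBelt x) (hT : K.boundary T = cycleEdges x) {v : V}
    (hv : v ∈ T) : ∃ y ∈ K.facetsAt v, y ∈ K.inside T := by
  obtain ⟨y, hy, hne⟩ := hx.not_subset_range hk v
  refine ⟨y, hy, (mem_inside_or_of_mem hT hv hy).resolve_right ?_⟩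
  rintro ⟨i, hi⟩
  exact hne i hi

lemma card_facetsAt_sdiff_add_card_inter (v : V) (A : Finset F) :
    #(K.facetsAt v \ A) + #(K.facetsAt v ∩ A) = 3 := by
  rw [card_sdiff_add_card_inter, K.card_facetsAt]

lemma IsBelt.sdiff_inside_mem_boundary (hx : K.IsBelt x) (hT : K.boundary T = cycleEdges x) {v : V}
    (hv : v ∈ K.level T 1) : K.facetsAt v \ K.inside T ∈ K.boundary T := by
  simp only [level, mem_filter] at hv
  have hcard : #(K.facetsAt v \ K.inside T) = 2 := by
    have := card_facetsAt_sdiff_add_card_inter (K := K) v (K.inside T)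
    omega
  obtain ⟨a, b, hab, heq⟩ := card_eq_two.1 hcard
  have ha : a ∈ K.facetsAt v \ K.inside T := by simp [heq]
  have hb : b ∈ K.facetsAt v \ K.inside T := by simp [heq]
  rw [mem_sdiff] at ha hb
  obtain ⟨i, rfl⟩ := (mem_inside_or_of_mem hT hv.1 ha.1).resolve_left ha.2
  obtain ⟨j, rfl⟩ := (mem_inside_or_of_mem hT hv.1 hb.1).resolve_left hb.2
  rw [heq, hT, mem_cycleEdges]
  rcases hx.chordless i j (adj_of_mem hab ha.1 hb.1) with rfl | rfl
  · exact ⟨i, rfl⟩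
  · exact ⟨j, pair_comm _ _⟩

lemma IsBelt.exists_sdiff_inside_eq (hk : 3 ≤ k) (hx : K.IsBelt x)
    (hT : K.boundary T = cycleEdges x) {e : Finset F} (he : e ∈ K.boundary T) :
    ∃ v ∈ K.level T 1, K.facetsAt v \ K.inside T = e := by
  obtain ⟨v, hv, -, -, hev, -⟩ := exists_mem_notMem_of_mem_boundary he
  have hcard := card_eq_two_of_mem_boundary he
  have hsub : e ⊆ K.facetsAt v \ K.inside T := by
    rw [hT] at he
    obtain ⟨i, rfl⟩ := mem_cycleEdges.1 he
    intro z hz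
    refine mem_sdiff.2 ⟨hev hz, ?_⟩
    simp only [mem_insert, mem_singleton] at hz
    rcases hz with rfl | rfl <;> exact notMem_inside_of_cycle hT _
  obtain ⟨y, hy, hyT⟩ := hx.exists_inside hk hT hv
  have hpos : 0 < #(K.facetsAt v ∩ K.inside T) := card_pos.2 ⟨y, mem_inter.2 ⟨hy, hyT⟩⟩
  have hsum := card_facetsAt_sdiff_add_card_inter (K := K) v (K.inside T)
  have hle := card_le_card hsub
  refine ⟨v, ?_, (eq_of_subset_of_card_le hsub (by omega)).symm⟩
  simp only [level, mem_filter, hv, true_and]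
  omega

lemma IsBelt.card_level_one (hk : 3 ≤ k) (hx : K.IsBelt x) (hT : K.boundary T = cycleEdges x) :
    #(K.level T 1) = k := by
  rw [← card_cycleEdges hk hx.injective, ← hT]
  refine card_bij (fun v _ => K.facetsAt v \ K.inside T)
    (fun v hv => hx.sdiff_inside_mem_boundary hT hv) (fun v hv w hw h => ?_)
    fun e he => by simpa only [exists_prop] using hx.exists_sdiff_inside_eq hk hT he
  by_contra hne
  have hmem := hx.sdiff_inside_mem_boundary hT hv
  rw [mem_boundary_iff (card_eq_two_of_mem_boundary hmem) hne sdiff_subset (h ▸ sdiff_subset) T]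
    at hmem
  simp only [level, mem_filter] at hv hw
  simp [hv.1, hw.1] at hmem

lemma IsBelt.card_levels (hk : 3 ≤ k) (hx : K.IsBelt x) (hT : K.boundary T = cycleEdges x) :
    #T = #(K.level T 1) + #(K.level T 2) + #(K.level T 3) ∧
    ∑ v ∈ T, #(K.facetsAt v ∩ K.inside T) =
      #(K.level T 1) + 2 * #(K.level T 2) + 3 * #(K.level T 3) := by
  have hcases : ∀ v ∈ T, #(K.facetsAt v ∩ K.inside T) = 1 ∨ #(K.facetsAt v ∩ K.inside T) = 2 ∨
      #(K.facetsAt v ∩ K.inside T) = 3 := by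
    intro v hv
    obtain ⟨y, hy, hyT⟩ := hx.exists_inside hk hT hv
    have hpos : 0 < #(K.facetsAt v ∩ K.inside T) := card_pos.2 ⟨y, mem_inter.2 ⟨hy, hyT⟩⟩
    have hsum := card_facetsAt_sdiff_add_card_inter (K := K) v (K.inside T)
    omega
  simp only [level, card_filter, mul_sum, ← sum_add_distrib]
  constructor
  · rw [card_eq_sum_ones]
    refine sum_congr rfl fun v hv => ?_
    rcases hcases v hv with h | h | h <;> simp [h]
  · refine sum_congr rfl fun v hv => ?_
    rcases hcases v hv with h | h | h <;> simp [h]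

lemma IsBelt.card_eq_add (hk : 3 ≤ k) (hx : K.IsBelt x) (hT : K.boundary T = cycleEdges x) :
    #T = k + #(K.level T 2) + #(K.core T) := by
  rw [(hx.card_levels hk hT).1, hx.card_level_one hk hT, level_three_eq_core]

lemma IsBelt.card_level_two_add (hk : 3 ≤ k) (hx : K.IsBelt x)
    (hT : K.boundary T = cycleEdges x) :
    #(K.level T 2) + #(K.core T) + 2 = 2 * #(K.inside T) := by
  have hcard := hx.card_eq_add hk hT
  have heuler := card_add_two_eq hk hx.injective hT
  omega

lemma IsBelt.sum_deg_inside (hk : 3 ≤ k) (hx : K.IsBelt x) (hT : K.boundary T = cycleEdges x) :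
    ∑ y ∈ K.inside T, K.deg y = k + 2 * #(K.level T 2) + 3 * #(K.core T) := by
  rw [sum_deg_eq_sum_card_inter_inside, (hx.card_levels hk hT).2, hx.card_level_one hk hT,
    level_three_eq_core]

lemma IsBelt.exists_region (hk : 3 ≤ k) (hx : K.IsBelt x) : ∃ T, K.boundary T = cycleEdges x := by
  refine exists_boundary_eq ?_ (even_card_cycleEdges_filter hk hx.injective)
  intro e he
  obtain ⟨i, rfl⟩ := mem_cycleEdges.1 he
  exact (hx.adj i).pair_mem_edges

end Belt

/-! ### Short cycles which are not belts -/

/-- There are no `k`-belts. -/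
def NoBelt (K : TriangulatedSphere F V) (k : ℕ) : Prop := ∀ x : ZMod k → F, ¬ K.IsBelt x

lemma exists_vertex_of_not_isBelt {x : ZMod 3 → F} (hx : Function.Injective x)
    (hadj : ∀ i, K.Adj (x i) (x (i + 1))) (hb : ¬ K.IsBelt x) :
    ∃ v, K.facetsAt v = {x 0, x 1, x 2} := by
  by_contra hv
  refine hb ⟨hx, hadj, ?_, ?_⟩
  · intro i j hij
    have : i ≠ j := fun h => hij.1 (by rw [h])
    clear hij
    revert i j
    decide
  · rintro ⟨v, h⟩
    refine hv ⟨v, (eq_of_subset_of_card_le ?_ ?_).symm⟩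
    · simp [insert_subset_iff, h]
    · have hne : ∀ i j : ZMod 3, i ≠ j → x i ≠ x j := fun i j h h' => h (hx h')
      rw [K.card_facetsAt, card_eq_three.2 ⟨_, _, _, hne 0 1 (by decide), hne 0 2 (by decide),
        hne 1 2 (by decide), rfl⟩]

lemma NoBelt.exists_vertex (hno3 : K.NoBelt 3) {a b c : F} (hab : K.Adj a b) (hbc : K.Adj b c)
    (hca : K.Adj c a) : ∃ v, K.facetsAt v = {a, b, c} := by
  obtain ⟨x, hx, rfl, rfl, rfl⟩ := exists_three_cycle hab.1 hbc.1 hca.1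
  refine exists_vertex_of_not_isBelt hx ?_ (hno3 x)
  intro i
  rcases zmod_three_cases i with rfl | rfl | rfl
  exacts [hab, hbc, hca]

lemma diagonal_of_not_isBelt {x : ZMod 4 → F} (hx : Function.Injective x)
    (hadj : ∀ i, K.Adj (x i) (x (i + 1))) (hb : ¬ K.IsBelt x) :
    K.Adj (x 0) (x 2) ∨ K.Adj (x 1) (x 3) := by
  by_contra! hv
  have hch : ∀ i j, K.Adj (x i) (x j) → j = i + 1 ∨ i = j + 1 := by
    intro i j hij
    have hne : i ≠ j := fun h => hij.1 (by rw [h])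
    rcases zmod_four_cases i with rfl | rfl | rfl | rfl <;>
    rcases zmod_four_cases j with rfl | rfl | rfl | rfl <;>
    first
    | exact absurd rfl hne
    | exact absurd hij hv.1
    | exact absurd hij hv.2
    | exact absurd hij.symm hv.1
    | exact absurd hij.symm hv.2
    | decide
  refine hb ⟨hx, hadj, hch, ?_⟩
  rintro ⟨v, h⟩
  exact hv.1 (adj_of_mem (fun h => absurd (hx h) (by decide)) (h 0) (h 2))

lemma pair_mem_boundary_singleton {v : V} {a b c : F} (h : K.facetsAt v = {a, b, c}) {p q : F}
    (hpq : p ≠ q) : {p, q} ∈ K.boundary {v} ↔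
      (p = a ∨ p = b ∨ p = c) ∧ (q = a ∨ q = b ∨ q = c) := by
  rw [boundary_singleton, mem_powersetCard, h, card_pair hpq]
  simp [insert_subset_iff]

lemma isModTwoCycle_boundary (T : Finset V) : IsModTwoCycle (K.boundary T) :=
  ⟨fun _ => card_eq_two_of_mem_boundary, even_card_boundary_filter T⟩

lemma card_boundary_singleton (v : V) : #(K.boundary {v}) = 3 := by
  rw [boundary_singleton, card_powersetCard, K.card_facetsAt]
  rfl

lemma card_symmDiff_le {α : Type*} [DecidableEq α] (A B : Finset α) : #(A ∆ B) ≤ #A + #B := by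
  rw [symmDiff_def]
  exact (card_union_le _ _).trans (add_le_add (card_le_card sdiff_subset)
    (card_le_card sdiff_subset))

lemma exists_filling_three {x : ZMod 3 → F} (hx : Function.Injective x)
    (hadj : ∀ i, K.Adj (x i) (x (i + 1))) (hb : ¬ K.IsBelt x) :
    ∃ T, #T ≤ 1 ∧ K.boundary T = cycleEdges x := by
  obtain ⟨v, hv⟩ := exists_vertex_of_not_isBelt hx hadj hb
  refine ⟨{v}, by simp, (isModTwoCycle_boundary _).eq_cycleEdges le_rfl hx ?_
    (by rw [card_boundary_singleton]; omega)⟩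
  have h01 := (hadj 0).1
  have h12 := (hadj 1).1
  have h20 := (hadj 2).1
  rw [cycleEdges_three]
  simp only [insert_subset_iff, singleton_subset_iff]
  change x 0 ≠ x 1 at h01
  change x 1 ≠ x 2 at h12
  change x 2 ≠ x 0 at h20
  rw [pair_mem_boundary_singleton hv h01, pair_mem_boundary_singleton hv h12,
    pair_mem_boundary_singleton hv h20]
  simp

lemma exists_filling_four_of_diagonal (hno3 : K.NoBelt 3) {x : ZMod 4 → F}
    (hx : Function.Injective x) (hadj : ∀ i, K.Adj (x i) (x (i + 1))) (h02 : K.Adj (x 0) (x 2)) :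
    ∃ T, #T ≤ 2 ∧ K.boundary T = cycleEdges x := by
  have h01 : K.Adj (x 0) (x 1) := hadj 0
  have h12 : K.Adj (x 1) (x 2) := hadj 1
  have h23 : K.Adj (x 2) (x 3) := hadj 2
  have h30 : K.Adj (x 3) (x 0) := hadj 3
  have h13 : x 1 ≠ x 3 := fun h => absurd (hx h) (by decide)
  obtain ⟨v, hv⟩ := hno3.exists_vertex h01 h12 h02.symm
  obtain ⟨w, hw⟩ := hno3.exists_vertex h02 h23 h30
  refine ⟨{v} ∆ {w}, (card_symmDiff_le _ _).trans (by simp),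
    (isModTwoCycle_boundary _).eq_cycleEdges (by omega) hx ?_ ?_⟩
  · rw [cycleEdges_four, boundary_symmDiff]
    simp only [insert_subset_iff, singleton_subset_iff, mem_symmDiff,
      pair_mem_boundary_singleton hv h01.1, pair_mem_boundary_singleton hv h12.1,
      pair_mem_boundary_singleton hv h23.1, pair_mem_boundary_singleton hv h30.1,
      pair_mem_boundary_singleton hw h01.1, pair_mem_boundary_singleton hw h12.1,
      pair_mem_boundary_singleton hw h23.1, pair_mem_boundary_singleton hw h30.1]
    have := h01.1; have := h12.1; have := h23.1; have := h30.1; have := h02.1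
    grind
  · rw [boundary_symmDiff]
    refine (card_symmDiff_le _ _).trans ?_
    rw [card_boundary_singleton, card_boundary_singleton]

lemma exists_filling_four (hno3 : K.NoBelt 3) {x : ZMod 4 → F} (hx : Function.Injective x)
    (hadj : ∀ i, K.Adj (x i) (x (i + 1))) (hb : ¬ K.IsBelt x) :
    ∃ T, #T ≤ 2 ∧ K.boundary T = cycleEdges x := by
  rcases diagonal_of_not_isBelt hx hadj hb with h | h
  · exact exists_filling_four_of_diagonal hno3 hx hadj h
  · obtain ⟨T, hT, hbd⟩ := exists_filling_four_of_diagonal hno3 (x := fun i => x (i + 1))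
      (fun i j h => add_right_cancel (hx h)) (fun i => hadj (i + 1)) h
    exact ⟨T, hT, by rw [hbd, cycleEdges_shift]⟩

lemma exists_filling_five_of_diagonal (hno3 : K.NoBelt 3) (hno4 : K.NoBelt 4) {x : ZMod 5 → F}
    (hx : Function.Injective x) (hadj : ∀ i, K.Adj (x i) (x (i + 1)))
    (h02 : K.Adj (x 0) (x 2)) : ∃ T, #T ≤ 3 ∧ K.boundary T = cycleEdges x := by
  have h01 : K.Adj (x 0) (x 1) := hadj 0
  have h12 : K.Adj (x 1) (x 2) := hadj 1
  have h23 : K.Adj (x 2) (x 3) := hadj 2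
  have h34 : K.Adj (x 3) (x 4) := hadj 3
  have h40 : K.Adj (x 4) (x 0) := hadj 4
  have hne : ∀ i j : ZMod 5, i ≠ j → x i ≠ x j := fun i j h h' => h (hx h')
  have h03 := hne 0 3 (by decide)
  have h13 := hne 1 3 (by decide)
  have h14 := hne 1 4 (by decide)
  have h24 := hne 2 4 (by decide)
  obtain ⟨v, hv⟩ := hno3.exists_vertex h01 h12 h02.symm
  obtain ⟨y, hy, hy0, hy1, hy2, hy3⟩ := exists_four_cycle h02.1 h23.1 h34.1 h40.1 h03 h24
  obtain ⟨T, hT, hbd⟩ := exists_filling_four hno3 hy (by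
    intro i
    rcases zmod_four_cases i with rfl | rfl | rfl | rfl
    · change K.Adj (y 0) (y 1); rwa [hy0, hy1]
    · change K.Adj (y 1) (y 2); rwa [hy1, hy2]
    · change K.Adj (y 2) (y 3); rwa [hy2, hy3]
    · change K.Adj (y 3) (y 0); rwa [hy3, hy0]) (hno4 y)
  have hcard := card_cycleEdges (by omega) hy
  rw [← hbd] at hcard
  rw [cycleEdges_four, hy0, hy1, hy2, hy3] at hbd
  refine ⟨{v} ∆ T, (card_symmDiff_le _ _).trans (by simp; omega),
    (isModTwoCycle_boundary _).eq_cycleEdges (by omega) hx ?_ ?_⟩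
  · rw [cycleEdges_five, boundary_symmDiff, hbd]
    simp only [insert_subset_iff, singleton_subset_iff, mem_symmDiff,
      pair_mem_boundary_singleton hv h01.1, pair_mem_boundary_singleton hv h12.1,
      pair_mem_boundary_singleton hv h23.1, pair_mem_boundary_singleton hv h34.1,
      pair_mem_boundary_singleton hv h40.1, mem_insert, mem_singleton, pair_eq_pair_iff]
    have := h01.1; have := h12.1; have := h23.1; have := h34.1; have := h40.1; have := h02.1
    grind
  · rw [boundary_symmDiff]
    refine (card_symmDiff_le _ _).trans ?_
    rw [card_boundary_singleton, hcard]

lemma exists_filling_five (hno3 : K.NoBelt 3) (hno4 : K.NoBelt 4) {x : ZMod 5 → F}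
    (hx : Function.Injective x) (hadj : ∀ i, K.Adj (x i) (x (i + 1))) (hb : ¬ K.IsBelt x) :
    ∃ T, #T ≤ 3 ∧ K.boundary T = cycleEdges x := by
  have hex : ∃ i, K.Adj (x i) (x (i + 2)) := by
    by_contra! hno
    refine hb ⟨hx, hadj, ?_, ?_⟩
    · intro i j hij
      have hne : i ≠ j := fun h => hij.1 (by rw [h])
      have hij2 : j ≠ i + 2 := fun h => hno i (h ▸ hij)
      have hji2 : i ≠ j + 2 := fun h => hno j (h ▸ hij.symm)
      clear hij
      revert i j
      decide
    · rintro ⟨v, h⟩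
      exact hno 0 (adj_of_mem (fun h => absurd (hx h) (by decide)) (h 0) (h _))
  obtain ⟨i, hi⟩ := hex
  obtain ⟨T, hT, hbd⟩ := exists_filling_five_of_diagonal hno3 hno4 (x := fun j => x (j + i))
    (fun a b h => add_right_cancel (hx h))
    (fun j => by have := hadj (j + i); rwa [add_right_comm] at this)
    (by simpa [add_comm] using hi)
  exact ⟨T, hT, by rw [hbd, cycleEdges_shift]⟩

/-- Cut along chords, and fill the resulting triangles. -/
lemma exists_filling {k : ℕ} [NeZero k] (hk : 3 ≤ k) (hk5 : k ≤ 5)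
    (hno : ∀ j, 3 ≤ j → j < k → K.NoBelt j) {x : ZMod k → F} (hx : Function.Injective x)
    (hadj : ∀ i, K.Adj (x i) (x (i + 1))) (hb : ¬ K.IsBelt x) :
    ∃ T, #T + 2 ≤ k ∧ K.boundary T = cycleEdges x := by
  obtain rfl | rfl | rfl : k = 3 ∨ k = 4 ∨ k = 5 := by omega
  · obtain ⟨T, hcard, hT⟩ := exists_filling_three hx hadj hb
    exact ⟨T, by omega, hT⟩
  · obtain ⟨T, hcard, hT⟩ := exists_filling_four (hno 3 (by omega) (by omega)) hx hadj hb
    exact ⟨T, by omega, hT⟩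
  · obtain ⟨T, hcard, hT⟩ := exists_filling_five (hno 3 (by omega) (by omega))
      (hno 4 (by omega) (by omega)) hx hadj hb
    exact ⟨T, by omega, hT⟩

end TriangulatedSphere

namespace TriangulatedSphere

variable {F V : Type*} [Fintype F] [Fintype V] [DecidableEq F] [DecidableEq V]
  {K : TriangulatedSphere F V}

/-! ### Fullerenes -/

/-- All facets are pentagons and hexagons. -/
def IsFullerene (K : TriangulatedSphere F V) : Prop := ∀ y, K.deg y = 5 ∨ K.deg y = 6

/-- The number of pentagons in a set of facets. -/
def numPentagons (K : TriangulatedSphere F V) (S : Finset F) : ℕ := #{y ∈ S | K.deg y = 5}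

lemma numPentagons_le_card (S : Finset F) : K.numPentagons S ≤ #S := card_filter_le _ _

lemma numPentagons_mono {S S' : Finset F} (h : S ⊆ S') : K.numPentagons S ≤ K.numPentagons S' :=
  card_le_card (filter_subset_filter _ h)

lemma numPentagons_union {S S' : Finset F} (h : Disjoint S S') :
    K.numPentagons (S ∪ S') = K.numPentagons S + K.numPentagons S' := by
  rw [numPentagons, filter_union, card_union_of_disjoint (disjoint_filter_filter h)]
  rfl

lemma IsFullerene.sum_deg (hK : K.IsFullerene) (S : Finset F) :
    ∑ y ∈ S, K.deg y + K.numPentagons S = 6 * #S := by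
  rw [numPentagons, card_filter, ← sum_add_distrib, mul_comm, ← smul_eq_mul, ← sum_const]
  refine sum_congr rfl fun y _ => ?_
  rcases hK y with h | h <;> simp [h]

lemma IsFullerene.numPentagons_univ (hK : K.IsFullerene) : K.numPentagons univ = 12 := by
  have hinside : K.inside univ = univ := by ext; simp [mem_inside]
  have hpentagons := hK.sum_deg univ
  have hdeg := sum_deg_eq_sum_card_inter_inside (K := K) univ
  simp only [hinside, inter_univ, K.card_facetsAt, sum_const, smul_eq_mul, card_univ]
    at hpentagons hdeg
  have := K.euler
  omega

lemma deg_eq_five_of_numPentagons_eq_card {S : Finset F} (h : K.numPentagons S = #S) {y : F}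
    (hy : y ∈ S) : K.deg y = 5 := by
  rw [numPentagons, card_filter_eq_iff] at h
  exact h y hy

lemma IsFullerene.deg_eq_six_of_numPentagons_eq_zero (hK : K.IsFullerene) {S : Finset F}
    (h : K.numPentagons S = 0) {y : F} (hy : y ∈ S) : K.deg y = 6 := by
  rw [numPentagons, card_eq_zero, filter_eq_empty_iff] at h
  exact (hK y).resolve_left (h hy)

lemma inside_mono {S T : Finset V} (h : S ⊆ T) : K.inside S ⊆ K.inside T :=
  fun _ hy => mem_inside.2 ((mem_inside.1 hy).trans h)

lemma IsFullerene.numPentagons_inside_le_six (hK : K.IsFullerene) (T : Finset V) :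
    K.numPentagons (K.inside T) ≤ 6 ∨ K.numPentagons (K.inside Tᶜ) ≤ 6 := by
  have hunion := numPentagons_union (K := K) (disjoint_inside_inside_compl (K := K) T)
  have hle := numPentagons_mono (K := K) (subset_univ (K.inside T ∪ K.inside Tᶜ))
  rw [hK.numPentagons_univ] at hle
  omega

lemma mem_inside_of_mem_boundary_core {T : Finset V} {e : Finset F}
    (he : e ∈ K.boundary (K.core T)) {z : F} (hz : z ∈ e) : z ∈ K.inside T := by
  obtain ⟨w, hw, -, -, hew, -⟩ := exists_mem_notMem_of_mem_boundary he
  exact mem_core.1 hw (hew hz)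

lemma mem_inside_of_boundary_core_eq {j : ℕ} [NeZero j] {x : ZMod j → F} {T : Finset V}
    (h : K.boundary (K.core T) = cycleEdges x) (i : ZMod j) : x i ∈ K.inside T :=
  mem_inside_of_mem_boundary_core (e := {x i, x (i + 1)})
    (by rw [h]; exact mem_cycleEdges.2 ⟨i, rfl⟩) (by simp)

lemma adj_of_boundary_eq {j : ℕ} [NeZero j] {x : ZMod j → F} {T : Finset V}
    (h : K.boundary T = cycleEdges x) (i : ZMod j) : K.Adj (x i) (x (i + 1)) :=
  adj_of_mem_edges (T := T) (boundary_subset_edges _ (by rw [h]; exact mem_cycleEdges.2 ⟨i, rfl⟩))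

section Belt

variable {k : ℕ} [NeZero k] {x : ZMod k → F} {T : Finset V}

lemma IsFullerene.numPentagons_inside_add (hK : K.IsFullerene) (hk : 3 ≤ k) (hx : K.IsBelt x)
    (hT : K.boundary T = cycleEdges x) :
    K.numPentagons (K.inside T) + k = 6 + #(K.level T 2) := by
  have hcard := hx.card_level_two_add hk hT
  have hdeg := hx.sum_deg_inside hk hT
  have hpentagons := hK.sum_deg (K.inside T)
  omega

/-- Such a filling `T₀` would be the core or its complement, and both are too large. -/
lemma IsFullerene.boundary_ne_of_boundary_core_eq (hK : K.IsFullerene) (hk : 3 ≤ k) (hk5 : k ≤ 5)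
    (hx : K.IsBelt x) (hT : K.boundary T = cycleEdges x) {j : ℕ} [NeZero j] (hj5 : j ≤ 5)
    {y : ZMod j → F} (hy : Function.Injective y)
    (hcore : K.boundary (K.core T) = cycleEdges y) {T₀ : Finset V} (hT₀ : #T₀ + 2 ≤ j) :
    K.boundary T₀ ≠ cycleEdges y := by
  intro hbd
  have hlevel := hx.card_level_two_add hk hT
  have hpentagons := hK.numPentagons_inside_add hk hx hT
  have hle := numPentagons_le_card (K := K) (K.inside T)
  have hj : j ≤ #(K.inside T) := by
    have hsub : univ.image y ⊆ K.inside T :=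
      image_subset_iff.2 fun i _ => mem_inside_of_boundary_core_eq hcore i
    simpa [card_image_of_injective _ hy, ZMod.card] using card_le_card hsub
  rcases eq_or_eq_compl_of_boundary_eq (hbd.trans hcore.symm) with rfl | rfl
  · omega
  · have hstar : K.star (x 0) ⊆ (K.core T)ᶜ := by
      intro v hv
      rw [mem_compl, mem_core]
      exact fun h => notMem_inside_of_cycle hT 0 (h (mem_star.1 hv))
    have hdeg : K.deg (x 0) ≤ #(K.core T)ᶜ := card_le_card hstar
    have := hK (x 0)
    omega

/-- Inside a belt with at most six pentagons, the next layer is again a belt: a shorter cycle, or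
one which is not a belt, would bound too few triangles. -/
lemma IsFullerene.card_inside_eq_one_or_exists_isBelt_boundary_core (hK : K.IsFullerene)
    (hk : 3 ≤ k) (hk5 : k ≤ 5) (hno : ∀ j, 3 ≤ j → j < k → K.NoBelt j) (hx : K.IsBelt x)
    (hT : K.boundary T = cycleEdges x) (hp : K.numPentagons (K.inside T) ≤ 6) :
    (k = 5 ∧ #(K.inside T) = 1) ∨
    ((∃ y : ZMod k → F, K.IsBelt y ∧ K.boundary (K.core T) = cycleEdges y) ∧
      #(K.level T 2) = k ∧ K.numPentagons (K.inside T) = 6) := by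
  have hlevel := hx.card_level_two_add hk hT
  have hpentagons := hK.numPentagons_inside_add hk hx hT
  have hle := numPentagons_le_card (K := K) (K.inside T)
  have hboundary := card_boundary_core_le (K := K) T
  rcases (K.boundary (K.core T)).eq_empty_or_nonempty with hempty | hne
  · left
    rcases eq_empty_or_univ_of_boundary_eq_empty hempty with h | h
    · rw [h, card_empty] at hlevel
      omega
    · obtain ⟨v, -, w, hw, -⟩ := exists_mem_notMem_of_cycle hT 0
      exact absurd (core_subset (K := K) T (h ▸ mem_univ w)) hw
  · right
    obtain ⟨j, hj, hj5, _, y, hy, hcore⟩ :=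
      (isModTwoCycle_boundary _).exists_eq_cycleEdges hne (by omega)
    have hjle : j ≤ #(K.level T 2) := by rwa [← card_cycleEdges hj hy, ← hcore]
    have hbelt : K.IsBelt y := by
      by_contra hb
      obtain ⟨T₀, hT₀, hfill⟩ := exists_filling hj hj5
        (fun i hi hij => hno i hi (by omega)) hy (adj_of_boundary_eq hcore) hb
      exact hK.boundary_ne_of_boundary_core_eq hk hk5 hx hT hj5 hy hcore hT₀ hfill
    obtain rfl : j = k := by
      by_contra h
      exact hno j hj (by omega) y hbelt
    exact ⟨⟨y, hbelt, hcore⟩, by omega, by omega⟩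

/-- A belt shorter than five would enclose an infinite sequence of nested belts. -/
lemma IsFullerene.six_lt_numPentagons_inside (hK : K.IsFullerene) (hk : 3 ≤ k) (hk4 : k ≤ 4)
    (hno : ∀ j, 3 ≤ j → j < k → K.NoBelt j) (hx : K.IsBelt x) (hT : K.boundary T = cycleEdges x) :
    6 < K.numPentagons (K.inside T) := by
  induction hn : #T using Nat.strong_induction_on generalizing T x with
  | _ n ih =>
    by_contra! hp
    rcases hK.card_inside_eq_one_or_exists_isBelt_boundary_core hk (by omega) hno hx hT hp with
      ⟨h, -⟩ | ⟨⟨y, hy, hcore⟩, -⟩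
    · omega
    · have hcard := hx.card_eq_add hk hT
      have hlt := ih #(K.core T) (by omega) hy hcore rfl
      have hle : K.numPentagons (K.inside (K.core T)) ≤ K.numPentagons (K.inside T) :=
        numPentagons_mono (inside_mono (core_subset T))
      omega

lemma IsFullerene.noBelt_of_forall_lt (hK : K.IsFullerene) (hk : 3 ≤ k) (hk4 : k ≤ 4)
    (hno : ∀ j, 3 ≤ j → j < k → K.NoBelt j) : K.NoBelt k := by
  intro x hx
  obtain ⟨T, hT⟩ := hx.exists_region hk
  have hT' : K.boundary Tᶜ = cycleEdges x := by rw [boundary_compl, hT]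
  have hlt := hK.six_lt_numPentagons_inside hk hk4 hno hx hT
  have hlt' := hK.six_lt_numPentagons_inside hk hk4 hno hx hT'
  have := hK.numPentagons_inside_le_six T
  omega

end Belt

lemma IsFullerene.noBelt_three (hK : K.IsFullerene) : K.NoBelt 3 :=
  hK.noBelt_of_forall_lt le_rfl (by omega) (by omega)

lemma IsFullerene.noBelt_four (hK : K.IsFullerene) : K.NoBelt 4 :=
  hK.noBelt_of_forall_lt (by omega) le_rfl fun j hj hj4 => by
    obtain rfl : j = 3 := by omega
    exact hK.noBelt_three

/-! ### Five-belts -/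

/-- The number of vertices of a facet in `T`. -/
def degIn (K : TriangulatedSphere F V) (T : Finset V) (y : F) : ℕ := #{v ∈ T | y ∈ K.facetsAt v}

section Five

variable {x : ZMod 5 → F} {T : Finset V}

/-- The belt `x` bounds the disc `T`, and the facets of `T` which touch `x` form a belt `y`. -/
structure IsNested (K : TriangulatedSphere F V) (T : Finset V) (x y : ZMod 5 → F) : Prop where
  isBelt_outer : K.IsBelt x
  boundary_eq : K.boundary T = cycleEdges x
  isBelt : K.IsBelt y
  boundary_core_eq : K.boundary (K.core T) = cycleEdges y
  card_level_two : #(K.level T 2) = 5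

lemma IsNested.numPentagons_inside (hK : K.IsFullerene) {y : ZMod 5 → F} (h : K.IsNested T x y) :
    K.numPentagons (K.inside T) = 6 := by
  have := hK.numPentagons_inside_add (by omega) h.isBelt_outer h.boundary_eq
  have := h.card_level_two
  omega

lemma IsFullerene.card_inside_eq_one_or_exists_isNested (hK : K.IsFullerene) (hx : K.IsBelt x)
    (hT : K.boundary T = cycleEdges x) (hp : K.numPentagons (K.inside T) ≤ 6) :
    #(K.inside T) = 1 ∨ ∃ y, K.IsNested T x y := by
  have hno : ∀ j, 3 ≤ j → j < 5 → K.NoBelt j := by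
    intro j hj hj5
    obtain rfl | rfl : j = 3 ∨ j = 4 := by omega
    exacts [hK.noBelt_three, hK.noBelt_four]
  rcases hK.card_inside_eq_one_or_exists_isBelt_boundary_core (by omega) le_rfl hno hx hT hp with
    ⟨-, hone⟩ | ⟨⟨y, hy, hcore⟩, hlevel, -⟩
  exacts [Or.inl hone, Or.inr ⟨y, hx, hT, hy, hcore, hlevel⟩]

lemma sum_degIn_eq_sum_card_sdiff (hx : Function.Injective x) (hT : K.boundary T = cycleEdges x) :
    ∑ i, K.degIn T (x i) = ∑ v ∈ T, #(K.facetsAt v \ K.inside T) := by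
  calc ∑ i, K.degIn T (x i)
      = ∑ v ∈ T, #{i | x i ∈ K.facetsAt v} :=
        sum_card_bipartiteAbove_eq_sum_card_bipartiteBelow fun i v => x i ∈ K.facetsAt v
    _ = ∑ v ∈ T, #(K.facetsAt v \ K.inside T) := by
        refine sum_congr rfl fun v hv => ?_
        rw [← card_image_of_injective _ hx]
        congr 1
        ext y
        simp only [mem_image, mem_filter, mem_univ, true_and, mem_sdiff]
        constructor
        · rintro ⟨i, hi, rfl⟩
          exact ⟨hi, notMem_inside_of_cycle hT i⟩
        · rintro ⟨hy, hyT⟩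
          obtain ⟨i, rfl⟩ := (mem_inside_or_of_mem hT hv hy).resolve_left hyT
          exact ⟨i, hy, rfl⟩

lemma IsBelt.sum_degIn (hx : K.IsBelt x) (hT : K.boundary T = cycleEdges x) :
    ∑ i, K.degIn T (x i) = 10 + #(K.level T 2) := by
  have htotal : ∑ v ∈ T, (#(K.facetsAt v \ K.inside T) + #(K.facetsAt v ∩ K.inside T)) =
      3 * #T := by
    simp only [card_facetsAt_sdiff_add_card_inter, sum_const, smul_eq_mul, mul_comm]
  rw [sum_add_distrib, ← sum_degIn_eq_sum_card_sdiff hx.injective hT] at htotal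
  obtain ⟨hcard, hsum⟩ := hx.card_levels (by omega) hT
  rw [hx.card_level_one (by omega) hT] at hcard hsum
  omega

lemma exists_mem_of_boundary_eq_cycleEdges (hT : K.boundary T = cycleEdges x) (i : ZMod 5) :
    ∃ v ∈ T, x i ∈ K.facetsAt v ∧ x (i + 1) ∈ K.facetsAt v := by
  obtain ⟨v, hv, -, -, hiv, -⟩ := exists_mem_notMem_of_cycle hT i
  exact ⟨v, hv, hiv (by simp), hiv (by simp)⟩

lemma IsBelt.notMem_facetsAt_of_sub_one (hx : K.IsBelt x) {v : V} {i : ZMod 5}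
    (hi : x (i - 1) ∈ K.facetsAt v) : x (i + 1) ∉ K.facetsAt v := by
  intro hi'
  have hindex : i - 1 ≠ i + 1 ∧ i + 1 ≠ i - 1 + 1 ∧ i - 1 ≠ i + 1 + 1 := by
    clear hi hi'
    revert i
    decide
  rcases hx.chordless _ _ (adj_of_mem (fun h => hindex.1 (hx.injective h)) hi hi') with h | h
  exacts [hindex.2.1 h, hindex.2.2 h]

lemma IsBelt.two_le_degIn (hx : K.IsBelt x) (hT : K.boundary T = cycleEdges x) (i : ZMod 5) :
    2 ≤ K.degIn T (x i) := by
  obtain ⟨v, hv, hiv, hiv'⟩ := exists_mem_of_boundary_eq_cycleEdges hT (i - 1)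
  rw [sub_add_cancel] at hiv'
  obtain ⟨w, hw, hiw, hiw'⟩ := exists_mem_of_boundary_eq_cycleEdges hT i
  have hvw : v ≠ w := by
    rintro rfl
    exact hx.notMem_facetsAt_of_sub_one hiv hiw'
  rw [← card_pair hvw]
  refine card_le_card ?_
  simp [insert_subset_iff, *]

end Five

end TriangulatedSphere

namespace TriangulatedSphere

variable {F V : Type*} [Fintype F] [Fintype V] [DecidableEq F] [DecidableEq V]
  {K : TriangulatedSphere F V}

lemma ne_of_mem_inside {k : ℕ} [NeZero k] {x : ZMod k → F} {T : Finset V}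
    (hT : K.boundary T = cycleEdges x) {X : F} (hX : X ∈ K.inside T) (i : ZMod k) : x i ≠ X := by
  rintro rfl
  exact notMem_inside_of_cycle hT i hX

lemma facetsAt_eq_of_mem {v : V} {a b c : F} (ha : a ∈ K.facetsAt v) (hb : b ∈ K.facetsAt v)
    (hc : c ∈ K.facetsAt v) (hab : a ≠ b) (hac : a ≠ c) (hbc : b ≠ c) :
    K.facetsAt v = {a, b, c} := by
  refine (eq_of_subset_of_card_le ?_ ?_).symm
  · simp [insert_subset_iff, *]
  · rw [K.card_facetsAt, card_eq_three.2 ⟨a, b, c, hab, hac, hbc, rfl⟩]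

lemma notMem_core_of_mem_facetsAt {T : Finset V} {v : V} {a : F} (ha : a ∉ K.inside T)
    (hav : a ∈ K.facetsAt v) : v ∉ K.core T :=
  fun hv => ha (mem_core.1 hv hav)

section Five

variable {x y : ZMod 5 → F} {T : Finset V}

lemma IsNested.notMem_inside (h : K.IsNested T x y) (i : ZMod 5) : x i ∉ K.inside T :=
  notMem_inside_of_cycle h.boundary_eq i

lemma IsNested.mem_inside (h : K.IsNested T x y) (i : ZMod 5) : y i ∈ K.inside T :=
  mem_inside_of_boundary_core_eq h.boundary_core_eq i

lemma IsNested.card_inside (h : K.IsNested T x y) :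
    #(K.inside T) = #(K.inside (K.core T)) + 5 := by
  have hlevel := h.isBelt_outer.card_level_two_add (by omega) h.boundary_eq
  have heuler := card_add_two_eq (by omega) h.isBelt.injective h.boundary_core_eq
  have := h.card_level_two
  omega

lemma IsNested.inside_eq (h : K.IsNested T x y) :
    K.inside T = K.inside (K.core T) ∪ univ.image y := by
  refine (eq_of_subset_of_card_le (union_subset (inside_mono (core_subset T))
    (image_subset_iff.2 fun i _ => h.mem_inside i)) ?_).symm
  rw [card_union_of_disjoint (disjoint_inside_image h.boundary_core_eq),
    card_image_of_injective _ h.isBelt.injective, card_univ, ZMod.card, h.card_inside]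

lemma IsNested.numPentagons_inside_core_le (hK : K.IsFullerene) (h : K.IsNested T x y) :
    K.numPentagons (K.inside (K.core T)) ≤ 6 :=
  h.numPentagons_inside hK ▸ numPentagons_mono (inside_mono (core_subset T))

lemma IsNested.deg_eq (hK : K.IsFullerene) (h : K.IsNested T x y) (i : ZMod 5) :
    K.deg (y i) = if #(K.inside (K.core T)) = 1 then 5 else 6 := by
  have hsix := h.numPentagons_inside hK
  split_ifs with hone
  · exact deg_eq_five_of_numPentagons_eq_card (by rw [hsix, h.card_inside, hone]) (h.mem_inside i)
  · obtain ⟨z, hz⟩ := (hK.card_inside_eq_one_or_exists_isNested h.isBelt h.boundary_core_eq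
      (h.numPentagons_inside_core_le hK)).resolve_left hone
    have hcore := hz.numPentagons_inside hK
    rw [h.inside_eq, numPentagons_union (disjoint_inside_image h.boundary_core_eq)] at hsix
    exact hK.deg_eq_six_of_numPentagons_eq_zero (by omega : K.numPentagons (univ.image y) = 0)
      (mem_image_of_mem y (mem_univ i))

/-! ### The rings around a five-belt -/

/-- The boundary facets of a disc have two or three vertices in the disc, according as the disc
has one inside facet or more. -/
def IsFlat (K : TriangulatedSphere F V) (T : Finset V) (x : ZMod 5 → F) : Prop :=
  ∀ i, K.degIn T (x i) = if #(K.inside T) = 1 then 2 else 3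

lemma IsNested.exists_eq_of_mem_facetsAt (h : K.IsNested T x y) {v : V} {i : ZMod 5} {X : F}
    (hiv : x i ∈ K.facetsAt v) (hXv : X ∈ K.facetsAt v) (hX : X ∈ K.inside T) : ∃ l, y l = X := by
  rw [h.inside_eq, mem_union] at hX
  rcases hX with hX | hX
  · exact absurd (TriangulatedSphere.mem_inside.1 hX (mem_star.2 hXv))
      (notMem_core_of_mem_facetsAt (h.notMem_inside i) hiv)
  · obtain ⟨l, -, rfl⟩ := mem_image.1 hX
    exact ⟨l, rfl⟩

lemma IsNested.notMem_facetsAt_of_mem (h : K.IsNested T x y) {v : V} {i l : ZMod 5}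
    (hi : x i ∈ K.facetsAt v) (hi' : x (i + 1) ∈ K.facetsAt v) (hl : y l ∈ K.facetsAt v) :
    y (l + 1) ∉ K.facetsAt v := by
  intro hl'
  have hne {X : F} (hX : X ∈ K.inside T) (j : ZMod 5) : x j ≠ X :=
    ne_of_mem_inside h.boundary_eq hX j
  have hv := facetsAt_eq_of_mem hi hi' hl (h.isBelt_outer.adj i).1 (hne (h.mem_inside l) i)
    (hne (h.mem_inside l) (i + 1))
  rw [hv] at hl'
  simp only [mem_insert, mem_singleton, (hne (h.mem_inside (l + 1)) _).symm,
    (h.isBelt.adj l).1.symm, or_self] at hl'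

/-- Besides its vertices in the core and `v` and `w`, the facet `y l` has the two vertices outside
the core on the edges which it shares with its neighbours in the belt `y`. -/
lemma IsNested.degIn_core_add_four_le (h : K.IsNested T x y) {i j l : ZMod 5} {v w : V}
    (hvw : v ≠ w) (hiv : x i ∈ K.facetsAt v) (hiv' : x (i + 1) ∈ K.facetsAt v)
    (hjw : x j ∈ K.facetsAt w) (hjw' : x (j + 1) ∈ K.facetsAt w)
    (hlv : y l ∈ K.facetsAt v) (hlw : y l ∈ K.facetsAt w) :
    K.degIn (K.core T) (y l) + 4 ≤ K.deg (y l) := by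
  obtain ⟨-, -, c, hc, -, hlc⟩ := exists_mem_notMem_of_cycle h.boundary_core_eq (l - 1)
  obtain ⟨-, -, d, hd, -, hld⟩ := exists_mem_notMem_of_cycle h.boundary_core_eq l
  rw [sub_add_cancel] at hlc
  simp only [insert_subset_iff, singleton_subset_iff] at hlc hld
  have hcd : c ≠ d := by
    rintro rfl
    exact h.isBelt.notMem_facetsAt_of_sub_one hlc.1 hld.2
  have hne_c {u : V} {m : ZMod 5} (hm : x m ∈ K.facetsAt u) (hm' : x (m + 1) ∈ K.facetsAt u) :
      u ≠ c := by
    rintro rfl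
    exact h.notMem_facetsAt_of_mem hm hm' hlc.1 (by rw [sub_add_cancel]; exact hlc.2)
  have hne_d {u : V} {m : ZMod 5} (hm : x m ∈ K.facetsAt u) (hm' : x (m + 1) ∈ K.facetsAt u) :
      u ≠ d := by
    rintro rfl
    exact h.notMem_facetsAt_of_mem hm hm' hld.1 hld.2
  have hfour : #({v, w, c, d} : Finset V) = 4 := by
    rw [card_insert_of_notMem (by simp [hvw, hne_c hiv hiv', hne_d hiv hiv']),
      card_insert_of_notMem (by simp [hne_c hjw hjw', hne_d hjw hjw']), card_pair hcd]
  have hdisj : Disjoint ({u ∈ K.core T | y l ∈ K.facetsAt u} : Finset V) {v, w, c, d} := by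
    rw [disjoint_right]
    intro u hu
    simp only [mem_insert, mem_singleton] at hu
    refine fun hmem => absurd (mem_filter.1 hmem).1 ?_
    rcases hu with rfl | rfl | rfl | rfl
    exacts [notMem_core_of_mem_facetsAt (h.notMem_inside i) hiv,
      notMem_core_of_mem_facetsAt (h.notMem_inside j) hjw, hc, hd]
  rw [degIn, ← hfour, ← card_union_of_disjoint hdisj]
  refine card_le_card (union_subset (fun u hu => mem_star.2 (mem_filter.1 hu).2) ?_)
  simp [insert_subset_iff, mem_star, *]

lemma IsNested.notMem_facetsAt (hK : K.IsFullerene) (h : K.IsNested T x y)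
    (hflat : K.IsFlat (K.core T) y) {i : ZMod 5} {v w : V} {X : F} (hX : X ∈ K.inside T)
    (hv : x (i - 1) ∈ K.facetsAt v) (hv' : x i ∈ K.facetsAt v) (hXv : X ∈ K.facetsAt v)
    (hw : x i ∈ K.facetsAt w) (hw' : x (i + 1) ∈ K.facetsAt w) : X ∉ K.facetsAt w := by
  intro hXw
  have hvw : v ≠ w := by
    rintro rfl
    exact h.isBelt_outer.notMem_facetsAt_of_sub_one hv hw'
  obtain ⟨l, rfl⟩ := h.exists_eq_of_mem_facetsAt hv hXv hX
  have hle := h.degIn_core_add_four_le hvw hv (by rwa [sub_add_cancel]) hw hw' hXv hXw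
  rw [hflat, h.deg_eq hK] at hle
  split_ifs at hle <;> omega

lemma IsBelt.exists_facetsAt_eq (hx : K.IsBelt x) (hT : K.boundary T = cycleEdges x) (i : ZMod 5) :
    ∃ v ∈ T, ∃ X ∈ K.inside T, K.facetsAt v = {x i, x (i + 1), X} := by
  obtain ⟨v, hv, hiv, hiv'⟩ := exists_mem_of_boundary_eq_cycleEdges hT i
  obtain ⟨X, hXv, hX⟩ := hx.exists_inside (by omega) hT hv
  exact ⟨v, hv, X, hX, facetsAt_eq_of_mem hiv hiv' hXv (hx.adj i).1 (ne_of_mem_inside hT hX _)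
    (ne_of_mem_inside hT hX _)⟩

lemma exists_ne_mem_of_mem_inside {v : V} {a X : F} (ha : a ∈ K.facetsAt v) (hXv : X ∈ K.facetsAt v)
    (haX : a ≠ X) (hX : X ∈ K.inside T) :
    ∃ u ∈ T, u ≠ v ∧ a ∈ K.facetsAt u ∧ X ∈ K.facetsAt u := by
  obtain ⟨u, huv, hu⟩ := exists_ne_subset_facetsAt (K := K) (e := {a, X}) (v := v) (card_pair haX)
    (by simp [insert_subset_iff, ha, hXv])
  exact ⟨u, mem_inside.1 hX (mem_star.2 (hu (by simp))), huv, hu (by simp), hu (by simp)⟩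

lemma three_le_degIn {v w : V} {a X : F} (ha : a ∉ K.inside T) (hX : X ∈ K.inside T) (hv : v ∈ T)
    (hav : a ∈ K.facetsAt v) (hXv : X ∈ K.facetsAt v) (hw : w ∈ T) (haw : a ∈ K.facetsAt w)
    (hXw : X ∉ K.facetsAt w) : 3 ≤ K.degIn T a := by
  obtain ⟨u, hu, huv, hau, hXu⟩ := exists_ne_mem_of_mem_inside hav hXv (fun h => ha (h ▸ hX)) hX
  have huw : u ≠ w := fun h => hXw (h ▸ hXu)
  have hvw : v ≠ w := fun h => hXw (h ▸ hXv)
  rw [← card_eq_three.2 ⟨u, v, w, huv, huw, hvw, rfl⟩]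
  refine card_le_card ?_
  simp [insert_subset_iff, *]

lemma exists_facetsAt_eq_of_degIn_eq_three {v w : V} {a X Y : F} (ha : a ∉ K.inside T)
    (hX : X ∈ K.inside T) (hY : Y ∈ K.inside T) (hv : v ∈ T) (hav : a ∈ K.facetsAt v)
    (hXv : X ∈ K.facetsAt v) (hYv : Y ∉ K.facetsAt v) (hw : w ∈ T) (haw : a ∈ K.facetsAt w)
    (hYw : Y ∈ K.facetsAt w) (hXw : X ∉ K.facetsAt w) (hdeg : K.degIn T a = 3) :
    ∃ u ∈ T, K.facetsAt u = {a, X, Y} ∧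
      ({u ∈ T | a ∈ K.facetsAt u} : Finset V) = {u, v, w} := by
  have haX : a ≠ X := fun h => ha (h ▸ hX)
  have haY : a ≠ Y := fun h => ha (h ▸ hY)
  obtain ⟨u, hu, huv, hau, hXu⟩ := exists_ne_mem_of_mem_inside hav hXv haX hX
  obtain ⟨u', hu', huw', hau', hYu'⟩ := exists_ne_mem_of_mem_inside haw hYw haY hY
  have huw : u ≠ w := fun h => hXw (h ▸ hXu)
  have huv' : u' ≠ v := fun h => hYv (h ▸ hYu')
  have hvw : v ≠ w := fun h => hXw (h ▸ hXv)
  have hfilter : ({u ∈ T | a ∈ K.facetsAt u} : Finset V) = {u, v, w} := by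
    refine (eq_of_subset_of_card_le ?_ ?_).symm
    · simp [insert_subset_iff, *]
    · rw [card_eq_three.2 ⟨u, v, w, huv, huw, hvw, rfl⟩]
      exact hdeg.le
  obtain rfl : u' = u := by
    have hmem : u' ∈ ({u ∈ T | a ∈ K.facetsAt u} : Finset V) := by simp [hu', hau']
    rw [hfilter] at hmem
    simpa [huv', huw'] using hmem
  exact ⟨u', hu, facetsAt_eq_of_mem hau hXu hYu' haX haY fun h => hXw (h ▸ hYw), hfilter⟩

lemma eq_of_sum_eq_card_mul {ι : Type*} [Fintype ι] {f : ι → ℕ} {m : ℕ} (hle : ∀ i, m ≤ f i)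
    (hsum : ∑ i, f i = Fintype.card ι * m) (i : ι) : f i = m :=
  ((sum_eq_sum_iff_of_le fun i _ => hle i).1 (by simp [hsum]) i (mem_univ i)).symm

/-- The numbers of vertices in the disc have the right sum, and the smaller disc, flat by
induction, shows that none of them is too small. -/
lemma IsFullerene.isFlat (hK : K.IsFullerene) (hx : K.IsBelt x) (hT : K.boundary T = cycleEdges x)
    (hp : K.numPentagons (K.inside T) ≤ 6) : K.IsFlat T x := by
  induction hn : #T using Nat.strong_induction_on generalizing T x with
  | _ n ih =>
    have hcard := hx.card_eq_add (by omega) hT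
    have hlevel := hx.card_level_two_add (by omega) hT
    have hsum := hx.sum_degIn hT
    intro i
    split_ifs with hone
    · exact eq_of_sum_eq_card_mul (hx.two_le_degIn hT) (by rw [hsum, ZMod.card]; omega) i
    · obtain ⟨y, hy⟩ := (hK.card_inside_eq_one_or_exists_isNested hx hT hp).resolve_left hone
      have hflat := ih _ (by omega) hy.isBelt hy.boundary_core_eq
        (hy.numPentagons_inside_core_le hK) rfl
      refine eq_of_sum_eq_card_mul (m := 3) (fun i => ?_)
        (by rw [hsum, ZMod.card, hy.card_level_two]) i
      obtain ⟨v, hvT, X, hX, hv⟩ := hx.exists_facetsAt_eq hT (i - 1)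
      obtain ⟨w, hwT, Y, -, hw⟩ := hx.exists_facetsAt_eq hT i
      rw [sub_add_cancel] at hv
      have hXw : X ∉ K.facetsAt w := hy.notMem_facetsAt hK hflat (i := i) (v := v) hX
        (by simp [hv]) (by simp [hv]) (by simp [hv]) (by simp [hw]) (by simp [hw])
      exact three_le_degIn (hy.notMem_inside i) hX hvT (by simp [hv]) (by simp [hv]) hwT
        (by simp [hw]) hXw

lemma IsBelt.adj_iff_mem_cycleEdges {k : ℕ} [NeZero k] {x : ZMod k → F} (hx : K.IsBelt x)
    {i j : ZMod k} : K.Adj (x i) (x j) ↔ {x i, x j} ∈ cycleEdges x := by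
  constructor
  · intro hij
    rcases hx.chordless i j hij with rfl | rfl
    exacts [mem_cycleEdges.2 ⟨i, rfl⟩, mem_cycleEdges.2 ⟨j, pair_comm _ _⟩]
  · intro hij
    obtain ⟨c, hc⟩ := mem_cycleEdges.1 hij
    rcases pair_eq_pair_iff.1 hc with h | h
    · rw [← h.1, ← h.2]
      exact hx.adj c
    · rw [← h.1, ← h.2]
      exact (hx.adj c).symm

lemma isBelt_of_cycleEdges_eq {k : ℕ} [NeZero k] {y z : ZMod k → F} (hy : K.IsBelt y)
    (h : cycleEdges z = cycleEdges y) : K.IsBelt z := by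
  have hz := injective_of_cycleEdges_eq hy.injective h
  have hedge : ∀ i j, K.Adj (z i) (z j) ↔ {z i, z j} ∈ cycleEdges z := by
    intro i j
    obtain ⟨a, ha⟩ := exists_eq_of_cycleEdges_subset h.le i
    obtain ⟨b, hb⟩ := exists_eq_of_cycleEdges_subset h.le j
    rw [h, ← ha, ← hb, hy.adj_iff_mem_cycleEdges]
  refine ⟨hz, fun i => (hedge _ _).2 (mem_cycleEdges.2 ⟨i, rfl⟩), fun i j hij => ?_, ?_⟩
  · obtain ⟨c, hc⟩ := mem_cycleEdges.1 ((hedge i j).1 hij)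
    rcases pair_eq_pair_iff.1 hc with h | h
    · rw [← hz h.1, ← hz h.2]
      exact Or.inl rfl
    · rw [← hz h.1, ← hz h.2]
      exact Or.inr rfl
  · rintro ⟨v, hv⟩
    refine hy.not_common ⟨v, fun i => ?_⟩
    obtain ⟨a, ha⟩ := exists_eq_of_cycleEdges_subset h.ge i
    exact ha ▸ hv a

lemma IsNested.isNested_of_cycleEdges_eq (h : K.IsNested T x y) {z : ZMod 5 → F}
    (hz : cycleEdges z = cycleEdges y) : K.IsNested T x z :=
  ⟨h.isBelt_outer, h.boundary_eq, isBelt_of_cycleEdges_eq h.isBelt hz,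
    h.boundary_core_eq.trans hz.symm, h.card_level_two⟩

lemma IsNested.boundary_core_eq_image (h : K.IsNested T x y) :
    K.boundary (K.core T) = (K.level T 2).image fun v => K.facetsAt v ∩ K.inside T := by
  refine eq_of_subset_of_card_le (boundary_core_subset T) (card_image_le.trans ?_)
  rw [h.boundary_core_eq, card_cycleEdges (by omega) h.isBelt.injective, h.card_level_two]

lemma IsNested.cycleEdges_eq (h : K.IsNested T x y) {z : ZMod 5 → F} (hz : ∀ i, z i ∈ K.inside T)
    (hne : ∀ i, z i ≠ z (i + 1)) {u : ZMod 5 → V} (huT : ∀ i, u i ∈ T)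
    (hu : ∀ i, K.facetsAt (u i) = {x i, z i, z (i + 1)}) : cycleEdges z = cycleEdges y := by
  have hinter : ∀ i, K.facetsAt (u i) ∩ K.inside T = {z i, z (i + 1)} := by
    intro i
    rw [hu, insert_inter_of_notMem (h.notMem_inside i), inter_eq_left]
    simp [insert_subset_iff, hz]
  have hlevel : ∀ i, u i ∈ K.level T 2 := fun i => by
    simp [level, huT, hinter, card_pair (hne i)]
  have hinj : Function.Injective u := by
    intro i j hij
    have hmem : x i ∈ K.facetsAt (u j) := by simp [← hij, hu]
    rw [hu] at hmem
    simpa [ne_of_mem_inside h.boundary_eq (hz _), h.isBelt_outer.injective.eq_iff] using hmem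
  have himage : univ.image u = K.level T 2 := by
    refine eq_of_subset_of_card_le (image_subset_iff.2 fun i _ => hlevel i) ?_
    rw [card_image_of_injective _ hinj, h.card_level_two, card_univ, ZMod.card]
  rw [← h.boundary_core_eq, h.boundary_core_eq_image, ← himage, image_image, cycleEdges]
  exact image_congr fun i _ => (hinter i).symm

/-- Two nested belts indexed so that the ten vertices between them are those of a zigzag. -/
structure IsRing (K : TriangulatedSphere F V) (T : Finset V) (x z : ZMod 5 → F) : Prop
    extends K.IsNested T x z where
  lower : ∀ i, ∃ v, K.facetsAt v = {x i, x (i + 1), z (i + 1)}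
  upper : ∀ i, ∃ v, K.facetsAt v = {x i, z i, z (i + 1)}
  vertex : ∀ v ∈ T, v ∈ K.core T ∨ (∃ i, K.facetsAt v = {x i, x (i + 1), z (i + 1)}) ∨
    ∃ i, K.facetsAt v = {x i, z i, z (i + 1)}

lemma IsFullerene.exists_isRing (hK : K.IsFullerene) (hx : K.IsBelt x)
    (hT : K.boundary T = cycleEdges x) (hp : K.numPentagons (K.inside T) ≤ 6)
    (hone : #(K.inside T) ≠ 1) : ∃ z, K.IsRing T x z := by
  obtain ⟨y, hy⟩ := (hK.card_inside_eq_one_or_exists_isNested hx hT hp).resolve_left hone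
  have hflat := hK.isFlat hy.isBelt hy.boundary_core_eq (hy.numPentagons_inside_core_le hK)
  choose v hvT z hz hv using fun i => hx.exists_facetsAt_eq hT (i - 1)
  simp only [sub_add_cancel] at hv
  have hv' : ∀ i, K.facetsAt (v (i + 1)) = {x i, x (i + 1), z (i + 1)} := fun i => by
    rw [hv, add_sub_cancel_right]
  have hzv : ∀ i, z i ∉ K.facetsAt (v (i + 1)) := fun i =>
    hy.notMem_facetsAt hK hflat (i := i) (v := v i) (hz i) (by simp [hv]) (by simp [hv])
      (by simp [hv]) (by simp [hv']) (by simp [hv'])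
  have hzv' : ∀ i, z (i + 1) ∉ K.facetsAt (v i) := fun i h =>
    hy.notMem_facetsAt hK hflat (i := i) (v := v i) (w := v (i + 1)) (hz (i + 1)) (by simp [hv])
      (by simp [hv]) h (by simp [hv']) (by simp [hv']) (by simp [hv'])
  choose u huT hu hstar using fun i => exists_facetsAt_eq_of_degIn_eq_three (v := v i)
    (w := v (i + 1)) (hy.notMem_inside i) (hz i) (hz (i + 1)) (hvT i) (by simp [hv])
    (by simp [hv]) (hzv' i) (hvT (i + 1)) (by simp [hv']) (by simp [hv']) (hzv i)
    (by rw [hK.isFlat hx hT hp, if_neg hone])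
  have hzne : ∀ i, z i ≠ z (i + 1) := fun i h => hzv i (by simp [hv', h])
  refine ⟨z, hy.isNested_of_cycleEdges_eq (hy.cycleEdges_eq hz hzne huT hu),
    fun i => ⟨_, hv' i⟩, fun i => ⟨_, hu i⟩, fun w hw => or_iff_not_imp_left.2 fun hcore => ?_⟩
  rw [mem_core, not_subset] at hcore
  obtain ⟨a, ha, haT⟩ := hcore
  obtain ⟨i, rfl⟩ := (mem_inside_or_of_mem hT hw ha).resolve_left haT
  have hmem : w ∈ ({w ∈ T | x i ∈ K.facetsAt w} : Finset V) := mem_filter.2 ⟨hw, ha⟩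
  simp only [hstar, mem_insert, mem_singleton] at hmem
  rcases hmem with rfl | rfl | rfl
  · exact Or.inr ⟨i, hu i⟩
  · exact Or.inl ⟨i - 1, by simp only [sub_add_cancel, hv]⟩
  · exact Or.inl ⟨i, hv' i⟩

end Five

end TriangulatedSphere

namespace TriangulatedSphere

variable {F V : Type*} [Fintype F] [Fintype V] [DecidableEq F] [DecidableEq V]
  {K : TriangulatedSphere F V}

/-- The five-belts `f 0, …, f n` are concentric rings around the pentagon `t`, and `f r` bounds a
disc with the `n - r` further rings and `t` inside. -/
structure IsStack (K : TriangulatedSphere F V) (n : ℕ) (t : F) (f : ℕ → ZMod 5 → F) : Prop where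
  lower : ∀ r < n, ∀ i, ∃ v, K.facetsAt v = {f r i, f r (i + 1), f (r + 1) (i + 1)}
  upper : ∀ r < n, ∀ i, ∃ v, K.facetsAt v = {f r i, f (r + 1) i, f (r + 1) (i + 1)}
  top : ∀ i, ∃ v, K.facetsAt v = {f n i, f n (i + 1), t}
  belt : ∀ r ≤ n, K.IsBelt (f r)
  region : ∀ r ≤ n, ∃ T, K.boundary T = cycleEdges (f r) ∧ #(K.inside T) + 5 * r = 5 * n + 1
  deg_top : K.deg t = 5
  deg_last : 1 ≤ n → ∀ i, K.deg (f n i) = 5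

/-- The disc `T` consists of the rings `f 0, …, f n` around `t`, the belt `f 0` being its rim. -/
structure IsTower (K : TriangulatedSphere F V) (T : Finset V) (n : ℕ) (t : F)
    (f : ℕ → ZMod 5 → F) : Prop extends K.IsStack n t f where
  vertex : ∀ v ∈ T, (∃ r < n, ∃ i, K.facetsAt v = {f r i, f r (i + 1), f (r + 1) (i + 1)}) ∨
    (∃ r < n, ∃ i, K.facetsAt v = {f r i, f (r + 1) i, f (r + 1) (i + 1)}) ∨
    ∃ i, K.facetsAt v = {f n i, f n (i + 1), t}
  facet : ∀ y ∈ K.inside T, y = t ∨ ∃ r ≤ n, ∃ i, y = f r i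
  card_inside : #(K.inside T) = 5 * n + 1

section Tower

variable {x : ZMod 5 → F} {T : Finset V}

lemma IsBelt.exists_facetsAt_eq_of_inside_eq_singleton (hx : K.IsBelt x)
    (hT : K.boundary T = cycleEdges x) {t : F} (ht : K.inside T = {t}) (i : ZMod 5) :
    ∃ v ∈ T, K.facetsAt v = {x i, x (i + 1), t} := by
  obtain ⟨v, hvT, X, hX, hv⟩ := hx.exists_facetsAt_eq hT i
  rw [ht, mem_singleton] at hX
  exact ⟨v, hvT, hX ▸ hv⟩

lemma IsFullerene.exists_facetsAt_eq_of_mem (hK : K.IsFullerene) (hx : K.IsBelt x)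
    (hT : K.boundary T = cycleEdges x) {t : F} (ht : K.inside T = {t}) {w : V} (hw : w ∈ T) :
    ∃ i, K.facetsAt w = {x i, x (i + 1), t} := by
  have hone : #(K.inside T) = 1 := by rw [ht, card_singleton]
  have hp : K.numPentagons (K.inside T) ≤ 6 := (numPentagons_le_card _).trans (by omega)
  choose v hvT hv using hx.exists_facetsAt_eq_of_inside_eq_singleton hT ht
  obtain ⟨a, ha, haT⟩ : ∃ a ∈ K.facetsAt w, a ∉ K.inside T := by
    by_contra! h
    have := card_le_card (show K.facetsAt w ⊆ K.inside T from h)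
    rw [K.card_facetsAt, hone] at this
    omega
  obtain ⟨i, rfl⟩ := (mem_inside_or_of_mem hT hw ha).resolve_left haT
  have hvne : v (i - 1) ≠ v i := fun h =>
    hx.notMem_facetsAt_of_sub_one (v := v i) (i := i) (by simp [← h, hv]) (by simp [hv])
  have hstar : ({v (i - 1), v i} : Finset V) = {w ∈ T | x i ∈ K.facetsAt w} := by
    refine eq_of_subset_of_card_le (by simp [insert_subset_iff, hvT, hv]) ?_
    rw [card_pair hvne]
    exact ((hK.isFlat hx hT hp i).trans (if_pos hone)).le
  have hmem : w ∈ ({v (i - 1), v i} : Finset V) := by simp [hstar, hw, ha]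
  simp only [mem_insert, mem_singleton] at hmem
  rcases hmem with rfl | rfl
  exacts [⟨i - 1, hv _⟩, ⟨i, hv _⟩]

lemma IsFullerene.star_eq_of_inside_eq_singleton (hK : K.IsFullerene) (hx : K.IsBelt x)
    (hT : K.boundary T = cycleEdges x) {t : F} (ht : K.inside T = {t}) : K.star t = T := by
  refine Subset.antisymm (mem_inside.1 (by simp [ht])) fun w hw => ?_
  obtain ⟨i, hi⟩ := hK.exists_facetsAt_eq_of_mem hx hT ht hw
  simp [mem_star, hi]

lemma IsFullerene.isTower_zero (hK : K.IsFullerene) (hx : K.IsBelt x)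
    (hT : K.boundary T = cycleEdges x) {t : F} (ht : K.inside T = {t}) :
    K.IsTower T 0 t (fun _ => x) := by
  have hone : #(K.inside T) = 1 := by rw [ht, card_singleton]
  have heuler := card_add_two_eq (by omega) hx.injective hT
  exact {
    lower := by simp
    upper := by simp
    top := fun i =>
      let ⟨v, _, hv⟩ := hx.exists_facetsAt_eq_of_inside_eq_singleton hT ht i
      ⟨v, hv⟩
    belt := fun _ _ => hx
    region := fun r hr => ⟨T, hT, by omega⟩
    deg_top := by rw [deg, hK.star_eq_of_inside_eq_singleton hx hT ht]; omega
    deg_last := by simp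
    vertex := fun w hw => Or.inr (Or.inr (hK.exists_facetsAt_eq_of_mem hx hT ht hw))
    facet := fun y hy => Or.inl (by simpa [ht] using hy)
    card_inside := hone }

lemma IsRing.isTower_succ (hK : K.IsFullerene) {n : ℕ} {t : F} {f : ℕ → ZMod 5 → F}
    (h : K.IsRing T (f 0) (f 1)) (hcore : K.IsTower (K.core T) n t fun r => f (r + 1)) :
    K.IsTower T (n + 1) t f := by
  have hcard := h.card_inside
  have hcard_core := hcore.card_inside
  exact {
    lower := fun
      | 0, _, i => h.lower i
      | r + 1, hr, i => hcore.lower r (by omega) i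
    upper := fun
      | 0, _, i => h.upper i
      | r + 1, hr, i => hcore.upper r (by omega) i
    top := hcore.top
    belt := fun
      | 0, _ => h.isBelt_outer
      | r + 1, hr => hcore.belt r (by omega)
    region := fun
      | 0, _ => ⟨T, h.boundary_eq, by omega⟩
      | r + 1, hr =>
        let ⟨S, hS, hSc⟩ := hcore.region r (by omega)
        ⟨S, hS, by omega⟩
    deg_top := hcore.deg_top
    deg_last := fun _ i => by
      rcases n with _ | n
      · exact (h.deg_eq hK i).trans (if_pos (by omega))
      · exact hcore.deg_last (by omega) i
    vertex := fun v hv => by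
      rcases h.vertex v hv with hvcore | ⟨i, hi⟩ | ⟨i, hi⟩
      · rcases hcore.vertex v hvcore with ⟨r, hr, i, hi⟩ | ⟨r, hr, i, hi⟩ | ⟨i, hi⟩
        · exact Or.inl ⟨r + 1, by omega, i, hi⟩
        · exact Or.inr (Or.inl ⟨r + 1, by omega, i, hi⟩)
        · exact Or.inr (Or.inr ⟨i, hi⟩)
      · exact Or.inl ⟨0, by omega, i, hi⟩
      · exact Or.inr (Or.inl ⟨0, by omega, i, hi⟩)
    facet := fun y hy => by
      rw [h.inside_eq, mem_union, mem_image] at hy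
      rcases hy with hy | ⟨i, -, rfl⟩
      · exact (hcore.facet y hy).imp_right fun ⟨r, hr, i, hi⟩ => ⟨r + 1, by omega, i, hi⟩
      · exact Or.inr ⟨1, by omega, i, rfl⟩
    card_inside := by omega }

lemma IsFullerene.exists_isTower (hK : K.IsFullerene) (hx : K.IsBelt x)
    (hT : K.boundary T = cycleEdges x) (hp : K.numPentagons (K.inside T) ≤ 6) :
    ∃ n t f, f 0 = x ∧ K.IsTower T n t f := by
  induction hm : #(K.inside T) using Nat.strong_induction_on generalizing T x with
  | _ m ih =>
  by_cases hone : #(K.inside T) = 1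
  · obtain ⟨t, ht⟩ := card_eq_one.1 hone
    exact ⟨0, t, _, rfl, hK.isTower_zero hx hT ht⟩
  obtain ⟨z, hz⟩ := hK.exists_isRing hx hT hp hone
  have hcard := hz.card_inside
  obtain ⟨n, t, f, rfl, hf⟩ := ih _ (by omega) hz.isBelt hz.boundary_core_eq
    (hz.numPentagons_inside_core_le hK) rfl
  let g : ℕ → ZMod 5 → F
    | 0 => x
    | r + 1 => f r
  exact ⟨n + 1, t, g, rfl, IsRing.isTower_succ (f := g) hK hz hf⟩

end Tower

/-- The sphere consists of the rings `f 0, …, f n` of five facets between the pentagons `b`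
and `t`. For `n = k + 1` this is the polytope `D_k`. -/
structure IsTube (K : TriangulatedSphere F V) (n : ℕ) (b t : F) (f : ℕ → ZMod 5 → F) : Prop
    extends K.IsStack n t f where
  bottom : ∀ i, ∃ v, K.facetsAt v = {f 0 i, f 0 (i + 1), b}
  vertex : ∀ v, (∃ i, K.facetsAt v = {f 0 i, f 0 (i + 1), b}) ∨
    (∃ r < n, ∃ i, K.facetsAt v = {f r i, f r (i + 1), f (r + 1) (i + 1)}) ∨
    (∃ r < n, ∃ i, K.facetsAt v = {f r i, f (r + 1) i, f (r + 1) (i + 1)}) ∨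
    ∃ i, K.facetsAt v = {f n i, f n (i + 1), t}
  facet : ∀ y, y = b ∨ y = t ∨ ∃ r ≤ n, ∃ i, y = f r i
  card_eq : Fintype.card F = 5 * n + 7
  deg_bottom : K.deg b = 5
  deg_first : ∀ i, K.deg (f 0 i) = 5

section Tube

variable {x : ZMod 5 → F} {T : Finset V}

lemma IsFullerene.numPentagons_add_numPentagons_compl (hK : K.IsFullerene)
    (hT : K.boundary T = cycleEdges x) :
    K.numPentagons (K.inside T) + K.numPentagons (K.inside Tᶜ) +
      K.numPentagons (univ.image x) = 12 := by
  have hT' : K.boundary Tᶜ = cycleEdges x := by rw [boundary_compl, hT]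
  rw [← hK.numPentagons_univ, ← numPentagons_union (disjoint_inside_inside_compl T),
    ← numPentagons_union
      (disjoint_union_left.2 ⟨disjoint_inside_image hT, disjoint_inside_image hT'⟩)]
  congr 1
  ext y
  simp only [mem_union, mem_image, mem_univ, true_and, iff_true]
  refine or_iff_not_imp_right.2 fun hy => ?_
  push Not at hy
  exact mem_inside_or_of_notMem_cycle hT hy

lemma numPentagons_image {k : ℕ} [NeZero k] {x : ZMod k → F} (hx : Function.Injective x)
    (h : ∀ i, K.deg (x i) = 5) : K.numPentagons (univ.image x) = k := by
  rw [numPentagons, filter_true_of_mem (by simpa using h), card_image_of_injective _ hx,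
    card_univ, ZMod.card]

lemma IsTower.isTube {n : ℕ} {b t : F} {f : ℕ → ZMod 5 → F} (h : K.IsTower T n t f)
    (hcap : K.IsTower Tᶜ 0 b fun _ => f 0) (hT : K.boundary T = cycleEdges (f 0))
    (hdeg : ∀ i, K.deg (f 0 i) = 5) : K.IsTube n b t f where
  toIsStack := h.toIsStack
  bottom := hcap.top
  vertex v := by
    by_cases hv : v ∈ T
    · exact Or.inr (h.vertex v hv)
    · exact Or.inl (by simpa using hcap.vertex v (mem_compl.2 hv))
  facet y := by
    by_cases hy : ∃ i, f 0 i = y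
    · obtain ⟨i, rfl⟩ := hy
      exact Or.inr (Or.inr ⟨0, by omega, i, rfl⟩)
    · push Not at hy
      rcases mem_inside_or_of_notMem_cycle hT hy with hyT | hyT
      · exact Or.inr (h.facet y hyT)
      · exact (hcap.facet y hyT).imp_right fun ⟨_, _, i, hi⟩ => absurd hi.symm (hy i)
  card_eq := by
    have := card_inside_add_card_inside_compl (h.belt 0 (by omega)).injective hT
    have := h.card_inside
    have := hcap.card_inside
    omega
  deg_bottom := hcap.deg_top
  deg_first := hdeg

/-- The last ring of a tower over `x` is the rim of a cap with six pentagons; a second tower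
over that ring, on the other side, completes the cap to a tube. -/
lemma IsFullerene.exists_isTube_of_numPentagons_inside_le (hK : K.IsFullerene) (hx : K.IsBelt x)
    (hT : K.boundary T = cycleEdges x) (hp : K.numPentagons (K.inside T) ≤ 6)
    (hone : #(K.inside T) ≠ 1) : ∃ n b t f, 1 ≤ n ∧ K.IsTube n b t f := by
  obtain ⟨m, b, g, -, hg⟩ := hK.exists_isTower hx hT hp
  have hcard := hg.card_inside
  have hdeg := hg.deg_last (by omega)
  have hbelt := hg.belt m le_rfl
  obtain ⟨S, hS, hSc⟩ := hg.region m le_rfl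
  have hS' : K.boundary Sᶜ = cycleEdges (g m) := by rw [boundary_compl, hS]
  obtain ⟨b', hb'⟩ := card_eq_one.1 (by omega : #(K.inside S) = 1)
  have hcap := hK.isTower_zero hbelt hS hb'
  have hpcap : K.numPentagons (K.inside S) = 1 := by
    simp [numPentagons, hb', filter_singleton, hcap.deg_top]
  have hprim := numPentagons_image hbelt.injective hdeg
  have hptotal := hK.numPentagons_add_numPentagons_compl hS
  have hple := numPentagons_le_card (K := K) (K.inside Sᶜ)
  obtain ⟨n, t, f, hf0, hf⟩ := hK.exists_isTower hbelt hS' (by omega)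
  have := hf.card_inside
  rw [← hf0] at hcap hS' hdeg
  exact ⟨n, b', t, f, by omega, hf.isTube (by rwa [compl_compl]) hS' hdeg⟩

lemma IsFullerene.exists_isTube (hK : K.IsFullerene) (hx : K.IsBelt x)
    (hT : K.boundary T = cycleEdges x) (hone : #(K.inside T) ≠ 1)
    (hone' : #(K.inside Tᶜ) ≠ 1) : ∃ n b t f, 1 ≤ n ∧ K.IsTube n b t f := by
  rcases hK.numPentagons_inside_le_six T with hp | hp
  · exact hK.exists_isTube_of_numPentagons_inside_le hx hT hp hone
  · exact hK.exists_isTube_of_numPentagons_inside_le hx (by rw [boundary_compl, hT]) hp hone'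

lemma IsFullerene.numPentagons_inside_eq_six (hK : K.IsFullerene) (hx : K.IsBelt x)
    (hT : K.boundary T = cycleEdges x) (hone : #(K.inside T) ≠ 1)
    (hone' : #(K.inside Tᶜ) ≠ 1) : K.numPentagons (K.inside T) = 6 := by
  have eq_six : ∀ S, K.boundary S = cycleEdges x → #(K.inside S) ≠ 1 →
      K.numPentagons (K.inside S) ≤ 6 → K.numPentagons (K.inside S) = 6 := fun S hS hS1 hp =>
    let ⟨_, hy⟩ := (hK.card_inside_eq_one_or_exists_isNested hx hS hp).resolve_left hS1
    hy.numPentagons_inside hK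
  rcases hK.numPentagons_inside_le_six T with hp | hp
  · exact eq_six T hT hone hp
  · have hsix := eq_six Tᶜ (by rw [boundary_compl, hT]) hone' hp
    have := hK.numPentagons_add_numPentagons_compl hT
    exact eq_six T hT hone (by omega)

lemma IsFullerene.deg_eq_six_of_card_inside_ne_one (hK : K.IsFullerene) (hx : K.IsBelt x)
    (hT : K.boundary T = cycleEdges x) (hone : #(K.inside T) ≠ 1)
    (hone' : #(K.inside Tᶜ) ≠ 1) (i : ZMod 5) : K.deg (x i) = 6 := by
  have hsix := hK.numPentagons_inside_eq_six hx hT hone hone'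
  have hsix' := hK.numPentagons_inside_eq_six hx (T := Tᶜ) (by rw [boundary_compl, hT]) hone'
    (by rwa [compl_compl])
  have := hK.numPentagons_add_numPentagons_compl hT
  exact hK.deg_eq_six_of_numPentagons_eq_zero (S := univ.image x) (by omega) (by simp)

end Tube

end TriangulatedSphere

namespace TriangulatedSphere

variable {F V : Type*} [Fintype F] [Fintype V] [DecidableEq F] [DecidableEq V]
  {K : TriangulatedSphere F V}

lemma mem_boundary_star {y : F} {e : Finset F} :
    e ∈ K.boundary (K.star y) ↔ ∃ v, y ∈ K.facetsAt v ∧ (K.facetsAt v).erase y = e := by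
  constructor
  · intro he
    obtain ⟨v, hv, w, hw, hev, hew⟩ := exists_mem_notMem_of_mem_boundary he
    rw [mem_star] at hv hw
    have hye : y ∉ e := fun h => hw (hew h)
    refine ⟨v, hv, (eq_of_subset_of_card_le (subset_erase.2 ⟨hev, hye⟩) ?_).symm⟩
    rw [card_erase_of_mem hv, K.card_facetsAt, card_eq_two_of_mem_boundary he]
  · rintro ⟨v, hv, rfl⟩
    have hcard : #((K.facetsAt v).erase y) = 2 := by rw [card_erase_of_mem hv, K.card_facetsAt]
    obtain ⟨w, hwv, hw⟩ := exists_ne_subset_facetsAt (K := K) hcard (erase_subset _ _)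
    rw [mem_boundary_iff hcard hwv.symm (erase_subset _ _) hw]
    simp only [mem_star, hv, true_iff]
    intro hyw
    refine hwv (K.facetsAt_injective (eq_of_subset_of_card_le ?_ (by simp [K.card_facetsAt]))).symm
    rw [← insert_erase hv]
    exact insert_subset hyw hw

lemma card_boundary_star (y : F) : #(K.boundary (K.star y)) = K.deg y := by
  have himage : K.boundary (K.star y) = (K.star y).image fun v => (K.facetsAt v).erase y := by
    ext e
    simp only [mem_boundary_star, mem_image, mem_star]
  rw [himage, card_image_of_injOn, deg]
  intro v hv w hw hvw
  rw [mem_coe, mem_star] at hv hw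
  refine K.facetsAt_injective ?_
  rw [← insert_erase hv, ← insert_erase hw]
  exact congrArg _ hvw

lemma exists_boundary_star_eq {y : F} (hy : K.deg y = 5) :
    ∃ x : ZMod 5 → F, Function.Injective x ∧ K.boundary (K.star y) = cycleEdges x := by
  have hcard := (card_boundary_star (K := K) y).trans hy
  obtain ⟨k, hk, -, _, x, hx, h⟩ := (isModTwoCycle_boundary (K.star y)).exists_eq_cycleEdges
    (card_pos.1 (by omega)) hcard.le
  rw [h, card_cycleEdges hk hx] at hcard
  subst hcard
  exact ⟨x, hx, h⟩

section Cycle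

variable {k : ℕ} [NeZero k] {x : ZMod k → F}

lemma range_eq_of_boundary_star_eq {y : F} (hbd : K.boundary (K.star y) = cycleEdges x) :
    Set.range x = {z | K.Adj z y} := by
  ext z
  simp only [Set.mem_range, Set.mem_ofPred_eq]
  constructor
  · rintro ⟨i, rfl⟩
    have he : {x i, x (i + 1)} ∈ K.boundary (K.star y) := hbd ▸ mem_cycleEdges.2 ⟨i, rfl⟩
    obtain ⟨v, hv, heq⟩ := mem_boundary_star.1 he
    have hxi : x i ∈ (K.facetsAt v).erase y := by simp [heq]
    rw [mem_erase] at hxi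
    exact ⟨hxi.1, v, hxi.2, hv⟩
  · rintro ⟨hzy, v, hz, hv⟩
    have he : (K.facetsAt v).erase y ∈ cycleEdges x := hbd ▸ mem_boundary_star.2 ⟨v, hv, rfl⟩
    obtain ⟨i, hi⟩ := mem_cycleEdges.1 he
    have hzi : z ∈ ({x i, x (i + 1)} : Finset F) := hi ▸ mem_erase.2 ⟨hzy, hz⟩
    simp only [mem_insert, mem_singleton] at hzi
    rcases hzi with rfl | rfl
    exacts [⟨_, rfl⟩, ⟨_, rfl⟩]

lemma not_forall_mem_facetsAt (hk : 4 ≤ k) (hx : Function.Injective x) (v : V) :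
    ¬ ∀ i, x i ∈ K.facetsAt v := by
  intro hv
  have := card_le_card (image_subset_iff.2 fun i (_ : i ∈ univ) => hv i)
  rw [card_image_of_injective _ hx, card_univ, ZMod.card, K.card_facetsAt] at this
  omega

lemma NoBelt.isBelt_of_boundary_star_eq (hno3 : K.NoBelt 3) (hk : 4 ≤ k) {y : F}
    (hx : Function.Injective x) (hbd : K.boundary (K.star y) = cycleEdges x) : K.IsBelt x := by
  have hadj : ∀ i, K.Adj (x i) y := fun i =>
    (range_eq_of_boundary_star_eq hbd).le ⟨i, rfl⟩
  refine ⟨hx, adj_of_boundary_eq hbd, fun i j hij => ?_,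
    fun ⟨v, hv⟩ => not_forall_mem_facetsAt hk hx v hv⟩
  obtain ⟨v, hv⟩ := hno3.exists_vertex hij (hadj j) (hadj i).symm
  have heq : (K.facetsAt v).erase y = {x i, x j} := by
    rw [hv]
    have := (hadj i).1
    have := (hadj j).1
    grind
  have he : {x i, x j} ∈ cycleEdges x := hbd ▸ mem_boundary_star.2 ⟨v, by simp [hv], heq⟩
  obtain ⟨l, hl⟩ := mem_cycleEdges.1 he
  rcases pair_eq_pair_iff.1 hl with h | h
  · rw [← hx h.1, ← hx h.2]
    exact Or.inl rfl
  · rw [← hx h.1, ← hx h.2]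
    exact Or.inr rfl

lemma IsBelt.cycleEdges_eq_of_range_eq {y : ZMod k → F} (hx : K.IsBelt x) (hy : K.IsBelt y)
    (h : Set.range x = Set.range y) : cycleEdges x = cycleEdges y := by
  have mem_iff : ∀ {z : ZMod k → F}, K.IsBelt z → ∀ e, e ∈ cycleEdges z ↔
      ∃ a ∈ Set.range z, ∃ b ∈ Set.range z, K.Adj a b ∧ {a, b} = e := by
    intro z hz e
    constructor
    · intro he
      obtain ⟨i, rfl⟩ := mem_cycleEdges.1 he
      exact ⟨_, ⟨i, rfl⟩, _, ⟨i + 1, rfl⟩, hz.adj i, rfl⟩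
    · rintro ⟨_, ⟨i, rfl⟩, _, ⟨j, rfl⟩, hij, rfl⟩
      exact hz.adj_iff_mem_cycleEdges.1 hij
  ext e
  rw [mem_iff hx, mem_iff hy, h]

end Cycle

lemma NoBelt.exists_isBelt_boundary_star_eq (hno3 : K.NoBelt 3) {y : F} (hy : K.deg y = 5) :
    ∃ x : ZMod 5 → F, K.IsBelt x ∧ K.boundary (K.star y) = cycleEdges x := by
  obtain ⟨x, hx, hbd⟩ := exists_boundary_star_eq hy
  exact ⟨x, hno3.isBelt_of_boundary_star_eq (by omega) hx hbd, hbd⟩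

lemma IsFullerene.twelve_le_card (hK : K.IsFullerene) : 12 ≤ Fintype.card F := by
  rw [← hK.numPentagons_univ, ← card_univ]
  exact numPentagons_le_card _

lemma IsFullerene.eq_of_setOf_adj_eq (hK : K.IsFullerene) {y z : F} (hy : K.deg y = 5)
    (hz : K.deg z = 5) (h : {a | K.Adj a y} = {a | K.Adj a z}) : y = z := by
  obtain ⟨x, hx, hbd⟩ := hK.noBelt_three.exists_isBelt_boundary_star_eq hy
  obtain ⟨x', hx', hbd'⟩ := hK.noBelt_three.exists_isBelt_boundary_star_eq hz
  have hrange : Set.range x = Set.range x' := by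
    rw [range_eq_of_boundary_star_eq hbd, range_eq_of_boundary_star_eq hbd', h]
  have heq : K.boundary (K.star y) = K.boundary (K.star z) := by
    rw [hbd, hbd', hx.cycleEdges_eq_of_range_eq hx' hrange]
  rcases eq_or_eq_compl_of_boundary_eq heq with hstar | hstar
  · by_contra hne
    obtain ⟨v, hv⟩ := star_nonempty (K := K) y
    have hvz : z ∈ K.facetsAt v := mem_star.1 (hstar ▸ hv)
    have hzy : z ∈ {a | K.Adj a y} := adj_of_mem (Ne.symm hne) hvz (mem_star.1 hv)
    exact (h.le hzy).1 rfl
  · have hcard := card_add_card_compl (K.star z)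
    rw [← hstar] at hcard
    unfold deg at hy hz
    have := hK.twelve_le_card
    have := K.euler
    omega

/-- The five-belts of the sphere, as sets of facets. -/
def beltSets (K : TriangulatedSphere F V) : Set (Set F) :=
  {B | ∃ x : ZMod 5 → F, K.IsBelt x ∧ Set.range x = B}

/-- The sets of facets surrounding a pentagon. -/
def pentagonLinks (K : TriangulatedSphere F V) : Set (Set F) :=
  {B | ∃ y, K.deg y = 5 ∧ {z | K.Adj z y} = B}

lemma IsFullerene.pentagonLinks_subset (hK : K.IsFullerene) : K.pentagonLinks ⊆ K.beltSets := by
  rintro _ ⟨y, hy, rfl⟩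
  obtain ⟨x, hx, hbd⟩ := hK.noBelt_three.exists_isBelt_boundary_star_eq hy
  exact ⟨x, hx, range_eq_of_boundary_star_eq hbd⟩

lemma IsFullerene.ncard_pentagonLinks (hK : K.IsFullerene) : K.pentagonLinks.ncard = 12 := by
  have himage : K.pentagonLinks =
      (fun y => {z | K.Adj z y}) '' (({y | K.deg y = 5} : Finset F) : Set F) := by
    ext B
    simp [pentagonLinks]
  rw [himage, Set.InjOn.ncard_image, Set.ncard_coe_finset, ← hK.numPentagons_univ, numPentagons]
  intro y hy z hz hyz
  exact hK.eq_of_setOf_adj_eq (by simpa using hy) (by simpa using hz) hyz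

section Five

variable {x : ZMod 5 → F} {T : Finset V}

lemma card_inside_star {y : F} (hy : K.deg y = 5) (hx : Function.Injective x)
    (hbd : K.boundary (K.star y) = cycleEdges x) : #(K.inside (K.star y)) = 1 := by
  have := card_add_two_eq (by omega) hx hbd
  unfold deg at hy
  omega

lemma IsFullerene.card_inside_eq_one_or_of_mem_pentagonLinks (hK : K.IsFullerene)
    (hx : K.IsBelt x) (hT : K.boundary T = cycleEdges x) (h : Set.range x ∈ K.pentagonLinks) :
    #(K.inside T) = 1 ∨ #(K.inside Tᶜ) = 1 := by
  obtain ⟨y, hy, hr⟩ := h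
  obtain ⟨x', hx', hbd⟩ := hK.noBelt_three.exists_isBelt_boundary_star_eq hy
  have hone := card_inside_star hy hx'.injective hbd
  have heq : K.boundary T = K.boundary (K.star y) := by
    rw [hT, hbd, hx.cycleEdges_eq_of_range_eq hx'
      (hr.symm.trans (range_eq_of_boundary_star_eq hbd).symm)]
  rcases eq_or_eq_compl_of_boundary_eq heq with rfl | rfl
  · exact Or.inl hone
  · exact Or.inr (by rwa [compl_compl])

lemma IsFullerene.mem_pentagonLinks_of_card_inside_eq_one (hK : K.IsFullerene) (hx : K.IsBelt x)
    (hT : K.boundary T = cycleEdges x) (hone : #(K.inside T) = 1) :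
    Set.range x ∈ K.pentagonLinks := by
  obtain ⟨t, ht⟩ := card_eq_one.1 hone
  have hstar := hK.star_eq_of_inside_eq_singleton hx hT ht
  exact ⟨t, (hK.isTower_zero hx hT ht).deg_top,
    (range_eq_of_boundary_star_eq (hstar.symm ▸ hT)).symm⟩

end Five

end TriangulatedSphere

namespace DPolytope

/-- The facets of `D_k` as a sum type, used to count them. -/
def facetEquiv (k : ℕ) : Facet k ≃ Unit ⊕ Unit ⊕ (Fin (k + 2) × ZMod 5) where
  toFun
    | .bottom => .inl ()
    | .top => .inr (.inl ())
    | .side r i => .inr (.inr (r, i))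
  invFun
    | .inl _ => .bottom
    | .inr (.inl _) => .top
    | .inr (.inr (r, i)) => .side r i
  left_inv := by rintro (_ | _ | _) <;> rfl
  right_inv := by rintro (_ | _ | _) <;> rfl

/-- The vertices of `D_k` as a sum type, used to count them. -/
def vertexEquiv (k : ℕ) :
    Vertex k ≃ ZMod 5 ⊕ ZMod 5 ⊕ (Fin (k + 1) × ZMod 5) ⊕ (Fin (k + 1) × ZMod 5) where
  toFun
    | .bottom i => .inl i
    | .top i => .inr (.inl i)
    | .lower r i => .inr (.inr (.inl (r, i)))
    | .upper r i => .inr (.inr (.inr (r, i)))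
  invFun
    | .inl i => .bottom i
    | .inr (.inl i) => .top i
    | .inr (.inr (.inl (r, i))) => .lower r i
    | .inr (.inr (.inr (r, i))) => .upper r i
  left_inv := by rintro (_ | _ | _ | _) <;> rfl
  right_inv := by rintro (_ | _ | _ | _) <;> rfl

instance (k : ℕ) : Finite (Facet k) := Finite.of_equiv _ (facetEquiv k).symm

instance (k : ℕ) : Finite (Vertex k) := Finite.of_equiv _ (vertexEquiv k).symm

lemma card_facet (k : ℕ) : Nat.card (Facet k) = 5 * k + 12 := by
  rw [Nat.card_congr (facetEquiv k)]
  simp [ZMod.card]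
  ring

lemma card_vertex (k : ℕ) : Nat.card (Vertex k) = 10 * k + 20 := by
  rw [Nat.card_congr (vertexEquiv k)]
  simp [ZMod.card]
  ring

variable {F : Type*} {k : ℕ} {b t : F} {f : ℕ → ZMod 5 → F}

/-- The facets of `D_k` as facets of a tube: the two ends `b`, `t` and the rings `f`. -/
def tubeFacet (b t : F) (f : ℕ → ZMod 5 → F) : Facet k → F
  | .bottom => b
  | .top => t
  | .side r i => f r i

variable [DecidableEq F]

/-- The facets of a tube which meet at a given vertex of `D_k`. -/
def tubeFacetsAt (b t : F) (f : ℕ → ZMod 5 → F) : Vertex k → Finset F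
  | .bottom i => {f 0 i, f 0 (i + 1), b}
  | .top i => {f (k + 1) i, f (k + 1) (i + 1), t}
  | .lower r i => {f r i, f r (i + 1), f (r + 1) (i + 1)}
  | .upper r i => {f r i, f (r + 1) i, f (r + 1) (i + 1)}

lemma coe_tubeFacetsAt (v : Vertex k) :
    (tubeFacetsAt b t f v : Set F) = tubeFacet b t f '' facetsAt v := by
  rcases v with i | i | ⟨r, i⟩ | ⟨r, i⟩ <;>
  simp only [tubeFacetsAt, facetsAt, tubeFacet, Set.image_insert_eq, Set.image_singleton,
    coe_insert, coe_singleton, Fin.val_zero, Fin.val_last, Fin.val_castSucc, Fin.val_succ] <;>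
  grind

end DPolytope

namespace TriangulatedSphere

variable {F V : Type*} [Fintype F] [Fintype V] [DecidableEq F] [DecidableEq V]
  {K : TriangulatedSphere F V}

section Model

open DPolytope

variable {k : ℕ} {b t : F} {f : ℕ → ZMod 5 → F}

lemma IsTube.exists_facetsAt_eq (h : K.IsTube (k + 1) b t f) :
    ∀ v : Vertex k, ∃ w, K.facetsAt w = tubeFacetsAt b t f v
  | .bottom i => h.bottom i
  | .top i => h.top i
  | .lower r i => h.lower r r.isLt i
  | .upper r i => h.upper r r.isLt i

lemma IsTube.exists_tubeFacetsAt_eq (h : K.IsTube (k + 1) b t f) (w : V) :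
    ∃ v : Vertex k, tubeFacetsAt b t f v = K.facetsAt w := by
  rcases h.vertex w with ⟨i, hi⟩ | ⟨r, hr, i, hi⟩ | ⟨r, hr, i, hi⟩ | ⟨i, hi⟩
  exacts [⟨.bottom i, hi.symm⟩, ⟨.lower ⟨r, hr⟩ i, hi.symm⟩, ⟨.upper ⟨r, hr⟩ i, hi.symm⟩,
    ⟨.top i, hi.symm⟩]

lemma IsTube.bijective_tubeFacet (h : K.IsTube (k + 1) b t f) :
    Function.Bijective (tubeFacet (k := k) b t f) := by
  have hsurj : Function.Surjective (tubeFacet (k := k) b t f) := by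
    intro y
    rcases h.facet y with rfl | rfl | ⟨r, hr, i, rfl⟩
    exacts [⟨.bottom, rfl⟩, ⟨.top, rfl⟩, ⟨.side ⟨r, by omega⟩ i, rfl⟩]
  refine hsurj.bijective_of_nat_card_le ?_
  rw [card_facet, Nat.card_eq_fintype_card, h.card_eq]
  omega

lemma IsTube.ring_injective (h : K.IsTube (k + 1) b t f) {r s : ℕ} (hr : r ≤ k + 1)
    (hs : s ≤ k + 1) {i j : ZMod 5} (heq : f r i = f s j) : r = s ∧ i = j := by
  simpa [Fin.ext_iff] using h.bijective_tubeFacet.1 (a₁ := .side ⟨r, by omega⟩ i)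
    (a₂ := .side ⟨s, by omega⟩ j) heq

lemma IsTube.exists_equiv (h : K.IsTube (k + 1) b t f) :
    ∃ (g : Facet k ≃ F) (e : Vertex k ≃ V),
      ∀ v φ, g φ ∈ K.facetsAt (e v) ↔ φ ∈ DPolytope.facetsAt v := by
  choose e he using h.exists_facetsAt_eq
  have hsurj : Function.Surjective e := fun w =>
    (h.exists_tubeFacetsAt_eq w).imp fun v hv => K.facetsAt_injective ((he v).trans hv)
  have hbij : Function.Bijective e := by
    refine hsurj.bijective_of_nat_card_le ?_
    have heuler := K.euler
    rw [h.card_eq] at heuler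
    rw [card_vertex, Nat.card_eq_fintype_card]
    omega
  refine ⟨Equiv.ofBijective _ h.bijective_tubeFacet, Equiv.ofBijective e hbij, fun v φ => ?_⟩
  rw [Equiv.ofBijective_apply, Equiv.ofBijective_apply, he, ← mem_coe, coe_tubeFacetsAt,
    h.bijective_tubeFacet.1.mem_set_image]

end Model

section Rings

variable {x : ZMod 5 → F} {T : Finset V} {k : ℕ} {b t : F} {f : ℕ → ZMod 5 → F}

lemma mem_iff_mem_of_notMem_range (hT : K.boundary T = cycleEdges x) {a c : F} (hac : a ≠ c)
    (hc : c ∉ Set.range x) {v w : V} (hav : a ∈ K.facetsAt v) (hcv : c ∈ K.facetsAt v)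
    (haw : a ∈ K.facetsAt w) (hcw : c ∈ K.facetsAt w) : v ∈ T ↔ w ∈ T := by
  refine mem_iff_mem_of_notMem_boundary (K := K) (e := {a, c}) (card_pair hac)
    (by simp [insert_subset_iff, *]) (by simp [insert_subset_iff, *]) fun he => ?_
  rw [hT] at he
  obtain ⟨i, hi⟩ := mem_cycleEdges.1 he
  have hci : c ∈ ({x i, x (i + 1)} : Finset F) := by simp [hi]
  simp only [mem_insert, mem_singleton] at hci
  rcases hci with rfl | rfl
  exacts [hc ⟨_, rfl⟩, hc ⟨_, rfl⟩]

/-- Three consecutive edges of `a` off the belt put four consecutive vertices of `a` on the same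
side of the belt. -/
lemma four_le_degIn_or_four_le_degIn_compl (hT : K.boundary T = cycleEdges x)
    {a c₀ c₁ c₂ c₃ c₄ : F} (hc : [a, c₀, c₁, c₂, c₃, c₄].Nodup)
    (h₁ : c₁ ∉ Set.range x) (h₂ : c₂ ∉ Set.range x) (h₃ : c₃ ∉ Set.range x) {v₀ v₁ v₂ v₃ : V}
    (hv₀ : K.facetsAt v₀ = {a, c₀, c₁}) (hv₁ : K.facetsAt v₁ = {a, c₁, c₂})
    (hv₂ : K.facetsAt v₂ = {a, c₂, c₃}) (hv₃ : K.facetsAt v₃ = {a, c₃, c₄}) :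
    4 ≤ K.degIn T a ∨ 4 ≤ K.degIn Tᶜ a := by
  simp only [List.nodup_cons, List.mem_cons, List.not_mem_nil, or_false, not_or] at hc
  have hne : ∀ {v w : V} (c : F), c ∈ K.facetsAt v → c ∉ K.facetsAt w → w ≠ v := by
    rintro v w c hv hw rfl
    exact hw hv
  have hcard : #({v₀, v₁, v₂, v₃} : Finset V) = 4 := by
    have h01 : v₀ ≠ v₁ := hne c₂ (by simp [hv₁]) (by grind)
    have h02 : v₀ ≠ v₂ := hne c₂ (by simp [hv₂]) (by grind)
    have h03 : v₀ ≠ v₃ := hne c₃ (by simp [hv₃]) (by grind)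
    have h12 : v₁ ≠ v₂ := hne c₃ (by simp [hv₂]) (by grind)
    have h13 : v₁ ≠ v₃ := hne c₃ (by simp [hv₃]) (by grind)
    have h23 : v₂ ≠ v₃ := hne c₄ (by simp [hv₃]) (by grind)
    simp [*]
  have hle : ∀ S : Finset V, v₀ ∈ S → v₁ ∈ S → v₂ ∈ S → v₃ ∈ S → 4 ≤ K.degIn S a := by
    intro S _ _ _ _
    rw [← hcard]
    refine card_le_card ?_
    simp [insert_subset_iff, *]
  have h01 : v₀ ∈ T ↔ v₁ ∈ T := mem_iff_mem_of_notMem_range hT (a := a) (c := c₁) (by tauto) h₁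
    (by simp [hv₀]) (by simp [hv₀]) (by simp [hv₁]) (by simp [hv₁])
  have h12 : v₁ ∈ T ↔ v₂ ∈ T := mem_iff_mem_of_notMem_range hT (a := a) (c := c₂) (by tauto) h₂
    (by simp [hv₁]) (by simp [hv₁]) (by simp [hv₂]) (by simp [hv₂])
  have h23 : v₂ ∈ T ↔ v₃ ∈ T := mem_iff_mem_of_notMem_range hT (a := a) (c := c₃) (by tauto) h₃
    (by simp [hv₂]) (by simp [hv₂]) (by simp [hv₃]) (by simp [hv₃])
  by_cases hv : v₀ ∈ T
  · exact Or.inl (hle T hv (by tauto) (by tauto) (by tauto))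
  · refine Or.inr (hle Tᶜ ?_ ?_ ?_ ?_) <;> rw [mem_compl] <;> tauto

lemma IsFullerene.card_inside_ne_one (hK : K.IsFullerene) (hx : K.IsBelt x)
    (hT : K.boundary T = cycleEdges x) (hlink : Set.range x ∉ K.pentagonLinks) :
    #(K.inside T) ≠ 1 ∧ #(K.inside Tᶜ) ≠ 1 :=
  ⟨fun h => hlink (hK.mem_pentagonLinks_of_card_inside_eq_one hx hT h),
    fun h => hlink (hK.mem_pentagonLinks_of_card_inside_eq_one hx
      (by rw [boundary_compl, hT]) h)⟩

lemma IsFullerene.degIn_eq_three (hK : K.IsFullerene) (hx : K.IsBelt x)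
    (hT : K.boundary T = cycleEdges x) (hone : #(K.inside T) ≠ 1) (hone' : #(K.inside Tᶜ) ≠ 1)
    (i : ZMod 5) : K.degIn T (x i) = 3 := by
  have hp := hK.numPentagons_inside_eq_six hx hT hone hone'
  exact (hK.isFlat hx hT hp.le i).trans (if_neg hone)

lemma IsTube.exists_eq_ring_of_deg_eq_six (h : K.IsTube (k + 1) b t f) {y : F}
    (hy : K.deg y = 6) : ∃ r, 1 ≤ r ∧ r ≤ k ∧ ∃ i, f r i = y := by
  rcases h.facet y with rfl | rfl | ⟨r, hr, i, rfl⟩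
  · simp [h.deg_bottom] at hy
  · simp [h.deg_top] at hy
  · have hr0 : r ≠ 0 := by
      rintro rfl
      simp [h.deg_first] at hy
    have hrk : r ≠ k + 1 := by
      rintro rfl
      simp [h.deg_last (by omega)] at hy
    exact ⟨r, by omega, by omega, i, rfl⟩

/-- A belt which leaves a ring but avoids the next one would leave three consecutive edges of a
hexagon on one side, whereas it cuts each of its hexagons in halves. -/
lemma IsTube.ring_add_one_mem_range (hK : K.IsFullerene) (h : K.IsTube (k + 1) b t f)
    (hx : K.IsBelt x) (hlink : Set.range x ∉ K.pentagonLinks) {r : ℕ} (hr : 1 ≤ r) (hrk : r ≤ k)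
    (hnext : ∀ i, f (r + 1) i ∉ Set.range x) {i : ZMod 5} (hi : f r i ∈ Set.range x) :
    f r (i + 1) ∈ Set.range x := by
  by_contra hnot
  obtain ⟨T, hT⟩ := hx.exists_region (by omega)
  obtain ⟨hone, hone'⟩ := hK.card_inside_ne_one hx hT hlink
  obtain ⟨j, hj⟩ := hi
  have hdeg := hK.degIn_eq_three hx hT hone hone' j
  have hdeg' := hK.degIn_eq_three hx (T := Tᶜ) (by rw [boundary_compl, hT]) hone'
    (by rwa [compl_compl]) j
  obtain ⟨v₀, hv₀⟩ := h.upper (r - 1) (by omega) i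
  obtain ⟨v₁, hv₁⟩ := h.lower r (by omega) i
  obtain ⟨v₂, hv₂⟩ := h.upper r (by omega) i
  obtain ⟨v₃, hv₃⟩ := h.lower r (by omega) (i - 1)
  rw [Nat.sub_add_cancel hr] at hv₀
  rw [sub_add_cancel] at hv₃
  have hne : ∀ {p q : ℕ} {i j : ZMod 5}, p ≤ k + 1 → q ≤ k + 1 → ¬ (p = q ∧ i = j) →
      f p i ≠ f q j := fun hp hq hpq heq => hpq (h.ring_injective hp hq heq)
  have hnodup : [f r i, f (r - 1) i, f r (i + 1), f (r + 1) (i + 1), f (r + 1) i,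
      f r (i - 1)].Nodup := by
    have hzmod : ∀ i : ZMod 5, i + 1 ≠ i ∧ i - 1 ≠ i ∧ i + 1 ≠ i - 1 := by decide
    simp only [List.nodup_cons, List.mem_cons, List.not_mem_nil, or_false, not_or]
    and_intros <;> first | exact hne (by omega) (by omega) (by have := hzmod i; grind) | simp
  rcases four_le_degIn_or_four_le_degIn_compl hT hnodup hnot (hnext _) (hnext _)
    (by rw [hv₀, insert_comm]) hv₁ (by rw [hv₂, pair_comm])
    (by rw [hv₃, insert_comm, pair_comm]) with hfour | hfour <;> rw [← hj] at hfour <;> omega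

lemma IsTube.exists_range_eq (hK : K.IsFullerene) (h : K.IsTube (k + 1) b t f)
    (hx : K.IsBelt x) (hlink : Set.range x ∉ K.pentagonLinks) :
    ∃ r, 1 ≤ r ∧ r ≤ k ∧ Set.range x = Set.range (f r) := by
  obtain ⟨T, hT⟩ := hx.exists_region (by omega)
  obtain ⟨hone, hone'⟩ := hK.card_inside_ne_one hx hT hlink
  have hring : ∀ j, ∃ r, 1 ≤ r ∧ r ≤ k ∧ ∃ i, f r i = x j := fun j =>
    h.exists_eq_ring_of_deg_eq_six (hK.deg_eq_six_of_card_inside_ne_one hx hT hone hone' j)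
  choose ρ hρ hρk σ hσ using hring
  obtain ⟨j₀, -, hmax⟩ := univ.exists_max_image ρ univ_nonempty
  have hnext : ∀ i, f (ρ j₀ + 1) i ∉ Set.range x := by
    rintro i ⟨j, hj⟩
    have := (h.ring_injective (by have := hρk j; omega) (by have := hρk j₀; omega)
      ((hσ j).trans hj)).1
    have := hmax j (mem_univ _)
    omega
  have hstep : ∀ i, f (ρ j₀) i ∈ Set.range x → f (ρ j₀) (i + 1) ∈ Set.range x := fun _ hi =>
    h.ring_add_one_mem_range hK hx hlink (hρ j₀) (hρk j₀) hnext hi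
  have hsub : Set.range (f (ρ j₀)) ⊆ Set.range x := by
    have hnat : ∀ m : ℕ, f (ρ j₀) (σ j₀ + m) ∈ Set.range x := by
      intro m
      induction m with
      | zero => exact ⟨j₀, by simp [hσ]⟩
      | succ m ih => simpa [add_assoc] using hstep _ ih
    rintro _ ⟨i, rfl⟩
    simpa using hnat (i - σ j₀).val
  refine ⟨ρ j₀, hρ j₀, hρk j₀, (Set.eq_of_subset_of_ncard_le hsub ?_).symm⟩
  rw [Set.ncard_range_of_injective hx.injective,
    Set.ncard_range_of_injective (h.belt _ ((hρk j₀).trans (by omega))).injective]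

lemma IsTube.range_mem_beltSets_diff (hK : K.IsFullerene) (h : K.IsTube (k + 1) b t f) {r : ℕ}
    (hr : 1 ≤ r) (hrk : r ≤ k) : Set.range (f r) ∈ K.beltSets \ K.pentagonLinks := by
  have hbelt := h.belt r (by omega)
  refine ⟨⟨f r, hbelt, rfl⟩, fun hlink => ?_⟩
  obtain ⟨T, hT, hcard⟩ := h.region r (by omega)
  have hsum := card_inside_add_card_inside_compl hbelt.injective hT
  rw [h.card_eq] at hsum
  rcases hK.card_inside_eq_one_or_of_mem_pentagonLinks hbelt hT hlink with hone | hone <;> omega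

lemma IsTube.ncard_beltSets (hK : K.IsFullerene) (h : K.IsTube (k + 1) b t f) :
    K.beltSets.ncard = 12 + k := by
  have hrings : K.beltSets \ K.pentagonLinks = (fun r => Set.range (f r)) '' Set.Icc 1 k := by
    ext B
    constructor
    · rintro ⟨⟨x, hx, rfl⟩, hlink⟩
      obtain ⟨r, hr, hrk, heq⟩ := h.exists_range_eq hK hx hlink
      exact ⟨r, ⟨hr, hrk⟩, heq.symm⟩
    · rintro ⟨r, ⟨hr, hrk⟩, rfl⟩
      exact h.range_mem_beltSets_diff hK hr hrk
  have hinj : Set.InjOn (fun r => Set.range (f r)) (Set.Icc 1 k) := by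
    rintro r ⟨-, hrk⟩ s ⟨-, hsk⟩ hrs
    obtain ⟨j, hj⟩ := hrs.le ⟨0, rfl⟩
    exact (h.ring_injective (by omega) (by omega) hj).1.symm
  have hncard : (Set.Icc 1 k).ncard = k := by simp [Set.ncard_eq_toFinset_card']
  rw [← Set.ncard_sdiff_add_ncard_of_subset hK.pentagonLinks_subset, hrings, hinj.ncard_image,
    hncard, hK.ncard_pentagonLinks, add_comm]

lemma IsFullerene.exists_isTube_of_notMem_pentagonLinks (hK : K.IsFullerene) (hx : K.IsBelt x)
    (hlink : Set.range x ∉ K.pentagonLinks) :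
    (∀ i, K.deg (x i) = 6) ∧ ∃ k b t f, 1 ≤ k ∧ K.IsTube (k + 1) b t f := by
  obtain ⟨T, hT⟩ := hx.exists_region (by omega)
  obtain ⟨hone, hone'⟩ := hK.card_inside_ne_one hx hT hlink
  refine ⟨hK.deg_eq_six_of_card_inside_ne_one hx hT hone hone', ?_⟩
  obtain ⟨n, b, t, f, hn, h⟩ := hK.exists_isTube hx hT hone hone'
  obtain ⟨k, rfl⟩ := Nat.exists_eq_add_of_le' hn
  obtain ⟨r, hr, hrk, -⟩ := h.exists_range_eq hK hx hlink
  exact ⟨k, b, t, f, by omega, h⟩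

end Rings

end TriangulatedSphere

namespace ConvexPolytope

/-! ### Vertices and edges of a simple polytope -/

variable {n : ℕ} {P : ConvexPolytope n} {v w x u d : EuclideanSpace ℝ (Fin n)} {i j : Fin P.m}
  {S T : Set (Fin P.m)}

/-- The value at `x` of the `i`-th inequality of `P`, which vanishes on the `i`-th facet. -/
noncomputable def height (P : ConvexPolytope n) (i : Fin P.m) (x : EuclideanSpace ℝ (Fin n)) : ℝ :=
  inner ℝ (P.a i) x + P.b i

open Classical in
/-- The facets containing a point `x` of `P`. -/
noncomputable def active (P : ConvexPolytope n) (x : EuclideanSpace ℝ (Fin n)) : Finset (Fin P.m) :=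
  {i | P.height i x = 0}

/-- The vertices of `P` as points, characterised by the fact that the normals of the facets through
them span the space; `IsVertex` is about one-point faces. -/
def IsNode (P : ConvexPolytope n) (v : EuclideanSpace ℝ (Fin n)) : Prop :=
  v ∈ P.carrier ∧ ∀ u : EuclideanSpace ℝ (Fin n), (∀ i ∈ P.active v, inner ℝ (P.a i) u = 0) → u = 0

/-- The face in which the facets of `S` intersect. -/
def face (P : ConvexPolytope n) (S : Set (Fin P.m)) : Set (EuclideanSpace ℝ (Fin n)) :=
  {x | x ∈ P.carrier ∧ S ⊆ P.active x}

lemma mem_active : i ∈ P.active x ↔ P.height i x = 0 := by simp [active]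

lemma height_nonneg (hx : x ∈ P.carrier) (i : Fin P.m) : 0 ≤ P.height i x := hx i

lemma height_pos (hx : x ∈ P.carrier) (hi : i ∉ P.active x) : 0 < P.height i x :=
  (height_nonneg hx i).lt_of_ne fun h => hi (mem_active.2 h.symm)

lemma height_add_smul (i : Fin P.m) (x u : EuclideanSpace ℝ (Fin n)) (t : ℝ) :
    P.height i (x + t • u) = P.height i x + t * inner ℝ (P.a i) u := by
  rw [height, height, inner_add_right, inner_smul_right]
  ring

lemma inner_sub_eq (i : Fin P.m) (x y : EuclideanSpace ℝ (Fin n)) :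
    inner ℝ (P.a i) (x - y) = P.height i x - P.height i y := by
  rw [height, height, inner_sub_right]
  ring

lemma height_smul_add_smul (i : Fin P.m) (x y : EuclideanSpace ℝ (Fin n)) {s t : ℝ}
    (hst : s + t = 1) :
    P.height i (s • x + t • y) = s * P.height i x + t * P.height i y := by
  simp only [height, inner_add_right, inner_smul_right]
  linear_combination (-P.b i) * hst

lemma continuous_height (i : Fin P.m) : Continuous (P.height i) := by
  unfold height
  fun_prop

lemma facet_eq_face (i : Fin P.m) : P.facet i = P.face {i} := by
  ext x
  simp [facet, face, mem_active, height]

lemma face_eq_inter_iInter (S : Set (Fin P.m)) : P.face S = P.carrier ∩ ⋂ i ∈ S, P.facet i := by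
  ext x
  simp only [facet_eq_face, face, Set.mem_inter_iff, Set.mem_iInter, Set.mem_ofPred_eq,
    Set.singleton_subset_iff]
  exact and_congr_right fun hx => ⟨fun h i hi => ⟨hx, h hi⟩, fun h i hi => (h i hi).2⟩

lemma face_mem_faces (S : Set (Fin P.m)) : P.face S ∈ P.faces := ⟨S, face_eq_inter_iInter S⟩

lemma IsNode.eq_of_active_subset (hv : P.IsNode v) (hx : P.active v ⊆ P.active x) : x = v := by
  refine sub_eq_zero.1 (hv.2 _ fun i hi => ?_)
  rw [inner_sub_eq, mem_active.1 hi, mem_active.1 (hx hi), sub_zero]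

lemma IsNode.face_active (hv : P.IsNode v) : P.face (P.active v) = {v} :=
  Set.eq_singleton_iff_unique_mem.2
    ⟨⟨hv.1, subset_rfl⟩, fun _ hx => hv.eq_of_active_subset (coe_subset.1 hx.2)⟩

lemma IsNode.isVertex (hv : P.IsNode v) : P.IsVertex {v} :=
  ⟨hv.face_active ▸ face_mem_faces _, Set.singleton_nonempty v, by simp⟩

lemma IsSimple.carrier_nonempty (hP : P.IsSimple) : P.carrier.Nonempty :=
  hP.1.mono interior_subset

lemma IsSimple.card_active (hP : P.IsSimple) (hv : P.IsNode v) : #(P.active v) = n := by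
  have hfacets : {i : Fin P.m | {v} ⊆ P.facet i} = P.active v := by
    ext i
    simp [facet, hv.1, mem_active, height]
  have hcard := hP.2 _ hv.isVertex
  rwa [hfacets, Set.ncard_coe_finset] at hcard

lemma IsSimple.exists_dual (hP : P.IsSimple) (hv : P.IsNode v) :
    ∃ d : Fin P.m → EuclideanSpace ℝ (Fin n), ∀ i ∈ P.active v, ∀ j ∈ P.active v,
      inner ℝ (P.a j) (d i) = if j = i then 1 else 0 := by
  let Φ : EuclideanSpace ℝ (Fin n) →ₗ[ℝ] (P.active v → ℝ) :=
    LinearMap.pi fun i => (innerSL ℝ (P.a i) : EuclideanSpace ℝ (Fin n) →L[ℝ] ℝ).toLinearMap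
  have hinj : Function.Injective Φ :=
    (injective_iff_map_eq_zero Φ).2 fun u hu => hv.2 u fun i hi => congrFun hu ⟨i, hi⟩
  have hsurj : Function.Surjective Φ := by
    refine (LinearMap.injective_iff_surjective_of_finrank_eq_finrank ?_).1 hinj
    rw [finrank_euclideanSpace_fin, Module.finrank_fintype_fun_eq_card, Fintype.card_coe,
      hP.card_active hv]
  choose d hd using fun i : Fin P.m => hsurj fun j => if j.1 = i then 1 else 0
  exact ⟨d, fun i _ j hj => congrFun (hd i) ⟨j, hj⟩⟩

/-- The direction of the edge leaving the facet `i` at the vertex `v` of a simple polytope, scaled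
so that the height over `i` grows with speed one. It is arbitrary if `i` does not contain `v`. -/
noncomputable def dir (P : ConvexPolytope n) (v : EuclideanSpace ℝ (Fin n)) :
    Fin P.m → EuclideanSpace ℝ (Fin n) :=
  Classical.epsilon fun d => ∀ i ∈ P.active v, ∀ j ∈ P.active v,
    inner ℝ (P.a j) (d i) = if j = i then 1 else 0

lemma IsSimple.inner_dir (hP : P.IsSimple) (hv : P.IsNode v) (hi : i ∈ P.active v)
    (hj : j ∈ P.active v) : inner ℝ (P.a j) (P.dir v i) = if j = i then 1 else 0 :=
  Classical.epsilon_spec (hP.exists_dual hv) i hi j hj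

lemma IsSimple.eq_sum_dir (hP : P.IsSimple) (hv : P.IsNode v) (u : EuclideanSpace ℝ (Fin n)) :
    u = ∑ i ∈ P.active v, inner ℝ (P.a i) u • P.dir v i := by
  refine sub_eq_zero.1 (hv.2 _ fun j hj => ?_)
  rw [inner_sub_right, inner_sum, sum_congr rfl fun i hi => by
    rw [inner_smul_right, hP.inner_dir hv hi hj]]
  simp [hj]

lemma IsSimple.sub_eq_sum_dir (hP : P.IsSimple) (hv : P.IsNode v) (x : EuclideanSpace ℝ (Fin n)) :
    x - v = ∑ i ∈ P.active v, P.height i x • P.dir v i := by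
  rw [hP.eq_sum_dir hv (x - v)]
  refine sum_congr rfl fun i hi => ?_
  rw [inner_sub_eq, mem_active.1 hi, sub_zero]

lemma IsSimple.dir_ne_zero (hP : P.IsSimple) (hv : P.IsNode v) (hi : i ∈ P.active v) :
    P.dir v i ≠ 0 := by
  intro h
  simpa [h] using hP.inner_dir hv hi hi

lemma exists_inner_neg (hx : x ∈ P.carrier) (hd : d ≠ 0) : ∃ l, inner ℝ (P.a l) d < 0 := by
  by_contra! hpos
  obtain ⟨R, hR⟩ := P.bounded.exists_norm_le
  have hray : ∀ t : ℝ, 0 ≤ t → ‖x + t • d‖ ≤ R := by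
    intro t ht
    refine hR _ fun l => ?_
    change 0 ≤ P.height l _
    rw [height_add_smul]
    exact add_nonneg (hx l) (mul_nonneg ht (hpos l))
  have hdpos : 0 < ‖d‖ := norm_pos_iff.2 hd
  have hx_le : ‖x‖ ≤ R := by simpa using hray 0 le_rfl
  set t := (R + ‖x‖ + 1) / ‖d‖ with ht
  have ht0 : 0 ≤ t := div_nonneg (by linarith [norm_nonneg x]) hdpos.le
  have hnorm : ‖t • d‖ = R + ‖x‖ + 1 := by
    rw [norm_smul, Real.norm_of_nonneg ht0, ht, div_mul_cancel₀ _ hdpos.ne']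
  have htri := norm_sub_le (x + t • d) x
  rw [add_sub_cancel_left, hnorm] at htri
  linarith [hray t ht0]

/-- The first exit of the ray from `x` in the direction `d`. -/
lemma exists_active_inner_neg (hx : x ∈ P.carrier) (hd : d ≠ 0)
    (hactive : ∀ j ∈ P.active x, 0 ≤ inner ℝ (P.a j) d) :
    ∃ c : ℝ, 0 < c ∧ x + c • d ∈ P.carrier ∧
      ∃ l ∈ P.active (x + c • d), inner ℝ (P.a l) d < 0 := by
  classical
  obtain ⟨l, hl, hmin⟩ := exists_min_image ({l | inner ℝ (P.a l) d < 0} : Finset (Fin P.m))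
    (fun l => P.height l x / -inner ℝ (P.a l) d) ((exists_inner_neg hx hd).imp (by simp))
  simp only [mem_filter_univ] at hl hmin
  set c := P.height l x / -inner ℝ (P.a l) d
  have hcpos : 0 < c :=
    div_pos (height_pos hx fun h => (hactive l h).not_gt hl) (neg_pos.2 hl)
  refine ⟨c, hcpos, fun j => ?_, l, ?_, hl⟩
  · change 0 ≤ P.height j _
    rw [height_add_smul]
    rcases lt_or_ge (inner ℝ (P.a j) d) 0 with hj | hj
    · have hcj := (le_div_iff₀ (neg_pos.2 hj)).1 (hmin j hj)
      linarith
    · exact add_nonneg (height_nonneg hx j) (mul_nonneg hcpos.le hj)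
  · have hcl : c * -inner ℝ (P.a l) d = P.height l x := div_mul_cancel₀ _ (neg_pos.2 hl).ne'
    rw [mem_active, height_add_smul]
    linarith

lemma IsSimple.exists_isNode_add_smul_dir (hP : P.IsSimple) (hv : P.IsNode v)
    (hi : i ∈ P.active v) : ∃ c : ℝ, 0 < c ∧ P.IsNode (v + c • P.dir v i) ∧
      (P.active v).erase i ⊆ P.active (v + c • P.dir v i) ∧
      i ∉ P.active (v + c • P.dir v i) := by
  obtain ⟨c, hcpos, hmem, l, hl, hlneg⟩ := exists_active_inner_neg hv.1 (hP.dir_ne_zero hv hi)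
    fun j hj => by
      rw [hP.inner_dir hv hi hj]
      split_ifs <;> norm_num
  have hsub : (P.active v).erase i ⊆ P.active (v + c • P.dir v i) := by
    intro j hj
    obtain ⟨hji, hj⟩ := mem_erase.1 hj
    rw [mem_active, height_add_smul, mem_active.1 hj, hP.inner_dir hv hi hj, if_neg hji]
    ring
  refine ⟨c, hcpos, ⟨hmem, fun u hu => ?_⟩, hsub, ?_⟩
  · have hu_eq : u = inner ℝ (P.a i) u • P.dir v i := by
      nth_rewrite 1 [hP.eq_sum_dir hv u]
      refine sum_eq_single_of_mem i hi fun j hj hji => ?_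
      rw [hu j (hsub (mem_erase.2 ⟨hji, hj⟩)), zero_smul]
    have hul := hu l hl
    rw [hu_eq, inner_smul_right] at hul
    rw [hu_eq, (mul_eq_zero.1 hul).resolve_right hlneg.ne, zero_smul]
  · rw [mem_active, height_add_smul, mem_active.1 hi, hP.inner_dir hv hi hi, if_pos rfl]
    linarith

lemma IsNode.sub_smul_notMem (hw : P.IsNode w) (hd : d ≠ 0) {s t : ℝ} (hs : 0 < s) (ht : 0 < t)
    (hmem : w + s • d ∈ P.carrier) : w - t • d ∉ P.carrier := by
  intro hmem'
  refine hd (hw.2 d fun i hi => ?_)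
  have hpos := height_nonneg hmem i
  have hneg := height_nonneg hmem' i
  rw [sub_eq_add_neg, ← neg_smul, height_add_smul, mem_active.1 hi] at hneg
  rw [height_add_smul, mem_active.1 hi] at hpos
  nlinarith

lemma IsSimple.eq_or_eq_add_smul_dir (hP : P.IsSimple) (hv : P.IsNode v) (hw : P.IsNode w)
    (hi : i ∈ P.active v) {c : ℝ} (hc : 0 < c) (hend : P.IsNode (v + c • P.dir v i))
    (hsub : (P.active v).erase i ⊆ P.active w) : w = v ∨ w = v + c • P.dir v i := by
  have hw_eq : w = v + P.height i w • P.dir v i := by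
    rw [← sub_eq_iff_eq_add', hP.sub_eq_sum_dir hv w]
    refine sum_eq_single_of_mem i hi fun j hj hji => ?_
    rw [mem_active.1 (hsub (mem_erase.2 ⟨hji, hj⟩)), zero_smul]
  have hd := hP.dir_ne_zero hv hi
  obtain ⟨s, hs0, rfl⟩ : ∃ s : ℝ, 0 ≤ s ∧ w = v + s • P.dir v i :=
    ⟨_, height_nonneg hw.1 i, hw_eq⟩
  rcases hs0.eq_or_lt with rfl | hspos
  · exact .inl (by rw [zero_smul, add_zero])
  rcases lt_trichotomy s c with hlt | rfl | hlt
  · refine (hw.sub_smul_notMem hd (sub_pos.2 hlt) hspos ?_ ?_).elim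
    · convert hend.1 using 1
      module
    · simpa using hv.1
  · exact .inr rfl
  · refine (hend.sub_smul_notMem hd (sub_pos.2 hlt) hc ?_ ?_).elim
    · convert hw.1 using 1
      module
    · simpa using hv.1

/-! ### Faces are the convex hulls of their vertices -/

lemma isCompact_face (S : Set (Fin P.m)) : IsCompact (P.face S) := by
  refine Metric.isCompact_of_isClosed_isBounded ?_ (P.bounded.subset fun x hx => hx.1)
  have hface : P.face S = (⋂ i, {x | 0 ≤ P.height i x}) ∩ ⋂ i ∈ S, {x | P.height i x = 0} := by
    ext x
    simp [face, carrier, height, mem_active, Set.subset_def]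
  rw [hface]
  exact (isClosed_iInter fun i => isClosed_le continuous_const (continuous_height i)).inter
    (isClosed_biInter fun i _ => isClosed_eq (continuous_height i) continuous_const)

lemma convex_face (S : Set (Fin P.m)) : Convex ℝ (P.face S) := by
  intro x hx y hy s t hs ht hst
  refine ⟨fun i => ?_, fun i hi => mem_active.2 ?_⟩
  · change 0 ≤ P.height i _
    rw [height_smul_add_smul i x y hst]
    exact add_nonneg (mul_nonneg hs (hx.1 i)) (mul_nonneg ht (hy.1 i))
  · rw [height_smul_add_smul i x y hst, mem_active.1 (hx.2 hi), mem_active.1 (hy.2 hi)]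
    ring

lemma exists_pos_add_smul_mem_face (hx : x ∈ P.face S)
    (hu : ∀ i ∈ P.active x, inner ℝ (P.a i) u = 0) : ∃ c : ℝ, 0 < c ∧ x + c • u ∈ P.face S := by
  rcases eq_or_ne u 0 with rfl | hu0
  · exact ⟨1, one_pos, by simpa using hx⟩
  obtain ⟨c, hc, hmem, -⟩ := exists_active_inner_neg hx.1 hu0 fun i hi => (hu i hi).ge
  refine ⟨c, hc, hmem, fun i hi => mem_active.2 ?_⟩
  rw [height_add_smul, hu i (hx.2 hi), mem_active.1 (hx.2 hi), mul_zero, add_zero]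

lemma isNode_of_mem_extremePoints (hx : x ∈ (P.face S).extremePoints ℝ) : P.IsNode x := by
  refine ⟨hx.1.1, fun u hu => ?_⟩
  obtain ⟨s, hs, hplus⟩ := exists_pos_add_smul_mem_face hx.1 hu
  obtain ⟨t, ht, hminus⟩ := exists_pos_add_smul_mem_face (u := -u) hx.1 fun i hi => by
    rw [inner_neg_right, hu i hi, neg_zero]
  have hseg : x ∈ openSegment ℝ (x + s • u) (x + t • -u) := by
    refine mem_openSegment_iff_div.2 ⟨t, s, ht, hs, ?_⟩
    match_scalars
    · field_simp
    · field_simp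
      ring
  have heq := hx.2 hplus hminus hseg
  simpa [hs.ne'] using heq

lemma exists_isNode_mem_face (h : (P.face S).Nonempty) : ∃ v, P.IsNode v ∧ v ∈ P.face S := by
  obtain ⟨v, hv⟩ := (isCompact_face S).extremePoints_nonempty h
  exact ⟨v, isNode_of_mem_extremePoints hv, hv.1⟩

lemma face_subset_face (h : ∀ v, P.IsNode v → v ∈ P.face S → v ∈ P.face T) :
    P.face S ⊆ P.face T := by
  rw [← closure_convexHull_extremePoints (isCompact_face S) (convex_face S)]
  exact closure_minimal
    (convexHull_min (fun v hv => h v (isNode_of_mem_extremePoints hv) hv.1) (convex_face T))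
    (isCompact_face T).isClosed

/-- The segment from a point of `P` to a point violating only the `i`-th inequality crosses the
`i`-th facet. -/
lemma face_singleton_nonempty (hP : P.carrier.Nonempty) (i : Fin P.m) :
    (P.face {i}).Nonempty := by
  obtain ⟨x, hx⟩ := hP
  obtain ⟨y, hy, hyi⟩ : ∃ y, (∀ j, j ≠ i → 0 ≤ P.height j y) ∧ P.height i y < 0 := by
    by_contra! h
    refine P.irredundant i (Set.Subset.antisymm (fun y hy j => ?_) fun y hy j _ => hy j)
    rcases eq_or_ne j i with rfl | hj
    exacts [h y hy, hy j hj]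
  have hxi := height_nonneg hx i
  have hpos : 0 < P.height i x - P.height i y := by linarith
  set s := -P.height i y / (P.height i x - P.height i y) with hs
  set t := P.height i x / (P.height i x - P.height i y) with ht
  have hst : s + t = 1 := by
    rw [hs, ht]
    field_simp
    ring
  have hzero : P.height i (s • x + t • y) = 0 := by
    rw [height_smul_add_smul i x y hst, hs, ht]
    ring
  refine ⟨s • x + t • y, fun j => ?_, by simpa [mem_active] using hzero⟩
  rcases eq_or_ne j i with rfl | hj
  · exact hzero.ge
  · change 0 ≤ P.height j _
    rw [height_smul_add_smul j x y hst]
    exact add_nonneg (mul_nonneg (div_nonneg (by linarith) hpos.le) (height_nonneg hx j))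
      (mul_nonneg (div_nonneg hxi hpos.le) (hy j hj))

/-! ### Generic linear functionals -/

/-- The type of vertices of `P`. -/
abbrev Node (P : ConvexPolytope n) := {v : EuclideanSpace ℝ (Fin n) // P.IsNode v}

lemma active_injective : Function.Injective fun v : P.Node => P.active v :=
  fun _ w h => Subtype.ext (w.2.eq_of_active_subset (Eq.ge h))

instance : Finite P.Node := Finite.of_injective _ active_injective

noncomputable instance : Fintype P.Node := Fintype.ofFinite _

noncomputable instance : DecidableEq P.Node := Classical.decEq _

lemma exists_linearMap_injective (P : ConvexPolytope n) :
    ∃ f : EuclideanSpace ℝ (Fin n) →ₗ[ℝ] ℝ, Function.Injective fun v : P.Node => f v := by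
  obtain ⟨f, hf⟩ := Module.exists_dual_forall_apply_ne_zero (K := ℝ)
    (fun p : {p : P.Node × P.Node // p.1 ≠ p.2} => p.1.1.1 - p.1.2.1)
    fun p h => p.2 (Subtype.ext (sub_eq_zero.1 h))
  refine ⟨f, fun v w h => ?_⟩
  by_contra hne
  exact hf ⟨(v, w), hne⟩ (by rw [map_sub]; exact sub_eq_zero.2 h)

/-- `v` is a vertex of the face `S` from which all edges in that face descend with respect to
`f`. -/
def IsTop (P : ConvexPolytope n) (f : EuclideanSpace ℝ (Fin n) →ₗ[ℝ] ℝ) (S : Set (Fin P.m))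
    (v : P.Node) : Prop :=
  v.1 ∈ P.face S ∧ ∀ i ∈ P.active v, i ∉ S → f (P.dir v i) < 0

section Generic

variable {f : EuclideanSpace ℝ (Fin n) →ₗ[ℝ] ℝ}

lemma IsSimple.apply_dir_ne_zero (hP : P.IsSimple)
    (hf : Function.Injective fun v : P.Node => f v) (v : P.Node) (hi : i ∈ P.active v) :
    f (P.dir v i) ≠ 0 := by
  intro h
  obtain ⟨c, hc, hnode, -⟩ := hP.exists_isNode_add_smul_dir v.2 hi
  have heq := congrArg Subtype.val (@hf ⟨_, hnode⟩ v (by simp [h]))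
  simp [hc.ne', hP.dir_ne_zero v.2 hi] at heq

lemma IsSimple.exists_isTop (hP : P.IsSimple) (hf : Function.Injective fun v : P.Node => f v)
    {Q : P.Node → Prop} (hQ : ∀ v w : P.Node, v.1 ∈ P.face S → w.1 ∈ P.face S →
      n ≤ #(P.active v ∩ P.active w) + 1 → Q v → Q w)
    {v₀ : P.Node} (hv₀ : v₀.1 ∈ P.face S) (hQ₀ : Q v₀) : ∃ v, P.IsTop f S v ∧ Q v := by
  classical
  obtain ⟨v, hv, hmax⟩ := exists_max_image ({v | v.1 ∈ P.face S ∧ Q v} : Finset P.Node)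
    (fun v => f v) ⟨v₀, by simpa using ⟨hv₀, hQ₀⟩⟩
  simp only [mem_filter_univ] at hv hmax
  refine ⟨v, ⟨hv.1, fun i hi hiS => ?_⟩, hv.2⟩
  obtain ⟨c, hc, hnode, hsub, -⟩ := hP.exists_isNode_add_smul_dir v.2 hi
  have hmem : v.1 + c • P.dir v i ∈ P.face S := ⟨hnode.1, fun j hj =>
    hsub (mem_erase.2 ⟨ne_of_mem_of_not_mem hj hiS, hv.1.2 hj⟩)⟩
  have hadj : n ≤ #(P.active v ∩ P.active (v.1 + c • P.dir v i)) + 1 := by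
    have hle := card_le_card (subset_inter (erase_subset i _) hsub)
    rw [card_erase_of_mem hi, hP.card_active v.2] at hle
    omega
  have hle := hmax ⟨_, hnode⟩ ⟨hmem, hQ v ⟨_, hnode⟩ hv.1 hmem hadj hv.2⟩
  simp only [map_add, map_smul, smul_eq_mul, add_le_iff_nonpos_right] at hle
  exact (nonpos_of_mul_nonpos_right hle hc).lt_of_ne (hP.apply_dir_ne_zero hf v hi)

lemma IsSimple.isTop_unique (hP : P.IsSimple) (hf : Function.Injective fun v : P.Node => f v)
    {v w : P.Node} (hv : P.IsTop f S v) (hw : P.IsTop f S w) : v = w := by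
  have hle : ∀ v w : P.Node, P.IsTop f S v → P.IsTop f S w → f w ≤ f v := by
    intro v w hv hw
    rw [← sub_nonpos, ← map_sub, hP.sub_eq_sum_dir v.2 w, map_sum]
    refine sum_nonpos fun i hi => ?_
    rw [map_smul, smul_eq_mul]
    by_cases hiS : i ∈ S
    · rw [mem_active.1 (hw.1.2 hiS), zero_mul]
    · exact mul_nonpos_of_nonneg_of_nonpos (w.2.1 i) (hv.2 i hi hiS).le
  exact hf (le_antisymm (hle w v hw hv) (hle v w hv hw))

/-- Otherwise a generic linear functional would have two tops in the face, one among the vertices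
with `Q` and one among those without. -/
lemma IsSimple.face_connected (hP : P.IsSimple) {Q : P.Node → Prop}
    (hQ : ∀ v w : P.Node, v.1 ∈ P.face S → w.1 ∈ P.face S →
      n ≤ #(P.active v ∩ P.active w) + 1 → Q v → Q w)
    {v w : P.Node} (hv : v.1 ∈ P.face S) (hw : w.1 ∈ P.face S) (h : Q v) : Q w := by
  by_contra hnot
  obtain ⟨f, hf⟩ := exists_linearMap_injective P
  obtain ⟨a, ha, haQ⟩ := hP.exists_isTop hf hQ hv h
  obtain ⟨b, hb, hbQ⟩ := hP.exists_isTop (Q := fun v => ¬ Q v) hf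
    (fun v w hv hw hadj => mt (hQ w v hw hv (by rwa [inter_comm]))) hw hnot
  exact hbQ (hP.isTop_unique hf ha hb ▸ haQ)

lemma IsSimple.card_isTop (hP : P.IsSimple) (hf : Function.Injective fun v : P.Node => f v)
    (hS : (P.face S).Nonempty) [DecidablePred (P.IsTop f S)] : #{v | P.IsTop f S v} = 1 := by
  obtain ⟨v₀, hnode, hv₀⟩ := exists_isNode_mem_face hS
  obtain ⟨v, hv, -⟩ := hP.exists_isTop (Q := fun _ => True) (v₀ := ⟨v₀, hnode⟩) hf
    (fun _ _ _ _ _ => id) hv₀ trivial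
  refine card_eq_one.2 ⟨v, ?_⟩
  ext w
  simp only [mem_filter_univ, mem_singleton]
  exact ⟨fun hw => hP.isTop_unique hf hw hv, fun h => h ▸ hv⟩

lemma card_filter_add_card_filter_not {α : Type*} [DecidableEq α] {s : Finset α} (hs : #s = 3)
    (p : α → Prop) [DecidablePred p] :
    #{i ∈ s | ∀ j ∈ s, j ≠ i → p j} + #{i ∈ s | ∀ j ∈ s, j ≠ i → ¬ p j} =
      1 + 2 * (if ∀ j ∈ s, p j then 1 else 0) + 2 * (if ∀ j ∈ s, ¬ p j then 1 else 0) := by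
  obtain ⟨a, b, c, hab, hac, hbc, rfl⟩ := card_eq_three.1 hs
  by_cases ha : p a <;> by_cases hb : p b <;> by_cases hc : p c <;>
    simp [filter_insert, filter_singleton, ha, hb, hc, hab, hac, hbc, hab.symm, hac.symm, hbc.symm]

lemma IsSimple.isTop_neg_iff (hP : P.IsSimple) (hf : Function.Injective fun v : P.Node => f v)
    {v : P.Node} : P.IsTop (-f) S v ↔
      v.1 ∈ P.face S ∧ ∀ i ∈ P.active v, i ∉ S → ¬ f (P.dir v i) < 0 := by
  refine and_congr_right fun _ => forall₃_congr fun i hi _ => ?_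
  rw [LinearMap.neg_apply, neg_lt_zero, not_lt]
  exact ⟨le_of_lt, fun h => h.lt_of_ne (hP.apply_dir_ne_zero hf v hi).symm⟩

lemma IsSimple.sum_card_isTop_singleton (hP : P.IsSimple)
    (hf : Function.Injective fun v : P.Node => f v) [∀ S, DecidablePred (P.IsTop f S)] :
    ∑ v : P.Node, #{i | P.IsTop f {i} v} = P.m := by
  simp_rw [card_filter]
  rw [sum_comm]
  simp_rw [← card_filter, hP.card_isTop hf (face_singleton_nonempty hP.carrier_nonempty _)]
  simp

end Generic

lemma IsSimple.card_isTop_add_card_isTop_neg {P : ConvexPolytope 3} (hP : P.IsSimple)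
    {f : EuclideanSpace ℝ (Fin 3) →ₗ[ℝ] ℝ} (hf : Function.Injective fun v : P.Node => f v)
    [∀ f S, DecidablePred (P.IsTop f S)] (v : P.Node) :
    #{i | P.IsTop f {i} v} + #{i | P.IsTop (-f) {i} v} =
      1 + 2 * (if P.IsTop f ∅ v then 1 else 0) + 2 * (if P.IsTop (-f) ∅ v then 1 else 0) := by
  classical
  have hcount := card_filter_add_card_filter_not (hP.card_active v.2) fun i => f (P.dir v i) < 0
  simp only [hP.isTop_neg_iff hf]
  convert hcount using 2
  · exact congrArg card (by ext i; simp [IsTop, face, v.2.1])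
  · exact congrArg card (by ext i; simp [face, v.2.1])
  all_goals simp [IsTop, face, v.2.1]

/-- Euler's formula, by counting the pairs of a facet and its highest or lowest vertex for a generic
functional: the highest and the lowest vertex of `P` lie in three such pairs, all others in one. -/
lemma IsSimple.card_node {P : ConvexPolytope 3} (hP : P.IsSimple) :
    Fintype.card P.Node + 4 = 2 * P.m := by
  classical
  obtain ⟨f, hf⟩ := exists_linearMap_injective P
  have hf_neg : Function.Injective fun v : P.Node => (-f) v := fun v w h => hf (by simpa using h)
  have hempty : (P.face ∅).Nonempty := by simpa [face] using hP.carrier_nonempty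
  have htop := hP.card_isTop hf hempty
  have hbot := hP.card_isTop hf_neg hempty
  rw [card_filter] at htop hbot
  have hsum := sum_congr rfl fun v (_ : v ∈ univ) => hP.card_isTop_add_card_isTop_neg hf v
  rw [sum_add_distrib, sum_add_distrib, sum_add_distrib, ← mul_sum, ← mul_sum,
    hP.sum_card_isTop_singleton hf, hP.sum_card_isTop_singleton hf_neg, htop, hbot] at hsum
  simp only [sum_const, card_univ, smul_eq_mul, mul_one] at hsum
  omega

end ConvexPolytope

namespace TriangulatedSphere

variable {F V : Type*} [Fintype F] [Fintype V] [DecidableEq F] [DecidableEq V]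
  {K : TriangulatedSphere F V}

/-- Both sides are half the number of pairs of a neighbour of `y` and a common vertex with `y`. -/
lemma ncard_adj (y : F) : {z | K.Adj z y}.ncard = K.deg y := by
  classical
  rw [Set.ncard_eq_toFinset_card', Set.toFinset_ofPred]
  refine Nat.eq_of_mul_eq_mul_right two_pos
    (card_mul_eq_card_mul (s := {z | K.Adj z y}) (t := K.star y) (fun z v => z ∈ K.facetsAt v)
      (fun z hz => ?_) fun v hv => ?_)
  · obtain ⟨hzy, v, hzv, hyv⟩ : K.Adj z y := by simpa using hz
    rw [← K.card_cofaces v {z, y} (by simp [insert_subset_iff, hzv, hyv]) (card_pair hzy)]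
    congr 1
    ext w
    simp [bipartiteAbove, mem_star, insert_subset_iff, and_comm]
  · have hyv := mem_star.1 hv
    have hcard : #((K.facetsAt v).erase y) = 2 := by rw [card_erase_of_mem hyv, K.card_facetsAt]
    rw [← hcard]
    congr 1
    ext z
    simp only [bipartiteBelow, mem_filter, mem_univ, true_and, mem_erase]
    exact ⟨fun h => ⟨h.1.1, h.2⟩, fun h => ⟨⟨h.1, v, h.2, hyv⟩, h.2⟩⟩

end TriangulatedSphere

namespace ConvexPolytope

section Edges

variable {n : ℕ} {P : ConvexPolytope n} {v : EuclideanSpace ℝ (Fin n)} {i : Fin P.m}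
  {S : Set (Fin P.m)}

lemma facet_inter_facet (i j : Fin P.m) : P.facet i ∩ P.facet j = P.face {i, j} := by
  ext x
  simp only [facet_eq_face, face, Set.mem_inter_iff, Set.mem_ofPred_eq, Set.insert_subset_iff,
    Set.singleton_subset_iff]
  tauto

lemma exists_erase_eq {α : Type*} [DecidableEq α] {s t : Finset α} (hst : s ⊆ t)
    (hcard : #s + 1 = #t) : ∃ i ∈ t, t.erase i = s := by
  obtain ⟨i, hi, rfl⟩ := exists_eq_insert_iff.2 ⟨hst, hcard⟩
  exact ⟨i, mem_insert_self i s, erase_insert hi⟩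

lemma IsSimple.card_filter_subset_active (hP : P.IsSimple) {v : P.Node} {e : Finset (Fin P.m)}
    (he : e ⊆ P.active v) (hcard : #e + 1 = n) : #{w : P.Node | e ⊆ P.active w} = 2 := by
  obtain ⟨i, hi, rfl⟩ := exists_erase_eq he (hcard.trans (hP.card_active v.2).symm)
  obtain ⟨c, hc, hnode, hsub, hnot⟩ := hP.exists_isNode_add_smul_dir v.2 hi
  have hne : v ≠ ⟨_, hnode⟩ := fun h =>
    hnot ((congrArg (fun w : P.Node => i ∈ P.active w) h).mp hi)
  rw [← card_pair hne]
  congr 1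
  ext w
  simp only [mem_filter_univ, mem_insert, mem_singleton]
  constructor
  · exact fun h =>
      (hP.eq_or_eq_add_smul_dir v.2 w.2 hi hc hnode h).imp Subtype.ext Subtype.ext
  · rintro (rfl | rfl)
    exacts [he, hsub]

lemma IsSimple.exists_add_smul_dir_mem_face (hP : P.IsSimple) (hv : P.IsNode v)
    (hS : S ⊆ P.active v) (hi : i ∈ P.active v) (hiS : i ∉ S) :
    ∃ c : ℝ, 0 < c ∧ v + c • P.dir v i ∈ P.face S ∧ i ∉ P.active (v + c • P.dir v i) := by
  obtain ⟨c, hc, hnode, hsub, hnot⟩ := hP.exists_isNode_add_smul_dir hv hi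
  exact ⟨c, hc, ⟨hnode.1, fun j hj =>
    hsub (mem_erase.2 ⟨ne_of_mem_of_not_mem hj hiS, hS hj⟩)⟩, hnot⟩

lemma IsSimple.mem_of_face_subset_facet (hP : P.IsSimple) (hv : P.IsNode v) (hS : S ⊆ P.active v)
    (h : P.face S ⊆ P.facet i) : i ∈ S := by
  rw [facet_eq_face] at h
  by_contra hiS
  obtain ⟨c, -, hmem, hnot⟩ :=
    hP.exists_add_smul_dir_mem_face hv hS ((h ⟨hv.1, hS⟩).2 rfl) hiS
  exact hnot ((h hmem).2 rfl)

lemma IsSimple.dir_mem_vectorSpan (hP : P.IsSimple) (hv : P.IsNode v) (hS : S ⊆ P.active v)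
    (hi : i ∈ P.active v) (hiS : i ∉ S) : P.dir v i ∈ vectorSpan ℝ (P.face S) := by
  obtain ⟨c, hc, hmem, -⟩ := hP.exists_add_smul_dir_mem_face hv hS hi hiS
  have h := vsub_mem_vectorSpan ℝ hmem (⟨hv.1, hS⟩ : v ∈ P.face S)
  rw [vsub_eq_sub, add_sub_cancel_left] at h
  exact (Submodule.smul_mem_iff _ hc.ne').1 h

lemma IsSimple.vectorSpan_face_erase (hP : P.IsSimple) (hv : P.IsNode v) (hi : i ∈ P.active v) :
    vectorSpan ℝ (P.face ((P.active v).erase i)) = Submodule.span ℝ {P.dir v i} := by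
  have hsub : (((P.active v).erase i : Finset _) : Set (Fin P.m)) ⊆ P.active v :=
    coe_subset.2 (erase_subset i _)
  have hmem : v ∈ P.face ((P.active v).erase i) := ⟨hv.1, hsub⟩
  refine le_antisymm ?_ ?_
  · rw [vectorSpan_eq_span_vsub_set_right ℝ hmem, Submodule.span_le]
    rintro _ ⟨x, hx, rfl⟩
    refine Submodule.mem_span_singleton.2 ⟨P.height i x, ?_⟩
    change P.height i x • P.dir v i = x - v
    rw [hP.sub_eq_sum_dir hv x, sum_eq_single_of_mem i hi fun j hj hji => ?_]
    rw [mem_active.1 (hx.2 (mem_coe.2 (mem_erase.2 ⟨hji, hj⟩))), zero_smul]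
  · rw [Submodule.span_singleton_le_iff_mem]
    exact hP.dir_mem_vectorSpan hv hsub hi (by simp)

lemma IsSimple.isEdge_face_erase (hP : P.IsSimple) (hv : P.IsNode v) (hi : i ∈ P.active v) :
    P.IsEdge (P.face ((P.active v).erase i)) := by
  refine ⟨face_mem_faces _, ⟨v, hv.1, coe_subset.2 (erase_subset i _)⟩, ?_⟩
  rw [hP.vectorSpan_face_erase hv hi, finrank_span_singleton (hP.dir_ne_zero hv hi)]

lemma IsSimple.exists_eq_erase_of_isEdge (hP : P.IsSimple) (hv : P.IsNode v)
    (hS : S ⊆ P.active v) (h : P.IsEdge (P.face S)) :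
    ∃ i ∈ P.active v, S = (P.active v).erase i := by
  obtain ⟨i, hi, hiS⟩ : ∃ i ∈ P.active v, i ∉ S := by
    by_contra! hall
    have hdim : Module.finrank ℝ (vectorSpan ℝ (P.face S)) = 0 := by
      rw [hS.antisymm hall, hv.face_active, vectorSpan_singleton, finrank_bot]
    exact one_ne_zero (h.2.2.symm.trans hdim)
  refine ⟨i, hi, Set.Subset.antisymm (fun j hj => ?_) fun j hj => ?_⟩
  · exact mem_coe.2 (mem_erase.2 ⟨ne_of_mem_of_not_mem hj hiS, hS hj⟩)
  · obtain ⟨hji, hj⟩ := mem_erase.1 (mem_coe.1 hj)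
    by_contra hjS
    obtain ⟨s, hs⟩ := (finrank_eq_one_iff_of_nonzero'
      (⟨P.dir v i, hP.dir_mem_vectorSpan hv hS hi hiS⟩ : vectorSpan ℝ (P.face S))
      (fun h0 => hP.dir_ne_zero hv hi (congrArg Subtype.val h0))).1 h.2.2
      ⟨P.dir v j, hP.dir_mem_vectorSpan hv hS hj hjS⟩
    have hinner := hP.inner_dir hv hj hj
    have hs_val : s • P.dir v i = P.dir v j := congrArg Subtype.val hs
    rw [← hs_val, inner_smul_right, hP.inner_dir hv hi hj,
      if_neg hji, if_pos rfl, mul_zero] at hinner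
    exact zero_ne_one hinner

end Edges

section Dual

variable {P : ConvexPolytope 3} {i j : Fin P.m}

/-- The triangulated sphere dual to a simple polytope. -/
noncomputable def sphere (P : ConvexPolytope 3) (hP : P.IsSimple) :
    TriangulatedSphere (Fin P.m) P.Node where
  facetsAt v := P.active v
  card_facetsAt v := hP.card_active v.2
  facetsAt_injective := active_injective
  card_cofaces _ _ he hcard := hP.card_filter_subset_active he (by omega)
  star_connected x Q hQ v w hv hw :=
    hP.face_connected (S := {x})
      (fun v w hv hw hadj => hQ v w (hv.2 rfl) (hw.2 rfl) (by omega))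
      ⟨v.2.1, by simpa using hv⟩ ⟨w.2.1, by simpa using hw⟩
  connected Q hQ v w :=
    hP.face_connected (S := ∅) (fun v w _ _ hadj => hQ v w (by omega))
      ⟨v.2.1, Set.empty_subset _⟩ ⟨w.2.1, Set.empty_subset _⟩
  exists_mem_facetsAt x := by
    obtain ⟨v, hv, hmem⟩ :=
      exists_isNode_mem_face (face_singleton_nonempty hP.carrier_nonempty x)
    exact ⟨⟨v, hv⟩, hmem.2 rfl⟩
  euler := by simpa using hP.card_node

lemma IsSimple.face_nonempty_iff (hP : P.IsSimple) {S : Set (Fin P.m)} :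
    (P.face S).Nonempty ↔ ∃ v, ∀ k ∈ S, k ∈ (P.sphere hP).facetsAt v := by
  refine ⟨fun h => ?_, fun ⟨v, hv⟩ => ⟨v, v.2.1, hv⟩⟩
  obtain ⟨v, hnode, hv⟩ := exists_isNode_mem_face h
  exact ⟨⟨v, hnode⟩, hv.2⟩

lemma IsSimple.facet_inter_nonempty_iff (hP : P.IsSimple) (hij : i ≠ j) :
    (P.facet i ∩ P.facet j).Nonempty ↔ (P.sphere hP).Adj i j := by
  rw [facet_inter_facet, hP.face_nonempty_iff]
  simp [TriangulatedSphere.Adj, hij]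

lemma IsSimple.isEdge_facet_inter_iff (hP : P.IsSimple) :
    P.IsEdge (P.facet i ∩ P.facet j) ↔ (P.sphere hP).Adj i j := by
  constructor
  · intro h
    refine (hP.facet_inter_nonempty_iff ?_).1 h.2.1
    rintro rfl
    rw [facet_inter_facet] at h
    obtain ⟨v, hv, hmem⟩ := exists_isNode_mem_face h.2.1
    obtain ⟨k, hk, hS⟩ := hP.exists_eq_erase_of_isEdge hv hmem.2 h
    have hcard := congrArg Set.ncard hS
    rw [Set.ncard_coe_finset, card_erase_of_mem hk, hP.card_active hv] at hcard
    simp at hcard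
  · rintro ⟨hij, v, hi, hj⟩
    have hsub : {i, j} ⊆ P.active v := insert_subset_iff.2 ⟨hi, singleton_subset_iff.2 hj⟩
    obtain ⟨k, hk, herase⟩ := exists_erase_eq hsub (by rw [card_pair hij, hP.card_active v.2])
    simpa [facet_inter_facet, herase] using hP.isEdge_face_erase v.2 hk

lemma IsSimple.exists_facet_inter_eq (hP : P.IsSimple) {e : Set (EuclideanSpace ℝ (Fin 3))}
    (he : P.IsEdge e) (hei : e ⊆ P.facet i) : ∃ j, P.facet j ∩ P.facet i = e := by
  obtain ⟨S, rfl⟩ := he.1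
  rw [← face_eq_inter_iInter] at he hei ⊢
  obtain ⟨v, hv, hmem⟩ := exists_isNode_mem_face he.2.1
  obtain ⟨k, hk, rfl⟩ := hP.exists_eq_erase_of_isEdge hv hmem.2 he
  have hi : i ∈ (P.active v).erase k := hP.mem_of_face_subset_facet hv hmem.2 hei
  obtain ⟨j, hj⟩ : ∃ j, ((P.active v).erase k).erase i = {j} := by
    rw [← card_eq_one, card_erase_of_mem hi, card_erase_of_mem hk, hP.card_active hv]
  refine ⟨j, ?_⟩
  rw [facet_inter_facet, ← insert_erase hi, hj, Set.pair_comm]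
  simp

lemma IsSimple.edges_facet (hP : P.IsSimple) (i : Fin P.m) : {e | P.IsEdge e ∧ e ⊆ P.facet i} =
    (fun j => P.facet j ∩ P.facet i) '' {j | (P.sphere hP).Adj j i} := by
  ext e
  constructor
  · rintro ⟨he, hei⟩
    obtain ⟨j, rfl⟩ := hP.exists_facet_inter_eq he hei
    exact ⟨j, hP.isEdge_facet_inter_iff.1 he, rfl⟩
  · rintro ⟨j, hj, rfl⟩
    exact ⟨hP.isEdge_facet_inter_iff.2 hj, Set.inter_subset_right⟩

lemma IsSimple.injOn_facet_inter (hP : P.IsSimple) (i : Fin P.m) :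
    Set.InjOn (fun j => P.facet j ∩ P.facet i) {j | (P.sphere hP).Adj j i} := by
  rintro j ⟨-, v, hj, hi⟩ k ⟨hki, -⟩ heq
  have hsub : ({j, i} : Set (Fin P.m)) ⊆ P.active v :=
    Set.insert_subset_iff.2 ⟨hj, Set.singleton_subset_iff.2 hi⟩
  have hk : k ∈ ({j, i} : Set (Fin P.m)) := by
    refine hP.mem_of_face_subset_facet v.2 hsub ?_
    rw [← facet_inter_facet]
    exact heq.subset.trans Set.inter_subset_left
  exact (hk.resolve_right hki).symm

lemma IsSimple.isGon_iff (hP : P.IsSimple) {k : ℕ} :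
    P.IsGon k i ↔ (P.sphere hP).deg i = k := by
  rw [IsGon, hP.edges_facet, (hP.injOn_facet_inter i).ncard_image, TriangulatedSphere.ncard_adj]

/-! ### Facets and belts in the dual sphere -/

lemma IsSimple.iInter_facet_eq_empty_iff (hP : P.IsSimple) {ι : Type*} [Nonempty ι]
    {L : ι → Fin P.m} :
    ⋂ p, P.facet (L p) = ∅ ↔ ¬ ∃ v, ∀ p, L p ∈ (P.sphere hP).facetsAt v := by
  have hface : ⋂ p, P.facet (L p) = P.face (Set.range L) := by
    ext x
    simp [facet_eq_face, face, Set.range_subset_iff, forall_and]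
  rw [hface, ← Set.not_nonempty_iff_eq_empty, hP.face_nonempty_iff]
  simp only [Set.forall_mem_range]

lemma IsSimple.isBeltLoop_iff (hP : P.IsSimple) {k : ℕ} {L : ZMod k → Fin P.m} :
    P.IsBeltLoop L ↔ (P.sphere hP).IsBelt L := by
  constructor
  · rintro ⟨hloop, hcap, hmeet⟩
    have hadj : ∀ p, (P.sphere hP).Adj (L p) (L (p + 1)) := fun p =>
      hP.isEdge_facet_inter_iff.1 (hloop p)
    refine ⟨fun p q hpq => ?_, hadj, fun p q hpq => ?_, hP.iInter_facet_eq_empty_iff.1 hcap⟩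
    · by_contra hne
      have hnonempty : (P.facet (L p) ∩ P.facet (L q)).Nonempty := by
        rw [hpq, Set.inter_self, facet_eq_face]
        exact face_singleton_nonempty hP.carrier_nonempty _
      rcases (hmeet p q hne).1 hnonempty with rfl | rfl
      · exact (hadj p).1 hpq
      · exact (hadj q).1 hpq.symm
    · exact (hmeet p q (ne_of_apply_ne L hpq.1)).1 ((hP.facet_inter_nonempty_iff hpq.1).2 hpq)
  · intro h
    refine ⟨fun p => hP.isEdge_facet_inter_iff.2 (h.adj p),
      hP.iInter_facet_eq_empty_iff.2 h.not_common, fun p q hpq => ?_⟩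
    rw [hP.facet_inter_nonempty_iff (h.injective.ne hpq)]
    refine ⟨h.chordless p q, ?_⟩
    rintro (rfl | rfl)
    exacts [h.adj p, (h.adj q).symm]

lemma IsSimple.setOf_isBelt (hP : P.IsSimple) : {B | P.IsBelt 5 B} = (P.sphere hP).beltSets := by
  ext B
  exact exists_congr fun L => and_congr_left fun _ => hP.isBeltLoop_iff

lemma IsSimple.surrounds_iff (hP : P.IsSimple) {B : Set (Fin P.m)} :
    P.Surrounds B i ↔ {z | (P.sphere hP).Adj z i} = B := by
  simp only [Surrounds, hP.isEdge_facet_inter_iff, eq_comm]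

lemma IsSimple.surroundsPentagon_iff (hP : P.IsSimple) {B : Set (Fin P.m)} :
    P.SurroundsPentagon B ↔ B ∈ (P.sphere hP).pentagonLinks :=
  exists_congr fun _ => and_congr hP.isGon_iff hP.surrounds_iff

section CombEquiv

variable {k : ℕ} {g : DPolytope.Facet k ≃ Fin P.m} {e : DPolytope.Vertex k ≃ P.Node}

lemma setOf_mem_face_eq (h : ∀ v φ, g φ ∈ P.active (e v) ↔ φ ∈ DPolytope.facetsAt v)
    (S : Set (Fin P.m)) : {v | (e v : EuclideanSpace ℝ (Fin 3)) ∈ P.face S} =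
      ⋂ φ ∈ g ⁻¹' S, {v | φ ∈ DPolytope.facetsAt v} := by
  ext v
  simp only [face, Set.mem_ofPred_eq, Set.mem_iInter, Set.mem_preimage, ← h, (e v).2.1, true_and,
    ← g.forall_congr_right (q := fun i => i ∈ S → i ∈ P.active (e v)), Set.subset_def, mem_coe]

lemma face_subset_face_iff {S T : Set (Fin P.m)} :
    P.face S ⊆ P.face T ↔ {v | (e v : EuclideanSpace ℝ (Fin 3)) ∈ P.face S} ⊆
      {v | (e v : EuclideanSpace ℝ (Fin 3)) ∈ P.face T} := by
  refine ⟨fun h v hv => h hv, fun h => face_subset_face fun v hnode hv => ?_⟩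
  obtain ⟨w, hw⟩ := e.surjective ⟨v, hnode⟩
  obtain rfl : (e w : EuclideanSpace ℝ (Fin 3)) = v := congrArg Subtype.val hw
  exact h hv

lemma combEquiv_of_incidence (h : ∀ v φ, g φ ∈ P.active (e v) ↔ φ ∈ DPolytope.facetsAt v) :
    CombEquiv P.faces (DPolytope.faces k) := by
  let vertexSet : P.faces → DPolytope.faces k := fun G =>
    ⟨{v | (e v : EuclideanSpace ℝ (Fin 3)) ∈ G.1}, by
      obtain ⟨S, hS⟩ := G.2
      rw [hS, ← face_eq_inter_iInter, setOf_mem_face_eq h]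
      exact ⟨_, rfl⟩⟩
  have hle : ∀ G H, vertexSet G ≤ vertexSet H ↔ G ≤ H := by
    rintro ⟨_, S, rfl⟩ ⟨_, T, rfl⟩
    simp only [vertexSet, Subtype.mk_le_mk, ← face_eq_inter_iInter]
    exact face_subset_face_iff.symm
  refine ⟨RelIso.ofSurjective (OrderEmbedding.ofMapLEIff vertexSet hle) ?_⟩
  rintro ⟨_, S, rfl⟩
  refine ⟨⟨P.face (g '' S), face_mem_faces _⟩, Subtype.ext ?_⟩
  refine (setOf_mem_face_eq h _).trans ?_
  rw [Equiv.preimage_image]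

end CombEquiv

end Dual

end ConvexPolytope

theorem mainTheorem5 (P : ConvexPolytope 3) (hP : P.IsFullerene) :
    ((∀ i, P.IsGon 5 i → ∃ B, P.IsBelt 5 B ∧ P.Surrounds B i) ∧
      {B | P.IsBelt 5 B ∧ P.SurroundsPentagon B}.ncard = 12) ∧
    (∀ B, P.IsBelt 5 B → ¬ P.SurroundsPentagon B →
      (∀ i ∈ B, P.IsGon 6 i) ∧
      ∃ k : ℕ, 1 ≤ k ∧ CombEquiv P.faces (DPolytope.faces k) ∧
        {C | P.IsBelt 5 C}.ncard = 12 + k) := by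
  obtain ⟨hS, hgon⟩ := hP
  set K := P.sphere hS
  have hfull : K.IsFullerene := fun i => (hgon i).imp hS.isGon_iff.1 hS.isGon_iff.1
  have hbelt : ∀ B, P.IsBelt 5 B ↔ B ∈ K.beltSets := Set.ext_iff.1 hS.setOf_isBelt
  refine ⟨⟨fun i hi => ?_, ?_⟩, fun B hB hnot => ?_⟩
  · have hlink : {z | K.Adj z i} ∈ K.pentagonLinks := ⟨i, hS.isGon_iff.1 hi, rfl⟩
    exact ⟨_, (hbelt _).2 (hfull.pentagonLinks_subset hlink), hS.surrounds_iff.2 rfl⟩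
  · simp only [hbelt, hS.surroundsPentagon_iff]
    rw [← hfull.ncard_pentagonLinks]
    exact congrArg Set.ncard (Set.inter_eq_right.2 hfull.pentagonLinks_subset)
  · rw [hS.surroundsPentagon_iff] at hnot
    obtain ⟨x, hx, rfl⟩ := (hbelt B).1 hB
    obtain ⟨hsix, k, b, t, f, hk, htube⟩ := hfull.exists_isTube_of_notMem_pentagonLinks hx hnot
    obtain ⟨g, e, hge⟩ := htube.exists_equiv
    refine ⟨?_, k, hk, ConvexPolytope.combEquiv_of_incidence hge, ?_⟩
    · rintro _ ⟨p, rfl⟩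
      exact hS.isGon_iff.2 (hsix p)
    · rw [hS.setOf_isBelt]
      exact htube.ncard_beltSets hfull
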